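/- **Setting.** Let $\Sigma$ be a finite signature of relation and constant symbols and let $\mathbb D$ be a $\Sigma$-structure with countably infinite domain. First-order logic is with equality. $\mathbb D$ is *oligomorphic* if for every $n$ the automorphism group of $\mathbb D$ has finitely many orbits on $\mathbb D^n$; it is *decidable* if the function $n\mapsto$ (number of orbits on $\mathbb D^n$) is computable and it is decidable whether a given first-order formula over $\Sigma$ is satisfied in $\mathbb D$ by some valuation of its free variables. It is *representable* if there are a finite alphabet $A$ and an injective map $\mathrm{enc}:\mathbb D\to A^*$ such that the set of codes of elements, the set of codes of constants, and, for every relation symbol, the set of tuples of codes of the tuples in the relation are decidable. An infinite word $x=x_1x_2\cdots\in\mathbb D^\omega$ is written on a tape as $\mathrm{enc}(x_1)\sharp\,\mathrm{enc}(x_2)\sharp\cdots$, with $\sharp\notin A$. A *non-deterministic register transducer* (NRT) over $\mathbb D$ has a finite set $Q$ of states with an initial state $q_0$ and a set $F\subseteq Q$ of final states, a finite set $R$ of registers, a constant symbol $c_r$ for each $r\in R$, and a finite set of transitions $(p,\varphi,q,\mathsf{upd},v)$, where $p,q\in Q$, $\varphi$ is a quantifier-free formula with variables in $R\uplus\{\mathsf{input}\}$,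 $\mathsf{upd}:R\to\{\mathsf{keep},\mathsf{set},\mathsf{guess}\}$ and $v\in R^*$. In state $p$ with register contents $\bar d\in\mathbb D^R$, reading $a\in\mathbb D$, the transition may be taken if $\varphi$ holds for $\bar d$ and $\mathsf{input}=a$; it leads to state $q$ and register contents $\bar d'$ with $\bar d'(r)=\bar d(r)$ if $\mathsf{upd}(r)=\mathsf{keep}$, $\bar d'(r)=a$ if $\mathsf{upd}(r)=\mathsf{set}$, and $\bar d'(r)$ arbitrary if $\mathsf{upd}(r)=\mathsf{guess}$; it outputs the word $\bar d'(v_1)\cdots\bar d'(v_{|v|})$. A run over an infinite input word is accepting if it starts in $q_0$ with register contents $(c_r^{\mathbb D})_r$ and visits $F$ infinitely often. A partial function $f:\mathbb D^\omega\rightharpoonup\mathbb D^\omega$ is *defined by* the NRT if its graph equals the set of pairs (input word, finite or infinite output word) of accepting runs. **Continuity.** Write $|x\wedge y|$ for the length of the longest common prefix. $f$ is *continuous* if for all $x\in\mathrm{dom}(f)$ and $i\in\mathbb N$ there is $j$ such that for all $y\in\mathrm{dom}(f)$, $|x\wedge y|\ge j$ implies $|f(x)\wedge f(y)|\ge i$.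 For $m:\mathbb N\to\mathbb N$, $f$ is *$m$-continuous* if for all $i$ and all $x,y\in\mathrm{dom}(f)$, $|x\wedge y|\ge m(i)$ implies $|f(x)\wedge f(y)|\ge i$. $f$ is *uniformly continuous* if it is $m$-continuous for some $m:\mathbb N\to\mathbb N$. **Computability.** Consider deterministic Turing machines with a read-only one-way input tape, which starts with a start marker followed by the encoding of the input word, a two-way working tape, and a write-only one-way output tape. A machine $M$ *computes* $f$ if for every $x\in\mathrm{dom}(f)$ the limit content of the output tape on input $x$ is the encoding of $f(x)$. Let $M(x,k)$ denote the (possibly infinite) output data word that $M$ writes on input $x$ while its input head has not gone beyond the encoding of the first $k$ data values of $x$. For $m:\mathbb N\to\mathbb N$, $f$ is *$m$-computable* if some $M$ computes $f$ and satisfies $|M(x,m(i))|\ge i$ for all $i\in\mathbb N$ and $x\in\mathrm{dom}(f)$. $f$ is *computable* if some $M$ computes it, and *uniformly computable* if it is $m$-computable for some computable $m$. **Theorem.** Let $\mathbb D$ be a decidable oligomorphic structure with a representation $\mathrm{enc}$, let $f:\mathbb D^\omega\rightharpoonup\mathbb D^\omega$ be a partial function defined by an NRT over $\mathbb D$, and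 let $m:\mathbb N\to\mathbb N$ be a total function. Then 1. $f$ is computable if and only if $f$ is continuous; 2. $f$ is uniformly computable if and only if $f$ is uniformly continuous; 3. $f$ is $m$-computable if and only if $f$ is $m$-continuous. -/

import Mathlib

open FirstOrder

namespace DataWord

/-! ### Oligomorphic and decidable structures -/

section Structures

variable (L : Language) (D : Type*) [L.Structure D]

/-- A signature that consists of relation symbols and constant symbols only. -/
def IsRelConst (L : Language) : Prop :=
  ∀ n : ℕ, IsEmpty (L.Functions (n + 1))

/-- Two `n`-tuples are equivalent if an automorphism of `D` maps one to the other. -/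
def orbitSetoid (n : ℕ) : Setoid (Fin n → D) where
  r v w := ∃ μ : D ≃[L] D, ∀ i, μ (v i) = w i
  iseqv :=
    { refl := fun _ => ⟨Language.Equiv.refl L D, fun _ => rfl⟩
      symm := fun {v w} ⟨μ, h⟩ => ⟨μ.symm, fun i => by
        rw [← h i]; exact μ.toEquiv.symm_apply_apply (v i)⟩
      trans := fun {u v w} ⟨μ, h⟩ ⟨ν, k⟩ => ⟨ν.comp μ, fun i => by
        rw [← k i, ← h i]; rfl⟩ }

/-- The set of orbits of `n`-tuples under the automorphism group of `D`. -/
abbrev Orbits (n : ℕ) : Type _ := Quotient (orbitSetoid L D n)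

/-- `D` is oligomorphic: for every `n` there are finitely many orbits of `n`-tuples. -/
def Oligomorphic : Prop := ∀ n : ℕ, Finite (Orbits L D n)

/-- The Ryll-Nardzewski function: the number of orbits of `n`-tuples. -/
noncomputable def ryllNardzewski (n : ℕ) : ℕ := Nat.card (Orbits L D n)

end Structures

section Codes

variable {L : Language} [Encodable (Σ n, L.Functions n)] [Encodable (Σ n, L.Relations n)]

/-- Gödel number of a term (free variables are indexed by `ℕ`), relative to a numbering of the
symbols of the signature. -/
def termCode {n : ℕ} : L.Term (ℕ ⊕ Fin n) → ℕ
  | .var (.inl i) => Nat.pair 0 i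
  | .var (.inr j) => Nat.pair 1 j
  | .func (l := l) g ts =>
      Nat.pair 2 (Nat.pair (Encodable.encode (⟨l, g⟩ : Σ n, L.Functions n))
        (Encodable.encode (List.ofFn fun i => termCode (ts i))))

/-- Gödel number of a first-order formula. -/
def formulaCode : {n : ℕ} → L.BoundedFormula ℕ n → ℕ
  | _, .falsum => Nat.pair 0 0
  | _, .equal t₁ t₂ => Nat.pair 1 (Nat.pair (termCode t₁) (termCode t₂))
  | _, .rel (l := l) R ts =>
      Nat.pair 2 (Nat.pair (Encodable.encode (⟨l, R⟩ : Σ n, L.Relations n))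
        (Encodable.encode (List.ofFn fun i => termCode (ts i))))
  | _, .imp φ ψ => Nat.pair 3 (Nat.pair (formulaCode φ) (formulaCode ψ))
  | _, .all φ => Nat.pair 4 (formulaCode φ)

end Codes

/-- The satisfiability problem over `D` is decidable: given (the code of) a first-order formula, one
can decide whether some valuation of its free variables makes it true in `D`. -/
def DecidableSat (L : Language) [Encodable (Σ n, L.Functions n)] [Encodable (Σ n, L.Relations n)]
    (D : Type*) [L.Structure D] : Prop :=
  ComputablePred fun c : ℕ =>
    ∃ φ : L.Formula ℕ, formulaCode φ = c ∧ ∃ v : ℕ → D, φ.Realize v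

/-- `D` is decidable: its Ryll-Nardzewski function is computable and first-order satisfiability over
`D` is decidable. -/
def DecidableStructure (L : Language) [Encodable (Σ n, L.Functions n)]
    [Encodable (Σ n, L.Relations n)] (D : Type*) [L.Structure D] : Prop :=
  Computable (ryllNardzewski L D) ∧ DecidableSat L D

/-- An effective representation of `D` by finite words over the finite alphabet `Fin size`: the
words that encode a data value, the words that encode a constant, and the tuples of words that
encode a tuple in a given relation form decidable sets. -/
structure Representation (L : Language) (D : Type*) [L.Structure D] where
  /-- size of the alphabet -/
  size : ℕ
  /-- the encoding -/
  enc : D → List (Fin size)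
  enc_injective : Function.Injective enc
  decidable_range : ComputablePred fun w : List (Fin size) => ∃ d, enc d = w
  decidable_constants : ComputablePred fun w : List (Fin size) => ∃ c : L.Constants, enc (c : D) = w
  decidable_rel : ∀ (k : ℕ) (P : L.Relations k),
    ComputablePred fun w : Fin k → List (Fin size) =>
      ∃ v : Fin k → D, Language.Structure.RelMap P v ∧ ∀ i, enc (v i) = w i

/-! ### Register transducers -/

/-- The operation that a transition performs on a register. -/
inductive RegOp
  | keep
  | set
  | guess

/-- A transition of a register transducer with states `Q` and registers `R`. Tests are
quantifier-free formulas over `R ⊎ {input}`; the variable `some r` is the register `r`, the variable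
`none` is the current input data value. -/
structure Transition (L : Language) (Q R : Type*) where
  source : Q
  test : L.Formula (Option R)
  test_isQF : test.IsQF
  target : Q
  update : R → RegOp
  output : List R

/-- A non-deterministic register transducer; `Q` and `R` are required to be finite where it is
used. -/
structure NRT (L : Language) (Q R : Type*) where
  /-- the transitions -/
  Δ : Set (Transition L Q R)
  finite_Δ : Δ.Finite
  /-- the initial state -/
  q₀ : Q
  /-- the constants that initialise the registers -/
  c₀ : R → L.Constants
  /-- the final states -/
  F : Set Q

/-- The infinite sequence `v 0, v 1, …` of finite words has concatenation `w`, where `w` is a finite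
word (`Sum.inl`) or an infinite word (`Sum.inr`). -/
def Produces {D : Type*} (v : ℕ → List D) : List D ⊕ (ℕ → D) → Prop
  | .inl u => ∃ N, ∀ n ≥ N, ((List.range n).map v).flatten = u
  | .inr y =>
      (∀ n, ∃ l, ((List.range n).map v).flatten = (List.range l).map y) ∧
        ∀ l, ∃ n, l ≤ ((List.range n).map v).flatten.length

namespace NRT

variable {L : Language} {Q R D : Type*} [L.Structure D]

/-- `C'` is a successor configuration of `C` by reading `d` and producing `w`. -/
def Step (T : NRT L Q R) (C : Q × (R → D)) (d : D) (w : List D) (C' : Q × (R → D)) : Prop :=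
  ∃ t ∈ T.Δ, t.source = C.1 ∧ t.target = C'.1 ∧
    t.test.Realize (fun a : Option R => a.elim d C.2) ∧
    (∀ r, t.update r = RegOp.keep → C'.2 r = C.2 r) ∧
    (∀ r, t.update r = RegOp.set → C'.2 r = d) ∧
    w = t.output.map C'.2

/-- The semantics of `T`: some accepting run of `T` over the infinite word `x` produces `w`. -/
def Rel (T : NRT L Q R) (x : ℕ → D) (w : List D ⊕ (ℕ → D)) : Prop :=
  ∃ (C : ℕ → Q × (R → D)) (v : ℕ → List D),
    C 0 = (T.q₀, fun r => (T.c₀ r : D)) ∧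
    (∀ n, T.Step (C n) (x n) (v n) (C (n + 1))) ∧
    (∃ᶠ n in Filter.atTop, (C n).1 ∈ T.F) ∧
    Produces v w

/-- The partial function `f` on infinite words is defined by `T`: the relation recognised by `T` is
the graph of `f`. -/
def Defines (T : NRT L Q R) (f : (ℕ → D) →. (ℕ → D)) : Prop :=
  ∀ (x : ℕ → D) (w : List D ⊕ (ℕ → D)), T.Rel x w ↔ ∃ y ∈ f x, w = .inr y

end NRT

/-! ### Continuity -/

/-- The longest common prefix of `x` and `y` has length at least `k`. -/
def Agree {A : Type*} (k : ℕ) (x y : ℕ → A) : Prop := ∀ i < k, x i = y i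

section Continuity

variable {A : Type*} (f : (ℕ → A) →. (ℕ → A))

/-- `f` is continuous at every point of its domain. -/
def IsContinuous : Prop :=
  ∀ x, ∀ x' ∈ f x, ∀ i, ∃ j, ∀ y, ∀ y' ∈ f y, Agree j x y → Agree i x' y'

/-- `m` is a modulus of continuity of `f`. -/
def IsMContinuous (m : ℕ → ℕ) : Prop :=
  ∀ i, ∀ x, ∀ x' ∈ f x, ∀ y, ∀ y' ∈ f y, Agree (m i) x y → Agree i x' y'

/-- `f` is uniformly continuous. -/
def IsUniformlyContinuous : Prop := ∃ m : ℕ → ℕ, IsMContinuous f m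

end Continuity

/-! ### Computability -/

section Encoding

variable {D : Type*} {n : ℕ} (enc : D → List (Fin n))

/-- The encoding `enc d₁ ♯ ⋯ enc dₖ ♯` of the first `k` letters of the infinite word `x`; the
separator `♯` is `none`. -/
def encPrefix (x : ℕ → D) (k : ℕ) : List (Option (Fin n)) :=
  ((List.range k).map fun i => (enc (x i)).map some ++ [none]).flatten

/-- The content of the input tape. Cell `0` is a start marker (`none`); it is followed by the
encoding of the infinite word `x`, that is, cell `p + 1` holds the symbol number `p` of
`enc d₁ ♯ enc d₂ ♯ ⋯`. (The encoding of `p + 1` letters has more than `p` symbols.) -/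
def inputCell (x : ℕ → D) : ℕ → Option (Option (Fin n))
  | 0 => none
  | p + 1 => (encPrefix enc x (p + 1))[p]?

end Encoding

/-- What a machine with states `Q` and working alphabet `Γ` does in one step. -/
structure Action (n : ℕ) (Q Γ : Type) where
  /-- the next state -/
  state : Q
  /-- the symbol written on the current cell of the working tape -/
  write : Γ
  /-- the move of the head on the working tape (`none`: it stays) -/
  move : Option Turing.Dir
  /-- whether the input head moves one cell to the right -/
  advance : Bool
  /-- the symbol appended to the output tape, if any; `some none` appends `♯` -/
  output : Option (Option (Fin n))

/-- A deterministic Turing machine with a read-only one-way input tape and a write-only one-way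
output tape, both over the alphabet `Fin n ⊎ {♯}` (with a start marker on the input tape), and a
two-way working tape over a finite alphabet `Γ`, whose blank symbol is `default`. -/
structure Machine (n : ℕ) where
  /-- the states -/
  Q : Type
  /-- the working alphabet -/
  Γ : Type
  [finite_Q : Finite Q]
  [finite_Γ : Finite Γ]
  [inhabited_Γ : Inhabited Γ]
  /-- the initial state -/
  q₀ : Q
  /-- the transition function; it depends on the state, the current input symbol and the current
  symbol of the working tape -/
  δ : Q → Option (Option (Fin n)) → Γ → Action n Q Γ

namespace Machine

attribute [instance] Machine.finite_Q Machine.finite_Γ Machine.inhabited_Γ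

variable {D : Type*} {n : ℕ}

/-- A configuration: state, working tape, position of the input head, content of the output tape. -/
structure Config (M : Machine n) where
  state : M.Q
  tape : Turing.Tape M.Γ
  pos : ℕ
  out : List (Option (Fin n))

/-- One step of the machine on the input word `x`. -/
def next (M : Machine n) (enc : D → List (Fin n)) (x : ℕ → D) (c : M.Config) : M.Config :=
  let a := M.δ c.state (inputCell enc x c.pos) c.tape.head
  { state := a.state
    tape := a.move.elim (c.tape.write a.write) fun dir => (c.tape.write a.write).move dir
    pos := if a.advance then c.pos + 1 else c.pos
    out := c.out ++ a.output.toList }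

/-- The configuration of the machine on the input word `x` after `t` steps. -/
def run (M : Machine n) (enc : D → List (Fin n)) (x : ℕ → D) : ℕ → M.Config
  | 0 => ⟨M.q₀, default, 0, []⟩
  | t + 1 => M.next enc x (M.run enc x t)

/-- `M` computes `f`: for every `x` in the domain of `f`, the limit content of the output tape
is the encoding of the infinite word `f x`. -/
def Computes (M : Machine n) (enc : D → List (Fin n)) (f : (ℕ → D) →. (ℕ → D)) : Prop :=
  ∀ x, ∀ y ∈ f x,
    (∀ t, ∃ l, (M.run enc x t).out <+: encPrefix enc y l) ∧
    ∀ l, ∃ t, encPrefix enc y l <+: (M.run enc x t).out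

/-- The output written on `x` while the input head has not gone beyond the encoding of the first `k`
data values of `x` contains at least `i` (complete) data values. This output may be infinite, if
the head never goes further. -/
def OutputLengthGE (M : Machine n) (enc : D → List (Fin n)) (x : ℕ → D) (k i : ℕ) : Prop :=
  ∃ t, (M.run enc x t).pos ≤ (encPrefix enc x k).length ∧ i ≤ (M.run enc x t).out.count none

end Machine

section Computability

variable {L : Language} {D : Type*} [L.Structure D] (ρ : Representation L D)
  (f : (ℕ → D) →. (ℕ → D))

/-- `f` is computable. -/
def IsComputable : Prop := ∃ M : Machine ρ.size, M.Computes ρ.enc f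

/-- `f` is `m`-computable: some machine that computes `f` writes at least `i` data values while it
has access to the first `m i` data values of the input only. -/
def IsMComputable (m : ℕ → ℕ) : Prop :=
  ∃ M : Machine ρ.size, M.Computes ρ.enc f ∧
    ∀ i, ∀ x, (f x).Dom → M.OutputLengthGE ρ.enc x (m i) i

/-- `f` is uniformly computable: it is `m`-computable for some computable `m`. -/
def IsUniformlyComputable : Prop := ∃ m : ℕ → ℕ, Computable m ∧ IsMComputable ρ f m

end Computability

end DataWord

/-!
That a computable function is continuous, with the same modulus, holds because a machine that has
not gone beyond a prefix of its input does the same on all inputs with this prefix.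

Conversely, let a register transducer define `f`. Up to automorphisms there are only finitely many
configurations, so there is a number `K` such that every configuration that admits a run with `K`
visits to final states admits runs with arbitrarily many visits, and hence an accepting run. Whether
`f` is determined at an output position by the first `j` input letters is therefore a question about
finite runs: it is not if there is a *mismatch*, a pair of finite runs, both with a continuation
that visits final states `K` times, that agree on `j` input letters and differ at this position.
Again by oligomorphicity, short runs suffice, and that one of the finitely many pairs of short
sequences of transitions can be filled in with data values to give a mismatch is the satisfiability
of a first-order formula. Hence mismatches are decidable.

A machine for `f` enumerates finite runs on the part of the input it has read, and writes the
output letter of such a run once mismatches are excluded. If `f` has a modulus of continuity, it can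
exclude mismatches of arbitrary runs. If `f` is merely continuous, no fixed number of letters need
suffice, and it only excludes mismatches of a run that begins with the same transitions as the run
at hand. For an accepting run on an input in the domain this succeeds eventually: otherwise, by
König's lemma, mismatching runs converge to a run with the same transitions, which is accepting, and
`f` is not continuous at its input.
-/

namespace DataWord

/-! ### Simulation of programs by machines -/

section Simulation

open Relation

/-- The trace `u` of pairs (head position, output written so far) simulates the trace `v`: all
observations of `v` occur in `u`, and what `u` writes in between is still a prefix of what `v`
writes. -/
def Simulates {P A : Type*} (u v : ℕ → P × List A) : Prop :=
  (∀ m, ∃ t, u t = v m) ∧ ∀ t, ∃ m, (u t).2 <+: (v m).2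

theorem Simulates.trans {P A : Type*} {u v w : ℕ → P × List A} (huv : Simulates u v)
    (hvw : Simulates v w) : Simulates u w := by
  refine ⟨fun k => ?_, fun t => ?_⟩
  · obtain ⟨m, hm⟩ := hvw.1 k
    obtain ⟨t, ht⟩ := huv.1 m
    exact ⟨t, ht.trans hm⟩
  · obtain ⟨m, hm⟩ := huv.2 t
    obtain ⟨k, hk⟩ := hvw.2 m
    exact ⟨k, hm.trans hk⟩

theorem exists_iterate_of_reflTransGen {C : Type*} {f : C → C} {a b : C}
    (h : ReflTransGen (f · = ·) a b) : ∃ k, f^[k] a = b := by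
  induction h with
  | refl => exact ⟨0, rfl⟩
  | tail _ hbc ih =>
    obtain ⟨k, hk⟩ := ih
    exact ⟨k + 1, by rw [Function.iterate_succ_apply', hk, hbc]⟩

theorem simulates_of_relation {C B P A : Type*} {f : C → C} {g : B → B} {obsC : C → P × List A}
    {obsB : B → P × List A} (S : C → B → Prop) {c₀ : C} {b₀ : B}
    (mono : ∀ c, (obsC c).2 <+: (obsC (f c)).2) (obs_eq : ∀ c b, S c b → obsC c = obsB b)
    (start : ∃ c, ReflTransGen (f · = ·) c₀ c ∧ S c b₀)
    (step : ∀ c b, S c b → ∃ c', TransGen (f · = ·) c c' ∧ S c' (g b)) :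
    Simulates (fun t => obsC (f^[t] c₀)) fun m => obsB (g^[m] b₀) := by
  have reached : ∀ m, ∃ t ≥ m, S (f^[t] c₀) (g^[m] b₀) := by
    intro m
    induction m with
    | zero =>
      obtain ⟨c, hc, hS⟩ := start
      obtain ⟨t, rfl⟩ := exists_iterate_of_reflTransGen hc
      exact ⟨t, t.zero_le, hS⟩
    | succ m ih =>
      obtain ⟨t, htm, hS⟩ := ih
      obtain ⟨c', hc', hS'⟩ := step _ _ hS
      obtain ⟨d, rfl, hd⟩ := TransGen.head'_iff.1 hc'
      obtain ⟨k, rfl⟩ := exists_iterate_of_reflTransGen hd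
      refine ⟨k + 1 + t, by omega, ?_⟩
      rwa [Function.iterate_add_apply, Function.iterate_succ_apply, Function.iterate_succ_apply']
  have out_mono : ∀ t k, (obsC (f^[t] c₀)).2 <+: (obsC (f^[t + k] c₀)).2 := by
    intro t k
    induction k with
    | zero => exact List.prefix_rfl
    | succ k ih => exact ih.trans (by rw [← add_assoc, Function.iterate_succ_apply']; exact mono _)
  refine ⟨fun m => ?_, fun t => ?_⟩
  · obtain ⟨t, -, hS⟩ := reached m
    exact ⟨t, obs_eq _ _ hS⟩
  · obtain ⟨s, hts, hS⟩ := reached t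
    obtain ⟨k, rfl⟩ := Nat.exists_eq_add_of_le hts
    exact ⟨t, (out_mono t k).trans (by simp only [obs_eq _ _ hS, List.prefix_rfl])⟩

/-- The alphabet `Fin n ⊎ {♯}` of the input and output tapes; `none` is the separator `♯`. -/
abbrev Symbol (n : ℕ) : Type := Option (Fin n)

/-- A program with states `σ` that works on a one-way input tape and a one-way output tape: from the
state and the content of the current input cell it determines the next state, whether the input head
advances, and the symbol written on the output tape, if any. -/
abbrev Program (n : ℕ) (σ : Type) : Type :=
  σ → Option (Symbol n) → σ × Bool × Option (Symbol n)

/-- A configuration of a program: state, position of the input head, content of the output tape. -/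
structure ProgramCfg (n : ℕ) (σ : Type) where
  state : σ
  pos : ℕ
  out : List (Symbol n)

namespace Program

variable {n : ℕ} {σ : Type} (δ : Program n σ) (cell : ℕ → Option (Symbol n))

/-- One step of a program on the input tape `cell`. -/
def step (c : ProgramCfg n σ) : ProgramCfg n σ :=
  let r := δ c.state (cell c.pos)
  ⟨r.1, if r.2.1 then c.pos + 1 else c.pos, c.out ++ r.2.2.toList⟩

/-- The position of the input head and the output of a program started in the state `s₀`, as
functions of time. -/
def trace (s₀ : σ) (t : ℕ) : ℕ × List (Symbol n) :=
  let c := (δ.step cell)^[t] ⟨s₀, 0, []⟩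
  (c.pos, c.out)

theorem simulates_trace {B : Type*} {g : B → B} {obs : B → ℕ × List (Symbol n)} {s₀ : σ} {b₀ : B}
    (S : ProgramCfg n σ → B → Prop) (obs_eq : ∀ c b, S c b → (c.pos, c.out) = obs b)
    (start : S ⟨s₀, 0, []⟩ b₀)
    (progress : ∀ c b, S c b → ∃ c', TransGen (δ.step cell · = ·) c c' ∧ S c' (g b)) :
    Simulates (δ.trace cell s₀) fun m => obs (g^[m] b₀) :=
  simulates_of_relation S (fun _ => List.prefix_append _ _) obs_eq ⟨_, .refl, start⟩ progress

end Program

namespace Machine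

variable {n : ℕ} {D : Type*} (M : Machine n) (enc : D → List (Fin n)) (x : ℕ → D)

/-- The position of the input head and the output of a machine, as functions of time. -/
def trace (t : ℕ) : ℕ × List (Symbol n) := ((M.run enc x t).pos, (M.run enc x t).out)

theorem run_eq_iterate (t : ℕ) :
    M.run enc x t = (M.next enc x)^[t] ⟨M.q₀, default, 0, []⟩ := by
  induction t with
  | zero => rfl
  | succ t ih => rw [Function.iterate_succ_apply', ← ih]; rfl

theorem simulates_trace {B : Type*} {g : B → B} {obs : B → ℕ × List (Symbol n)} {b₀ : B}
    (S : M.Config → B → Prop) (obs_eq : ∀ c b, S c b → (c.pos, c.out) = obs b)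
    (start : ∃ c, ReflTransGen (M.next enc x · = ·) ⟨M.q₀, default, 0, []⟩ c ∧ S c b₀)
    (progress : ∀ c b, S c b → ∃ c', TransGen (M.next enc x · = ·) c c' ∧ S c' (g b)) :
    Simulates (M.trace enc x) fun m => obs (g^[m] b₀) := by
  have h := simulates_of_relation (f := M.next enc x) (obsC := fun c : M.Config => (c.pos, c.out))
    S (fun _ => List.prefix_append _ _) obs_eq start progress
  simp only [← run_eq_iterate] at h
  exact h

end Machine

end Simulation

section Compile

open Turing StateTransition Relation
open Turing.PartrecToTM2 (Λ' Cont' K' trNormal trList)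

/-- The stack program of Mathlib for partial recursive functions, modified so that the symbol on
top of the main stack is in the store when the program halts. -/
def trPeek (q : Λ') : TM2.Stmt (fun _ : K' => PartrecToTM2.Γ') Λ' (Option PartrecToTM2.Γ') :=
  if q = Λ'.ret Cont'.halt then .peek K'.main (fun _ s => s) .halt else PartrecToTM2.tr q

theorem trPeek_halt : trPeek (Λ'.ret Cont'.halt) = .peek K'.main (fun _ s => s) .halt :=
  if_pos rfl

theorem trPeek_of_ne {q : Λ'} (hq : q ≠ Λ'.ret Cont'.halt) : trPeek q = PartrecToTM2.tr q :=
  if_neg hq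

theorem stepAux_tr_label_ne_none {q : Λ'} (hq : q ≠ Λ'.ret Cont'.halt)
    (s : Option PartrecToTM2.Γ') (S : ∀ _ : K', List PartrecToTM2.Γ') :
    (TM2.stepAux (PartrecToTM2.tr q) s S).l ≠ none := by
  cases q with
  | ret k =>
    cases k with
    | halt => exact absurd rfl hq
    | _ => simp [PartrecToTM2.tr, PartrecToTM2.pop']
  | _ =>
    simp only [PartrecToTM2.tr, PartrecToTM2.pop', PartrecToTM2.push', TM2.stepAux,
      PartrecToTM2.peek']
    repeat' first
      | (simp only [cond_eq_ite]; split_ifs)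
      | simp

theorem reaches_trPeek_of_reaches_tr {v : List ℕ} {a : PartrecToTM2.Cfg'}
    (h : Reaches (TM2.step PartrecToTM2.tr) a (PartrecToTM2.halt v)) (ha : a.l ≠ none) :
    Reaches (TM2.step trPeek) a ⟨none, (trList v).head?, K'.elim (trList v) [] [] []⟩ := by
  induction h using ReflTransGen.head_induction_on with
  | refl => exact absurd rfl ha
  | @head a b hab hb ih =>
    obtain ⟨_ | l, s, S⟩ := a
    · exact absurd rfl ha
    obtain rfl : TM2.stepAux (PartrecToTM2.tr l) s S = b := Option.some.inj hab
    by_cases hl : l = Λ'.ret Cont'.halt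
    · subst hl
      obtain h | ⟨_, hd, -⟩ := hb.cases_head
      · have hS : S = K'.elim (trList v) [] [] [] := congrArg TM2.Cfg.stk h
        exact .single (by simp [TM2.step, trPeek_halt, hS])
      · cases hd
    · refine .head ?_ (ih (stepAux_tr_label_ne_none hl s S))
      simp [TM2.step, trPeek_of_ne hl]

theorem reaches_trPeek {c : ToPartrec.Code} {v v' : List ℕ} (h : v' ∈ c.eval v) :
    Reaches (TM2.step trPeek)
      ⟨some (trNormal c Cont'.halt), none, K'.elim (trList v) [] [] []⟩
      ⟨none, (trList v').head?, K'.elim (trList v') [] [] []⟩ := by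
  have halts : PartrecToTM2.halt v' ∈
      eval (TM2.step PartrecToTM2.tr) (PartrecToTM2.init c v) := by
    rw [PartrecToTM2.tr_eval]
    exact (Part.mem_map_iff _).2 ⟨v', h, rfl⟩
  exact reaches_trPeek_of_reaches_tr (mem_eval.1 halts).1 (Option.some_ne_none _)

variable {ι : Type} [Fintype ι]

/-- The finite set of labels used to run the programs `c i`. -/
noncomputable def compileLabels (c : ι → ToPartrec.Code) : Finset Λ' :=
  insert (Λ'.ret Cont'.halt)
    (Finset.univ.biUnion fun i => PartrecToTM2.codeSupp (c i) Cont'.halt)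

theorem codeSupp_subset_compileLabels (c : ι → ToPartrec.Code) (i : ι) :
    PartrecToTM2.codeSupp (c i) Cont'.halt ⊆ compileLabels c :=
  (Finset.subset_biUnion_of_mem (fun i => PartrecToTM2.codeSupp (c i) Cont'.halt)
    (Finset.mem_univ i)).trans (Finset.subset_insert _ _)

theorem supports_compileLabels (c : ι → ToPartrec.Code) :
    TM2.Supports trPeek (compileLabels c) := by
  refine ⟨Finset.mem_insert_self _ _, fun q hq => ?_⟩
  by_cases h : q = Λ'.ret Cont'.halt
  · rw [h, trPeek_halt]
    trivial
  · rw [trPeek_of_ne h]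
    obtain ⟨i, -, hi⟩ := Finset.mem_biUnion.1 ((Finset.mem_insert.1 hq).resolve_left h)
    exact PartrecToTM2.codeSupp_supports (codeSupp_subset_compileLabels c i) q hi

/-- The single tape program that simulates `trPeek`. -/
abbrev tapeProg := TM2to1.tr trPeek

/-- The elementary program that simulates `trPeek`. -/
abbrev tapeMachine := TM1to0.tr tapeProg

/-- The tape alphabet. -/
abbrev TapeSymbol := TM2to1.Γ' K' (fun _ : K' => PartrecToTM2.Γ')

/-- The tape holds the list `v`, with the head at the bottom marker. -/
def HoldsList (v : List ℕ) (T : Tape TapeSymbol) : Prop :=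
  ∃ L : ListBlank (∀ _ : K', Option PartrecToTM2.Γ'),
    (∀ k, L.map (proj k) = ListBlank.mk ((K'.elim (trList v) [] [] [] k).map some).reverse) ∧
      T = Tape.mk' ∅ (TM2to1.addBottom L)

/-- The symbol on the first cell of a tape that holds the list `[0]`: the bottom marker, together
with the separator `cons` on the main stack. -/
def zeroSymbol : TapeSymbol :=
  (true, Function.update (fun _ => none) K'.main (some PartrecToTM2.Γ'.cons))

theorem holdsList_zero : HoldsList [0] ((default : Tape TapeSymbol).write zeroSymbol) := by
  refine ⟨ListBlank.mk [zeroSymbol.2], fun k => ?_, ?_⟩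
  · rw [ListBlank.map_mk]
    cases k
    case main => rfl
    all_goals exact Quotient.sound (.inr ⟨1, rfl⟩)
  · rfl

/-- The label at which the simulation of the program `c` starts. -/
def startLabel (c : ToPartrec.Code) : TM1to0.Λ' tapeProg :=
  (some (tapeProg (TM2to1.Λ'.normal (trNormal c Cont'.halt))), none)

theorem tapeMachine_reaches {c : ToPartrec.Code} {v v' : List ℕ} (h : v' ∈ c.eval v)
    {T : Tape TapeSymbol} (hT : HoldsList v T) :
    ∃ T', HoldsList v' T' ∧ Reaches (TM0.step tapeMachine)
      ⟨startLabel c, T⟩ ⟨(none, (trList v').head?), T'⟩ := by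
  obtain ⟨L, hL, rfl⟩ := hT
  obtain ⟨b, hb, hr⟩ := tr_reaches (TM2to1.tr_respects trPeek)
    (TM2to1.TrCfg.mk (q := some (trNormal c Cont'.halt)) (v := none) L hL) (reaches_trPeek h)
  obtain @⟨_, _, _, L', hL'⟩ := hb
  obtain ⟨b', rfl, hr'⟩ := tr_reaches (TM1to0.tr_respects tapeProg) rfl hr
  exact ⟨_, ⟨L', hL', rfl⟩, hr'⟩

/-- The finite set of labels of the elementary program used to run the programs `c i`. -/
noncomputable def machineLabels (c : ι → ToPartrec.Code) : Finset (TM1to0.Λ' tapeProg) :=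
  TM1to0.trStmts tapeProg (TM2to1.trSupp trPeek (compileLabels c))

theorem supports_machineLabels (c : ι → ToPartrec.Code) :
    TM0.Supports tapeMachine (machineLabels c : Set (TM1to0.Λ' tapeProg)) :=
  TM1to0.tr_supports _ (TM2to1.tr_supports _ (supports_compileLabels c))

theorem startLabel_mem (c : ι → ToPartrec.Code) (i : ι) : startLabel (c i) ∈ machineLabels c := by
  classical
  have normal_mem : trNormal (c i) Cont'.halt ∈ compileLabels c :=
    codeSupp_subset_compileLabels c i
      (PartrecToTM2.codeSupp_self _ _ (PartrecToTM2.trStmts₁_self _))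
  refine Finset.mem_product.2 ⟨?_, Finset.mem_univ _⟩
  refine Finset.some_mem_insertNone.2 (Finset.mem_biUnion.2 ⟨_, ?_, TM1.stmts₁_self⟩)
  exact Finset.mem_biUnion.2 ⟨_, normal_mem, Finset.mem_insert_self _ _⟩

theorem head?_trList_singleton (s : ℕ) :
    ((trList [s]).head? == some PartrecToTM2.Γ'.bit1) = s.bodd := by
  have head?_trPosNum (p : PosNum) :
      ((PartrecToTM2.trPosNum p ++ [PartrecToTM2.Γ'.cons]).head? ==
        some PartrecToTM2.Γ'.bit1) = (p : ℕ).bodd := by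
    cases p with
    | one => rfl
    | bit0 p => simp [PartrecToTM2.trPosNum, Nat.bodd_add]
    | bit1 p => simp [PartrecToTM2.trPosNum, Nat.bodd_add]
  change ((PartrecToTM2.trNum (s : Num) ++ [PartrecToTM2.Γ'.cons]).head? == _) = _
  conv_rhs => rw [← Num.to_of_nat s]
  cases (s : Num) with
  | zero => rfl
  | pos p => simpa [PartrecToTM2.trNum] using head?_trPosNum p

theorem exists_code_of_computable {F : ℕ → ℕ} (hF : Computable F) :
    ∃ c : ToPartrec.Code, ∀ s : ℕ, c.eval [s] = pure [F s] := by
  have h : Nat.Partrec' fun v : List.Vector ℕ 1 => (F v.head : Part ℕ) :=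
    Nat.Partrec'.part_iff.2 (hF.comp Computable.vector_head).partrec
  obtain ⟨c, hc⟩ := ToPartrec.Code.exists_code h
  exact ⟨c, fun s => by simpa [List.Vector.head] using hc ⟨[s], rfl⟩⟩

end Compile

section Driver

open Turing StateTransition Relation
open Turing.PartrecToTM2 (K' trList)

instance : Finite TapeSymbol :=
  have : Finite K' := .of_surjective ![.main, .rev, .aux, .stack] fun
    | .main => ⟨0, rfl⟩ | .rev => ⟨1, rfl⟩ | .aux => ⟨2, rfl⟩ | .stack => ⟨3, rfl⟩
  inferInstanceAs (Finite (Bool × (K' → Option PartrecToTM2.Γ')))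

variable {n : ℕ} {Φ : Type}

/-- The program that keeps a natural number in memory and goes through the phases `Φ`: in phase `φ`
the function `F φ` is applied to the memory, and the parity of the result and the current input
symbol determine the next phase and what is done with the input head and the output. -/
def controlProgram (F : Φ → ℕ → ℕ)
    (δ : Φ → Option (Symbol n) → Bool → Φ × Bool × Option (Symbol n)) : Program n (Φ × ℕ) :=
  fun s b => let r := δ s.1 b (F s.1 s.2).bodd; ((r.1, F s.1 s.2), r.2)

variable [Fintype Φ] (c : Φ → ToPartrec.Code)
  (δ : Φ → Option (Symbol n) → Bool → Φ × Bool × Option (Symbol n)) (φ₀ : Φ)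

/-- The state of `driver` in which the program `c φ` is started. -/
noncomputable def driverState (φ : Φ) : Option (Φ × machineLabels c) :=
  some (φ, ⟨startLabel (c φ), startLabel_mem c φ⟩)

/-- The machine that runs the programs `c φ` on a number kept on its tape, as directed by `δ`. When
a program halts, its label contains the top symbol of the main stack, hence the parity of the
result. -/
noncomputable def driver : Machine n :=
  open scoped Classical in
  { Q := Option (Φ × machineLabels c)
    Γ := TapeSymbol
    q₀ := none
    δ := fun q b a => match q with
      | none => ⟨driverState c φ₀, zeroSymbol, none, false, none⟩
      | some (φ, q) => match tapeMachine q.1 a with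
        | none =>
          let r := δ φ b (q.1.2 == some PartrecToTM2.Γ'.bit1)
          ⟨driverState c r.1, a, none, r.2.1, r.2.2⟩
        | some (q', s) =>
          let q'' := if h : q' ∈ machineLabels c then ⟨q', h⟩ else q
          match s with
          | .move d => ⟨some (φ, q''), a, some d, false, none⟩
          | .write a' => ⟨some (φ, q''), a', none, false, none⟩ }

/-- The configuration of `driver` with the given components. -/
def driverCfg (q : Option (Φ × machineLabels c)) (T : Tape TapeSymbol) (pos : ℕ)
    (out : List (Symbol n)) : (driver c δ φ₀).Config :=
  ⟨q, T, pos, out⟩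

variable {c δ φ₀} {D : Type*} {enc : D → List (Fin n)} {x : ℕ → D}

theorem driver_next_of_step {φ : Φ} {q q' : TM1to0.Λ' tapeProg} {T T' : Tape TapeSymbol}
    (hq : q ∈ machineLabels c) (h : (⟨q', T'⟩ : TM0.Cfg _ _) ∈ TM0.step tapeMachine ⟨q, T⟩)
    (pos : ℕ) (out : List (Symbol n)) :
    ∃ hq' : q' ∈ machineLabels c,
      (driver c δ φ₀).next enc x (driverCfg c δ φ₀ (some (φ, ⟨q, hq⟩)) T pos out) =
        driverCfg c δ φ₀ (some (φ, ⟨q', hq'⟩)) T' pos out := by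
  have hq' : q' ∈ machineLabels c := TM0.step_supports _ (supports_machineLabels c) h hq
  refine ⟨hq', ?_⟩
  obtain ⟨⟨p, s⟩, hp, he⟩ := Option.map_eq_some_iff.1 h
  cases s <;> cases he <;> simp only [Machine.next, driverCfg, driver, hp, hq', dif_pos] <;>
    congr 1 <;> exact List.append_nil out

theorem driver_reaches {φ : Φ} {a b : TM0.Cfg TapeSymbol (TM1to0.Λ' tapeProg)}
    (h : Reaches (TM0.step tapeMachine) a b) (ha : a.q ∈ machineLabels c) (pos : ℕ)
    (out : List (Symbol n)) :
    ∃ hb : b.q ∈ machineLabels c, ReflTransGen ((driver c δ φ₀).next enc x · = ·)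
      (driverCfg c δ φ₀ (some (φ, ⟨a.q, ha⟩)) a.Tape pos out)
      (driverCfg c δ φ₀ (some (φ, ⟨b.q, hb⟩)) b.Tape pos out) := by
  induction h with
  | refl => exact ⟨ha, .refl⟩
  | tail _ hbd ih =>
    obtain ⟨hb, hr⟩ := ih
    obtain ⟨hd, hn⟩ := driver_next_of_step hb hbd pos out
    exact ⟨hd, hr.tail hn⟩

theorem driver_next_of_halt {φ : Φ} {s : Option PartrecToTM2.Γ'}
    (hs : ((none, s) : TM1to0.Λ' tapeProg) ∈ machineLabels c) (T : Tape TapeSymbol) (pos : ℕ)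
    (out : List (Symbol n)) :
    (driver c δ φ₀).next enc x (driverCfg c δ φ₀ (some (φ, ⟨(none, s), hs⟩)) T pos out) =
      let r := δ φ (inputCell enc x pos) (s == some PartrecToTM2.Γ'.bit1)
      driverCfg c δ φ₀ (driverState c r.1) T (if r.2.1 then pos + 1 else pos)
        (out ++ r.2.2.toList) := by
  simp only [Machine.next, driverCfg, driver, TM1to0.tr]
  rfl

theorem driver_cycle {φ : Φ} {s s' : ℕ} (hs : (c φ).eval [s] = pure [s']) {T : Tape TapeSymbol}
    (hT : HoldsList [s] T) (pos : ℕ) (out : List (Symbol n)) :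
    let r := δ φ (inputCell enc x pos) s'.bodd
    ∃ T', HoldsList [s'] T' ∧ TransGen ((driver c δ φ₀).next enc x · = ·)
      (driverCfg c δ φ₀ (driverState c φ) T pos out)
      (driverCfg c δ φ₀ (driverState c r.1) T' (if r.2.1 then pos + 1 else pos)
        (out ++ r.2.2.toList)) := by
  obtain ⟨T', hT', hr⟩ := tapeMachine_reaches (v' := [s']) (by rw [hs]; exact Part.mem_some _) hT
  obtain ⟨hb, hrun⟩ := driver_reaches hr (startLabel_mem c φ) pos out
  refine ⟨T', hT', .tail' hrun ?_⟩
  rw [driver_next_of_halt, head?_trList_singleton]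

theorem exists_machine_simulates_controlProgram {Φ : Type} [Finite Φ] (F : Φ → ℕ → ℕ)
    (hF : ∀ φ, Computable (F φ))
    (δ : Φ → Option (Symbol n) → Bool → Φ × Bool × Option (Symbol n)) (φ₀ : Φ) :
    ∃ M : Machine n, ∀ {D : Type*} (enc : D → List (Fin n)) (x : ℕ → D),
      Simulates (M.trace enc x) ((controlProgram F δ).trace (inputCell enc x) (φ₀, 0)) := by
  have := Fintype.ofFinite Φ
  choose c hc using fun φ => exists_code_of_computable (hF φ)
  refine ⟨driver c δ φ₀, fun enc x => ?_⟩
  let S (C : (driver c δ φ₀).Config) (b : ProgramCfg n (Φ × ℕ)) : Prop :=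
    ∃ T, HoldsList [b.state.2] T ∧ C = driverCfg c δ φ₀ (driverState c b.state.1) T b.pos b.out
  refine Machine.simulates_trace _ enc x (obs := fun b => (b.pos, b.out)) S ?_ ?_ ?_
  · rintro _ b ⟨T, -, rfl⟩
    rfl
  · exact ⟨_, .single rfl, _, holdsList_zero, rfl⟩
  · rintro _ b ⟨T, hT, rfl⟩
    obtain ⟨T', hT', hrun⟩ := driver_cycle (hc b.state.1 b.state.2) hT b.pos b.out
    exact ⟨_, hrun, T', hT', rfl⟩

end Driver

section ProgramToMachine

open Relation

variable {n : ℕ} {σ : Type}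

/-- The phases in which a finite control performs one step of a program: read the input symbol,
compute the reaction to it, compare the symbol to be written with the symbols of the alphabet in
turn, and move the input head. -/
inductive ControlPhase (n : ℕ)
  | read
  | compute (b : Option (Symbol n))
  | emit (j : Fin (n + 1))
  | advance

instance : Finite (ControlPhase n) := by
  refine Finite.of_injective (β := Option (Symbol n) ⊕ Fin (n + 1) ⊕ Bool)
    (fun | .read => .inr (.inr false) | .compute b => .inl b | .emit j => .inr (.inl j)
         | .advance => .inr (.inr true)) ?_
  intro x y h
  cases x <;> cases y <;> simp_all

/-- The control that performs one step of a program in a cycle of phases. The parity of the memory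
is the answer to the question asked in the phases `emit` and `advance`. -/
def controlNext : ControlPhase n → Option (Symbol n) → Bool →
    ControlPhase n × Bool × Option (Symbol n)
  | .read, b, _ => (.compute b, false, none)
  | .compute _, _, _ => (.emit 0, false, none)
  | .emit j, _, true => (.advance, false, some (finSuccEquiv n j))
  | .emit j, _, false => (Fin.lastCases .advance (fun i => .emit i.succ) j, false, none)
  | .advance, _, t => (.read, t, none)

variable [Primcodable σ]

/-- The reaction of a program with initial state `s₀` that is coded by a number; the code `0` stands
for the beginning of the computation. -/
def decodeReaction (s₀ : σ) (k : ℕ) : σ × Bool × Option (Symbol n) :=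
  ((Encodable.decode (α := Option (σ × Bool × Option (Symbol n))) k).getD none).getD
    (s₀, false, none)

theorem decodeReaction_encode (s₀ : σ) (r : σ × Bool × Option (Symbol n)) :
    decodeReaction s₀ (Encodable.encode (some r)) = r := by
  simp [decodeReaction]

/-- The functions computed in the phases of the control: the memory consists of the code of the last
reaction of the program and of a parity bit. -/
def controlFun (δ : Program n σ) (s₀ : σ) : ControlPhase n → ℕ → ℕ
  | .read, m => m
  | .compute b, m =>
      Nat.bit false (Encodable.encode (some (δ (decodeReaction (n := n) s₀ m.div2).1 b)))
  | .emit j, m =>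
      Nat.bit (decide ((decodeReaction s₀ m.div2).2.2 = some (finSuccEquiv n j))) m.div2
  | .advance, m => Nat.bit (decodeReaction (n := n) s₀ m.div2).2.1 m.div2

theorem computable₂_bit : Computable₂ Nat.bit :=
  Computable.cond .fst (Primrec.nat_double_succ.to_comp.comp .snd)
    (Primrec.nat_double.to_comp.comp .snd)

theorem computable_controlFun {δ : Program n σ} (hδ : Computable₂ δ) (s₀ : σ) (φ : ControlPhase n) :
    Computable (controlFun δ s₀ φ) := by
  have hdecode : Computable (decodeReaction (n := n) s₀) :=
    Computable.option_getD (Computable.option_getD Computable.decode (.const none)) (.const _)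
  have hreaction := hdecode.comp Computable.nat_div2
  cases φ with
  | read => exact Computable.id
  | compute b =>
    exact computable₂_bit.comp (.const false) (Computable.encode.comp (Computable.option_some.comp
      (hδ.comp (Computable.fst.comp hreaction) (.const b))))
  | emit j =>
    refine computable₂_bit.comp ?_ Computable.nat_div2
    exact (Primrec.eq (α := Option (Symbol n))).decide.to_comp.comp
      (Computable.snd.comp (Computable.snd.comp hreaction)) (.const _)
  | advance =>
    exact computable₂_bit.comp (Computable.fst.comp (Computable.snd.comp hreaction))
      Computable.nat_div2

variable (δ : Program n σ) (s₀ : σ) (cell : ℕ → Option (Symbol n))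

/-- One step of the control of the program `δ` on the input tape `cell`. -/
abbrev controlStep : ProgramCfg n (ControlPhase n × ℕ) → ProgramCfg n (ControlPhase n × ℕ) :=
  (controlProgram (controlFun δ s₀) controlNext).step cell

theorem controlStep_emit_of_eq {k : ℕ} {j : Fin (n + 1)}
    (h : (decodeReaction s₀ k).2.2 = some (finSuccEquiv n j)) (t : Bool) (pos : ℕ)
    (out : List (Symbol n)) :
    controlStep δ s₀ cell ⟨(.emit j, Nat.bit t k), pos, out⟩ =
      ⟨(.advance, Nat.bit true k), pos, out ++ [finSuccEquiv n j]⟩ := by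
  simp [controlStep, Program.step, controlProgram, controlFun, h, controlNext]

theorem controlStep_emit_of_ne {k : ℕ} {j : Fin (n + 1)}
    (h : (decodeReaction s₀ k).2.2 ≠ some (finSuccEquiv n j)) (t : Bool) (pos : ℕ)
    (out : List (Symbol n)) :
    controlStep δ s₀ cell ⟨(.emit j, Nat.bit t k), pos, out⟩ =
      ⟨(Fin.lastCases .advance (fun i => .emit i.succ) j, Nat.bit false k), pos, out⟩ := by
  simp [controlStep, Program.step, controlProgram, controlFun, h, controlNext]

theorem controlStep_emit_reaches (k pos : ℕ) (out : List (Symbol n)) (j : Fin (n + 1))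
    (hj : ∀ i < j, (decodeReaction s₀ k).2.2 ≠ some (finSuccEquiv n i)) (t : Bool) :
    ∃ t', ReflTransGen (controlStep δ s₀ cell · = ·) ⟨(.emit j, Nat.bit t k), pos, out⟩
      ⟨(.advance, Nat.bit t' k), pos,
        out ++ (decodeReaction (n := n) s₀ k).2.2.toList⟩ := by
  induction j using Fin.reverseInduction generalizing t with
  | last =>
    by_cases h : (decodeReaction s₀ k).2.2 = some (finSuccEquiv n (Fin.last n))
    · exact ⟨true, .single (by rw [controlStep_emit_of_eq δ s₀ cell h, h, Option.toList_some])⟩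
    · have hnone : (decodeReaction (n := n) s₀ k).2.2 = none := by
        refine Option.eq_none_iff_forall_ne_some.2 fun a ha => ?_
        obtain ⟨i, rfl⟩ := (finSuccEquiv n).surjective a
        exact (Fin.le_last i).lt_or_eq.elim (fun hi => hj i hi ha) fun hi => h (hi ▸ ha)
      refine ⟨false, .single ?_⟩
      rw [controlStep_emit_of_ne δ s₀ cell h, hnone, Fin.lastCases_last, Option.toList_none,
        List.append_nil]
  | cast i ih =>
    by_cases h : (decodeReaction s₀ k).2.2 = some (finSuccEquiv n i.castSucc)
    · exact ⟨true, .single (by rw [controlStep_emit_of_eq δ s₀ cell h, h, Option.toList_some])⟩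
    · have hsucc : ∀ i' < i.succ, (decodeReaction s₀ k).2.2 ≠ some (finSuccEquiv n i') :=
        fun i' hi' => (Fin.le_castSucc_iff.2 hi').lt_or_eq.elim (hj i') fun hi => hi ▸ h
      obtain ⟨t', ht'⟩ := ih hsucc false
      refine ⟨t', .head ?_ ht'⟩
      rw [controlStep_emit_of_ne δ s₀ cell h, Fin.lastCases_castSucc]

theorem controlStep_cycle (t : Bool) (k pos : ℕ) (out : List (Symbol n)) :
    let r := δ (decodeReaction (n := n) s₀ k).1 (cell pos)
    ∃ t', TransGen (controlStep δ s₀ cell · = ·) ⟨(.read, Nat.bit t k), pos, out⟩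
      ⟨(.read, Nat.bit t' (Encodable.encode (some r))), if r.2.1 then pos + 1 else pos,
        out ++ r.2.2.toList⟩ := by
  intro r
  obtain ⟨t', ht'⟩ := controlStep_emit_reaches δ s₀ cell (Encodable.encode (some r)) pos out 0
    (fun i hi => absurd hi (Fin.not_lt_zero i)) false
  rw [decodeReaction_encode] at ht'
  refine ⟨r.2.1, .head (b := ⟨(.compute (cell pos), Nat.bit t k), pos, out⟩) ?_
    (.head' ?_ (ht'.tail ?_))⟩
  · simp [controlStep, Program.step, controlProgram, controlFun, controlNext]
  · simp [controlStep, Program.step, controlProgram, controlFun, controlNext, r]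
  · simp [controlStep, Program.step, controlProgram, controlFun, controlNext,
      decodeReaction_encode, -Encodable.encode_some]

variable {δ} in
theorem exists_machine_simulates_program (hδ : Computable₂ δ) :
    ∃ M : Machine n, ∀ {D : Type*} (enc : D → List (Fin n)) (x : ℕ → D),
      Simulates (M.trace enc x) (δ.trace (inputCell enc x) s₀) := by
  obtain ⟨M, hM⟩ := exists_machine_simulates_controlProgram (controlFun δ s₀)
    (computable_controlFun hδ s₀) controlNext .read
  refine ⟨M, fun enc x => (hM enc x).trans ?_⟩
  let S (C : ProgramCfg n (ControlPhase n × ℕ)) (b : ProgramCfg n σ) : Prop :=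
    ∃ t k, C = ⟨(.read, Nat.bit t k), b.pos, b.out⟩ ∧
      (decodeReaction (n := n) s₀ k).1 = b.state
  refine Program.simulates_trace _ _ (obs := fun b => (b.pos, b.out)) S ?_ ?_ ?_
  · rintro _ b ⟨t, k, rfl, -⟩
    rfl
  · exact ⟨false, 0, rfl, rfl⟩
  · rintro _ b ⟨t, k, rfl, hk⟩
    obtain ⟨t', hrun⟩ := controlStep_cycle δ s₀ (inputCell enc x) t k b.pos b.out
    rw [hk] at hrun
    exact ⟨_, hrun, t', _, rfl, by rw [decodeReaction_encode]; rfl⟩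

end ProgramToMachine

/-! ### Algorithms that read and write whole letters -/

section EncPrefix

variable {n : ℕ} {D : Type*} (enc : D → List (Fin n)) (x : ℕ → D)

theorem encPrefix_succ (k : ℕ) :
    encPrefix enc x (k + 1) = encPrefix enc x k ++ ((enc (x k)).map some ++ [none]) := by
  simp [encPrefix, List.range_succ]

theorem length_encPrefix_succ (k : ℕ) :
    (encPrefix enc x (k + 1)).length = (encPrefix enc x k).length + 1 + (enc (x k)).length := by
  simp only [encPrefix_succ, List.length_append, List.length_map, List.length_singleton]
  omega

theorem encPrefix_prefix {k l : ℕ} (h : k ≤ l) : encPrefix enc x k <+: encPrefix enc x l := by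
  induction l, h using Nat.le_induction with
  | base => exact List.prefix_rfl
  | succ l _ ih => rw [encPrefix_succ]; exact ih.trans (List.prefix_append _ _)

theorem le_length_encPrefix (k : ℕ) : k ≤ (encPrefix enc x k).length := by
  induction k with
  | zero => exact Nat.zero_le _
  | succ k ih => rw [length_encPrefix_succ]; omega

theorem inputCell_succ {p k : ℕ} (h : p < (encPrefix enc x k).length) :
    inputCell enc x (p + 1) = (encPrefix enc x k)[p]? := by
  have hp : p < (encPrefix enc x (p + 1)).length := le_length_encPrefix enc x (p + 1)
  simp only [inputCell]
  rcases le_total k (p + 1) with hk | hk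
  · obtain ⟨t, ht⟩ := encPrefix_prefix enc x hk
    rw [← ht, List.getElem?_append_left h]
  · obtain ⟨t, ht⟩ := encPrefix_prefix enc x hk
    rw [← ht, List.getElem?_append_left hp]

theorem inputCell_letter {k i : ℕ} (hi : i ≤ (enc (x k)).length) :
    inputCell enc x ((encPrefix enc x k).length + 1 + i) = some (enc (x k))[i]? := by
  rw [Nat.add_right_comm, inputCell_succ enc x (k := k + 1)
    (by rw [length_encPrefix_succ]; omega), encPrefix_succ,
    List.getElem?_append_right (by omega), Nat.add_sub_cancel_left]
  rcases hi.lt_or_eq with h | rfl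
  · simp [List.getElem?_append_left, h]
  · simp

end EncPrefix

section LetterAlgorithm

open Relation

variable {n : ℕ} {D : Type*}

/-- A configuration of an algorithm that reads and writes whole letters: the numbers of letters read
and written, the number of failed searches since a letter was written, the output. -/
structure LetterCfg (n : ℕ) where
  read : ℕ
  written : ℕ
  counter : ℕ
  out : List (Symbol n)

/-- The codes of the first `j` letters of `x`. -/
def letterNames (enc : D → List (Fin n)) (x : ℕ → D) (j : ℕ) : List (List (Fin n)) :=
  (List.range j).map fun i => enc (x i)

theorem length_letterNames (enc : D → List (Fin n)) (x : ℕ → D) (j : ℕ) :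
    (letterNames enc x j).length = j := by
  simp [letterNames]

theorem letterNames_succ (enc : D → List (Fin n)) (x : ℕ → D) (j : ℕ) :
    letterNames enc x (j + 1) = letterNames enc x j ++ [enc (x j)] := by
  simp [letterNames, List.range_succ]

variable (chk : List (List (Fin n)) × ℕ × ℕ → Option (List (Fin n))) (rd : ℕ × ℕ → Bool)

/-- One step of an algorithm on letters: given the letters read, the number of letters written and
the counter, write a letter if `chk` finds one; otherwise increase the counter, and read a letter
if `rd` says so. -/
def letterStep (enc : D → List (Fin n)) (x : ℕ → D) (c : LetterCfg n) : LetterCfg n :=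
  match chk (letterNames enc x c.read, c.written, c.counter) with
  | some w => ⟨c.read, c.written + 1, 0, c.out ++ (w.map some ++ [none])⟩
  | none => ⟨bif rd (c.read, c.written) then c.read + 1 else c.read, c.written, c.counter + 1,
      c.out⟩

/-- The run of an algorithm on letters. -/
def letterRun (enc : D → List (Fin n)) (x : ℕ → D) (k : ℕ) : LetterCfg n :=
  (letterStep chk rd enc x)^[k] ⟨0, 0, 0, []⟩

/-- The states of the program that implements an algorithm on letters: the argument of the next
search, the output still to be written, and, while a letter is being read, the part of its code that
has been seen. -/
abbrev LetterState (n : ℕ) : Type :=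
  (List (List (Fin n)) × ℕ × ℕ) × List (Symbol n) × Option (List (Fin n))

/-- The state after a search for a letter with argument `τ`. -/
def letterSearch (τ : List (List (Fin n)) × ℕ × ℕ) : LetterState n :=
  match chk τ with
  | some w => ((τ.1, τ.2.1 + 1, 0), w.map some ++ [none], none)
  | none => ((τ.1, τ.2.1, τ.2.2 + 1), [], bif rd (τ.1.length, τ.2.1) then some [] else none)

/-- The reaction to an input cell while a letter is being read. -/
def letterRead (τ : List (List (Fin n)) × ℕ × ℕ) (w : List (Fin n)) (cell : Option (Symbol n)) :
    LetterState n × Bool × Option (Symbol n) :=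
  match cell.join with
  | some a => ((τ, [], some (w ++ [a])), true, none)
  | none => (((τ.1 ++ [w], τ.2), [], none), false, none)

/-- The program that implements an algorithm on letters. -/
def letterProgram : Program n (LetterState n)
  | (τ, a :: l, b), _ => ((τ, l, b), false, some a)
  | (τ, [], some w), cell => letterRead τ w cell
  | (τ, [], none), _ => (letterSearch chk rd τ, (letterSearch chk rd τ).2.2.isSome, none)

variable {chk rd}

theorem computable_letterSearch (hchk : Computable chk) (hrd : Computable rd) :
    Computable (letterSearch chk rd) := by
  let T := List (List (Fin n)) × ℕ × ℕ
  have hfound : Computable₂ fun (τ : T) (w : List (Fin n)) =>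
      (((τ.1, τ.2.1 + 1, 0), w.map some ++ [none], none) : LetterState n) :=
    (Primrec.pair
      (Primrec.pair (Primrec.fst.comp Primrec.fst)
        (Primrec.pair (Primrec.succ.comp (Primrec.fst.comp (Primrec.snd.comp Primrec.fst)))
          (Primrec.const 0)))
      (Primrec.pair
        (Primrec.list_append.comp
          (Primrec.list_map Primrec.snd (Primrec.option_some.comp Primrec.snd).to₂)
          (Primrec.const [none]))
        (Primrec.const none))).to_comp
  have hread : Computable fun τ : T => rd (τ.1.length, τ.2.1) :=
    hrd.comp ((Computable.list_length.comp Computable.fst).pair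
      (Computable.fst.comp Computable.snd))
  have hfail : Computable fun τ : T => (((τ.1, τ.2.1, τ.2.2 + 1), [],
      bif rd (τ.1.length, τ.2.1) then some [] else none) : LetterState n) :=
    (Computable.fst.pair ((Computable.fst.comp Computable.snd).pair
      (Computable.succ.comp (Computable.snd.comp Computable.snd)))).pair
      ((Computable.const []).pair
        (Computable.cond hread (Computable.const (some [])) (Computable.const none)))
  exact (Computable.option_casesOn hchk hfail hfound).of_eq fun τ => by
    unfold letterSearch
    cases chk τ <;> rfl

theorem primrec_letterRead :
    Primrec fun p : ((List (List (Fin n)) × ℕ × ℕ) × List (Fin n)) × Option (Symbol n) =>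
      letterRead p.1.1 p.1.2 p.2 := by
  let T := ((List (List (Fin n)) × ℕ × ℕ) × List (Fin n)) × Option (Symbol n)
  have hsearch : Primrec fun p : T => p.1.1 := Primrec.fst.comp Primrec.fst
  have hbuffer : Primrec fun p : T => p.1.2 := Primrec.snd.comp Primrec.fst
  have hjoin : Primrec fun p : T => p.2.join :=
    (Primrec.option_bind Primrec.snd Primrec₂.right).of_eq fun p => by
      rcases p.2 with _ | _ | _ <;> rfl
  have hend : Primrec fun p : T =>
      ((((p.1.1.1 ++ [p.1.2], p.1.1.2), [], none), false, none) :
        LetterState n × Bool × Option (Symbol n)) :=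
    Primrec.pair (Primrec.pair (Primrec.pair
        (Primrec.list_concat.comp (Primrec.fst.comp hsearch) hbuffer) (Primrec.snd.comp hsearch))
      (Primrec.const ([], none))) (Primrec.const (false, none))
  have hsymbol : Primrec₂ fun (p : T) (a : Fin n) =>
      (((p.1.1, [], some (p.1.2 ++ [a])), true, none) :
        LetterState n × Bool × Option (Symbol n)) :=
    Primrec.pair (Primrec.pair (hsearch.comp Primrec.fst) (Primrec.pair (Primrec.const [])
      (Primrec.option_some.comp (Primrec.list_concat.comp (hbuffer.comp Primrec.fst)
        Primrec.snd)))) (Primrec.const (true, none))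
  refine (Primrec.option_casesOn hjoin hend hsymbol).of_eq fun p => ?_
  unfold letterRead
  cases p.2.join <;> rfl

theorem computable_letterProgram (hchk : Computable chk) (hrd : Computable rd) :
    Computable₂ (letterProgram chk rd) := by
  let T := LetterState n × Option (Symbol n)
  have hsearch : Computable fun p : T => p.1.1 := Computable.fst.comp Computable.fst
  have hpending : Computable fun p : T => p.1.2.1 :=
    Computable.fst.comp (Computable.snd.comp Computable.fst)
  have hbuffer : Computable fun p : T => p.1.2.2 :=
    Computable.snd.comp (Computable.snd.comp Computable.fst)
  have hfound : Computable fun p : T => letterSearch chk rd p.1.1 :=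
    (computable_letterSearch hchk hrd).comp hsearch
  have hidle : Computable fun p : T => ((letterSearch chk rd p.1.1,
      (letterSearch chk rd p.1.1).2.2.isSome, none) : LetterState n × Bool × Option (Symbol n)) :=
    hfound.pair ((Primrec.option_isSome.to_comp.comp
      (Computable.snd.comp (Computable.snd.comp hfound))).pair (Computable.const none))
  have hargs : Computable fun q : T × List (Fin n) => ((q.1.1.1, q.2), q.1.2) :=
    ((hsearch.comp Computable.fst).pair Computable.snd).pair (Computable.snd.comp Computable.fst)
  have hread : Computable₂ fun (p : T) (w : List (Fin n)) => letterRead p.1.1 w p.2 :=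
    (primrec_letterRead.to_comp.comp hargs).to₂
  have hflush : Computable₂ fun (p : T) (a : Symbol n) =>
      (((p.1.1, p.1.2.1.tail, p.1.2.2), false, some a) :
        LetterState n × Bool × Option (Symbol n)) :=
    ((hsearch.comp Computable.fst).pair ((Primrec.list_tail.to_comp.comp
      (hpending.comp Computable.fst)).pair (hbuffer.comp Computable.fst))).pair
      ((Computable.const false).pair (Computable.option_some.comp Computable.snd))
  have hreact := Computable.option_casesOn hbuffer hidle hread
  refine (Computable.option_casesOn (Primrec.list_head?.to_comp.comp hpending) hreact
    hflush).of_eq ?_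
  rintro ⟨⟨τ, _ | ⟨a, l⟩, _ | w⟩, cell⟩ <;> rfl

section Trace

variable (enc : D → List (Fin n)) (x : ℕ → D)

variable (chk rd) in
theorem letterProgram_flush (τ : List (List (Fin n)) × ℕ × ℕ) (l : List (Symbol n)) (pos : ℕ)
    (out : List (Symbol n)) :
    ReflTransGen ((letterProgram chk rd).step (inputCell enc x) · = ·)
      ⟨(τ, l, none), pos, out⟩ ⟨(τ, [], none), pos, out ++ l⟩ := by
  induction l generalizing out with
  | nil => rw [List.append_nil]
  | cons a l ih =>
    rw [List.append_cons]
    exact .head rfl (ih _)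

variable (chk rd) in
theorem letterProgram_read (τ : List (List (Fin n)) × ℕ × ℕ) (out : List (Symbol n)) {k : ℕ}
    {v w : List (Fin n)} (h : v ++ w = enc (x k)) :
    ReflTransGen ((letterProgram chk rd).step (inputCell enc x) · = ·)
      ⟨(τ, [], some v), (encPrefix enc x k).length + 1 + v.length, out⟩
      ⟨((τ.1 ++ [enc (x k)], τ.2), [], none), (encPrefix enc x (k + 1)).length, out⟩ := by
  have hcell := inputCell_letter enc x (k := k) (i := v.length)
    (by rw [← h, List.length_append]; omega)
  induction w generalizing v with
  | nil =>
    rw [List.append_nil] at h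
    refine .single ?_
    simp only [Program.step, letterProgram, hcell, letterRead]
    simp [h, length_encPrefix_succ]
  | cons a w ih =>
    have h' : (v ++ [a]) ++ w = enc (x k) := by rw [← h, ← List.append_cons]
    refine .head ?_ (ih h' (inputCell_letter enc x
      (by rw [← h', List.length_append (as := v ++ [a])]; omega)))
    simp only [Program.step, letterProgram, hcell, letterRead]
    simp [← h, Nat.add_assoc]

theorem exists_machine_simulates_letterRun (hchk : Computable chk) (hrd : Computable rd) :
    ∃ M : Machine n, ∀ {D : Type*} (enc : D → List (Fin n)) (x : ℕ → D),
      Simulates (M.trace enc x) fun k =>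
        let c := letterRun chk rd enc x k
        ((encPrefix enc x c.read).length, c.out) := by
  obtain ⟨M, hM⟩ := exists_machine_simulates_program (([], 0, 0), [], none)
    (computable_letterProgram hchk hrd)
  refine ⟨M, fun enc x => (hM enc x).trans ?_⟩
  let idle (b : LetterCfg n) : ProgramCfg n (LetterState n) :=
    ⟨((letterNames enc x b.read, b.written, b.counter), [], none),
      (encPrefix enc x b.read).length, b.out⟩
  refine Program.simulates_trace _ _ (obs := fun b : LetterCfg n =>
    ((encPrefix enc x b.read).length, b.out)) (fun c b => c = idle b) ?_ rfl ?_
  · rintro _ b rfl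
    rfl
  rintro _ b rfl
  refine ⟨_, ?_, rfl⟩
  cases hc : chk (letterNames enc x b.read, b.written, b.counter) with
  | some w =>
    simp only [idle, letterStep, hc]
    refine .head' ?_ (letterProgram_flush chk rd enc x _ _ _ _)
    simp [Program.step, letterProgram, letterSearch, hc]
  | none =>
    cases hr : rd (b.read, b.written) with
    | false =>
      refine .single ?_
      simp [idle, letterStep, Program.step, letterProgram, letterSearch, hc, hr,
        length_letterNames]
    | true =>
      simp only [idle, letterStep, hc, hr, cond_true, letterNames_succ]
      refine .head' ?_ (letterProgram_read chk rd enc x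
        (letterNames enc x b.read, b.written, b.counter + 1) b.out (v := []) rfl)
      simp [Program.step, letterProgram, letterSearch, hc, hr, length_letterNames]

end Trace

end LetterAlgorithm

/-! ### Computable functions are continuous -/

section Locality

variable {D : Type*} {n : ℕ} {enc : D → List (Fin n)}

theorem encPrefix_congr {x y : ℕ → D} {k : ℕ} (h : Agree k x y) :
    encPrefix enc x k = encPrefix enc y k := by
  unfold encPrefix
  congr 1
  exact List.map_congr_left fun i hi => by rw [h i (List.mem_range.1 hi)]

theorem inputCell_congr {x y : ℕ → D} {k p : ℕ} (h : Agree k x y)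
    (hp : p ≤ (encPrefix enc x k).length) : inputCell enc x p = inputCell enc y p := by
  have he := encPrefix_congr (enc := enc) h
  cases p with
  | zero => rfl
  | succ p => rw [inputCell_succ enc x hp, inputCell_succ enc y (he ▸ hp), he]

theorem Machine.run_pos_le_succ (M : Machine n) (x : ℕ → D) (t : ℕ) :
    (M.run enc x t).pos ≤ (M.run enc x (t + 1)).pos := by
  simp only [Machine.run, Machine.next]
  split <;> omega

theorem Machine.run_congr (M : Machine n) {x y : ℕ → D} {k t : ℕ} (h : Agree k x y)
    (ht : (M.run enc x t).pos ≤ (encPrefix enc x k).length) : M.run enc x t = M.run enc y t := by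
  induction t with
  | zero => rfl
  | succ t ih =>
    have hpos := (M.run_pos_le_succ x t).trans ht
    simp only [Machine.run, Machine.next]
    rw [← ih hpos, inputCell_congr h hpos]

theorem count_none_letter (d : D) : ((enc d).map some).count none = 0 :=
  List.count_eq_zero.2 (by simp)

theorem count_encPrefix (x : ℕ → D) (k : ℕ) : (encPrefix enc x k).count none = k := by
  induction k with
  | zero => rfl
  | succ k ih =>
    rw [encPrefix_succ, List.count_append, List.count_append, ih, count_none_letter,
      List.count_singleton_self, zero_add]

theorem encPrefix_prefix_of_le_count {x : ℕ → D} {l i : ℕ} {u : List (Symbol n)}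
    (hu : u <+: encPrefix enc x l) (hi : i ≤ u.count none) : encPrefix enc x i <+: u := by
  have hil : i ≤ l := (hi.trans (hu.sublist.count_le none)).trans_eq (count_encPrefix x l)
  rcases List.prefix_or_prefix_of_prefix (encPrefix_prefix enc x hil) hu with h | h
  · exact h
  cases i with
  | zero => exact List.nil_prefix
  | succ i =>
    rw [encPrefix_succ, ← List.append_assoc] at h ⊢
    rcases List.prefix_concat_iff.1 h with rfl | h
    · exact List.prefix_rfl
    · have hcount := h.sublist.count_le none
      rw [List.count_append, count_encPrefix, count_none_letter] at hcount
      omega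

theorem agree_of_encPrefix_prefix (henc : Function.Injective enc) {x y : ℕ → D} {i l : ℕ}
    (h : encPrefix enc x i <+: encPrefix enc y l) : Agree i x y := by
  induction i with
  | zero => exact fun j hj => absurd hj (Nat.not_lt_zero j)
  | succ i ih =>
    have hagree := ih ((encPrefix_prefix enc x (Nat.le_succ i)).trans h)
    have hprefix : encPrefix enc y (i + 1) <+: encPrefix enc x (i + 1) :=
      encPrefix_prefix_of_le_count h (count_encPrefix x (i + 1)).ge
    rw [encPrefix_succ, encPrefix_succ, encPrefix_congr hagree, List.prefix_append_right_inj,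
      List.prefix_concat_iff] at hprefix
    have hletter : enc (y i) = enc (x i) := by
      rcases hprefix with heq | hprefix
      · exact List.map_injective_iff.2 (Option.some_injective _) (List.append_cancel_right heq)
      · have := hprefix.subset (List.mem_append_right _ (List.mem_singleton_self none))
        simp at this
    intro j hj
    rcases Nat.lt_succ_iff_lt_or_eq.1 hj with hj | rfl
    · exact hagree j hj
    · exact (henc hletter).symm

variable {f : (ℕ → D) →. (ℕ → D)} {M : Machine n}

theorem Machine.Computes.agree (henc : Function.Injective enc) (hM : M.Computes enc f)
    {x y x' y' : ℕ → D} (hx : x' ∈ f x) (hy : y' ∈ f y) {k i t : ℕ} (h : Agree k x y)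
    (ht : (M.run enc x t).pos ≤ (encPrefix enc x k).length)
    (hi : i ≤ (M.run enc x t).out.count none) : Agree i x' y' := by
  obtain ⟨l, hl⟩ := (hM x x' hx).1 t
  obtain ⟨l', hl'⟩ := (hM y y' hy).1 t
  rw [← M.run_congr h ht] at hl'
  exact agree_of_encPrefix_prefix henc ((encPrefix_prefix_of_le_count hl hi).trans hl')

end Locality

section Converse

variable {L : Language} {D : Type*} [L.Structure D] {ρ : Representation L D}
  {f : (ℕ → D) →. (ℕ → D)}

theorem IsComputable.isContinuous (h : IsComputable ρ f) : IsContinuous f := by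
  obtain ⟨M, hM⟩ := h
  intro x x' hx i
  obtain ⟨t, ht⟩ := (hM x x' hx).2 i
  have hi := ht.sublist.count_le none
  rw [count_encPrefix] at hi
  exact ⟨(M.run ρ.enc x t).pos, fun y y' hy hxy => hM.agree ρ.enc_injective hx hy hxy
    (le_length_encPrefix ρ.enc x _) hi⟩

theorem IsMComputable.isMContinuous {m : ℕ → ℕ} (h : IsMComputable ρ f m) : IsMContinuous f m := by
  obtain ⟨M, hM, hm⟩ := h
  intro i x x' hx y y' hy hxy
  obtain ⟨t, ht, hi⟩ := hm i x (Part.dom_iff_mem.2 ⟨x', hx⟩)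
  exact hM.agree ρ.enc_injective hx hy hxy ht hi

theorem IsUniformlyComputable.isUniformlyContinuous (h : IsUniformlyComputable ρ f) :
    IsUniformlyContinuous f := by
  obtain ⟨m, -, hm⟩ := h
  exact ⟨m, hm.isMContinuous⟩

end Converse

/-! ### Compactness of oligomorphic structures -/

section Orbits

variable {L : Language} {D : Type*} [L.Structure D]

theorem exists_infinite_orbit (hD : Oligomorphic L D) {X : Type*} [Finite X] (v : ℕ → X → D) :
    ∃ N₀, ∀ N, ∃ N' ≥ N, ∃ μ : D ≃[L] D, ∀ x, μ (v N' x) = v N₀ x := by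
  obtain ⟨m, ⟨ε⟩⟩ := Finite.exists_equiv_fin X
  have := hD m
  let c : ℕ → Orbits L D m := fun N => Quotient.mk (orbitSetoid L D m) (v N ∘ ε.symm)
  obtain ⟨o, ho⟩ := Finite.exists_infinite_fiber c
  have hinf : (c ⁻¹' {o}).Infinite := Set.infinite_coe_iff.1 ho
  obtain ⟨N₀, hN₀⟩ := hinf.nonempty
  refine ⟨N₀, fun N => ?_⟩
  obtain ⟨N', hN', hle⟩ := hinf.exists_gt N
  obtain ⟨μ, hμ⟩ := Quotient.exact (s := orbitSetoid L D m) (hN'.trans hN₀.symm : c N' = c N₀)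
  exact ⟨N', hle.le, μ, fun x => by simpa using hμ (ε x)⟩

theorem exists_bound_of_invariant (hD : Oligomorphic L D) {X : Type*} [Finite X]
    {S : ℕ → (X → D) → Prop} (hS : ∀ (μ : D ≃[L] D) l v, S l v → S l (μ ∘ v)) :
    ∃ K, ∀ v, (∃ l, S l v) → ∃ l ≤ K, S l v := by
  by_contra! h
  choose v hv hn using h
  choose l hl using hv
  obtain ⟨N₀, hN₀⟩ := exists_infinite_orbit hD v
  obtain ⟨N', hN', μ, hμ⟩ := hN₀ (l N₀)
  have hvN' : v N' = μ.symm ∘ v N₀ := by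
    funext x
    simp only [Function.comp_apply, ← hμ x]
    exact (μ.toEquiv.symm_apply_apply _).symm
  exact hn N' (l N₀) hN' (hvN' ▸ hS _ _ _ (hl N₀))

theorem exists_bound_of_invariant_of_finite (hD : Oligomorphic L D) {Q X : Type*} [Finite Q]
    [Finite X] {S : ℕ → Q → (X → D) → Prop}
    (hS : ∀ (μ : D ≃[L] D) l q v, S l q v → S l q (μ ∘ v)) :
    ∃ K, ∀ q v, (∃ l, S l q v) → ∃ l ≤ K, S l q v := by
  choose K hK using fun q => exists_bound_of_invariant hD fun μ l v => hS μ l q v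
  obtain ⟨B, hB⟩ := (Set.finite_range K).bddAbove
  refine ⟨B, fun q v h => ?_⟩
  obtain ⟨l, hl, hlv⟩ := hK q v h
  exact ⟨l, hl.trans (hB ⟨q, rfl⟩), hlv⟩

theorem exists_limit_of_extensions {A : Type*} {E : ℕ → (ℕ → A) → Prop} (hzero : ∃ v, E 0 v)
    (hsucc : ∀ n v, E n v → ∃ w, E (n + 1) w ∧ ∀ s < n, w s = v s) :
    ∃ v : ℕ → A, ∀ n, ∃ w, E n w ∧ ∀ s < n, w s = v s := by
  obtain ⟨v₀, hv₀⟩ := hzero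
  choose! g hg hgv using hsucc
  let V : ℕ → ℕ → A := fun n => Nat.rec v₀ g n
  have hV : ∀ n, E n (V n) := fun n => Nat.rec hv₀ (fun n ih => hg n _ ih) n
  have hstable : ∀ m n, m ≤ n → ∀ s < m, V n s = V m s := by
    intro m n hmn
    induction n, hmn using Nat.le_induction with
    | base => exact fun _ _ => rfl
    | succ n hmn ih => exact fun s hs => (hgv n _ (hV n) s (hs.trans_le hmn)).trans (ih s hs)
  exact ⟨fun s => V (s + 1) s, fun n =>
    ⟨V n, hV n, fun s hs => hstable (s + 1) n hs s (Nat.lt_succ_self s)⟩⟩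

-- König's lemma: along the sequence, keep a finite prefix that extends to arbitrarily late levels;
-- an infinite orbit of the next prefixes provides one more tuple, up to an automorphism.
theorem exists_limit_of_invariant (hD : Oligomorphic L D) {X : Type*} [Finite X]
    {P : ℕ → (ℕ → X → D) → Prop} (hinv : ∀ (μ : D ≃[L] D) n v, P n v → P n fun s => μ ∘ v s)
    (hanti : Antitone P) (hloc : ∀ n v w, (∀ s < n, v s = w s) → P n v → P n w)
    (hne : ∀ n, ∃ v, P n v) : ∃ v, ∀ n, P n v := by
  let E : ℕ → (ℕ → X → D) → Prop := fun n v => ∀ N, ∃ w, P N w ∧ ∀ s < n, w s = v s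
  have hzero : ∃ v, E 0 v := by
    obtain ⟨v, -⟩ := hne 0
    exact ⟨v, fun N => (hne N).imp fun w hw => ⟨hw, fun s hs => absurd hs (Nat.not_lt_zero s)⟩⟩
  have hsucc : ∀ n v, E n v → ∃ w, E (n + 1) w ∧ ∀ s < n, w s = v s := by
    intro n v h
    choose w hw hwv using h
    obtain ⟨N₀, hN₀⟩ := exists_infinite_orbit hD fun N (p : Fin (n + 1) × X) => w N p.1 p.2
    refine ⟨w N₀, fun N => ?_, hwv N₀⟩
    obtain ⟨N', hN', μ, hμ⟩ := hN₀ N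
    exact ⟨fun s => μ ∘ w N' s, hinv _ _ _ (hanti hN' _ (hw N')),
      fun s hs => funext fun x => hμ (⟨s, hs⟩, x)⟩
  obtain ⟨v, hv⟩ := exists_limit_of_extensions hzero hsucc
  refine ⟨v, fun n => ?_⟩
  obtain ⟨w, hw, hwv⟩ := hv n
  obtain ⟨u, hu, huw⟩ := hw n
  exact hloc n u v (fun s hs => (huw s hs).trans (hwv s hs)) hu

end Orbits

/-! ### Register systems -/

/-- A register automaton with output whose transitions and registers are numbered. A rule relates
the old contents of the registers (`Sum.inl r`), the input data value (`Sum.inr none`) and the new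
contents of the registers (`Sum.inr (some r)`). -/
structure RegisterSystem (L : Language) (Q : Type*) (nT k : ℕ) where
  src : Fin nT → Q
  tgt : Fin nT → Q
  q₀ : Q
  acc : Fin nT → Bool
  rule : Fin nT → L.Formula (Fin k ⊕ Option (Fin k))
  rule_isQF : ∀ t, (rule t).IsQF
  out : Fin nT → List (Fin k)
  init : Fin k → L.Constants

/-- A label of a run: a transition, the input data value, and the new contents of the registers. -/
abbrev Label (nT k : ℕ) (A : Type*) : Type _ := Fin nT × A × (Fin k → A)

/-- Application of a function to the data values of a label. -/
def Label.map {nT k : ℕ} {A B : Type*} (μ : A → B) (l : Label nT k A) : Label nT k B :=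
  (l.1, μ l.2.1, μ ∘ l.2.2)

namespace RegisterSystem

variable {L : Language} {Q D : Type*} [L.Structure D] {nT k : ℕ}

section Runs

variable (σ : RegisterSystem L Q nT k)

/-- The transition `t` can be taken with register contents `r` on the input data value `d`, and
changes the register contents to `r'`. -/
def Step (t : Fin nT) (r : Fin k → D) (d : D) (r' : Fin k → D) : Prop :=
  (σ.rule t).Realize (Sum.elim r fun o => o.elim d r')

/-- The configuration that a label leads to. -/
def next (l : Label nT k D) : Q × (Fin k → D) := (σ.tgt l.1, l.2.2)

/-- The label can be appended to a run that ends in the given configuration. -/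
def Enabled (C : Q × (Fin k → D)) (l : Label nT k D) : Prop :=
  σ.src l.1 = C.1 ∧ σ.Step l.1 C.2 l.2.1 l.2.2

/-- The configuration reached by a list of labels. -/
def after : Q × (Fin k → D) → List (Label nT k D) → Q × (Fin k → D)
  | C, [] => C
  | _, l :: e => after (σ.next l) e

/-- The list of labels is a run from the given configuration. -/
def Valid : Q × (Fin k → D) → List (Label nT k D) → Prop
  | _, [] => True
  | C, l :: e => σ.Enabled C l ∧ Valid (σ.next l) e

/-- The output of a list of labels. -/
def outputs {A : Type*} (e : List (Label nT k A)) : List A :=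
  e.flatMap fun l => (σ.out l.1).map l.2.2

/-- The number of visits to final states. -/
def visits (τ : List (Fin nT)) : ℕ := τ.countP σ.acc

end Runs

/-- The transitions of a list of labels. -/
def transitions {A : Type*} (e : List (Label nT k A)) : List (Fin nT) := e.map Prod.fst

/-- The input of a list of labels. -/
def inputs {A : Type*} (e : List (Label nT k A)) : List A := e.map fun l => l.2.1

variable {σ : RegisterSystem L Q nT k}

@[simp] theorem valid_nil (C : Q × (Fin k → D)) : σ.Valid C [] := trivial

@[simp] theorem valid_cons {C : Q × (Fin k → D)} {l : Label nT k D} {e : List (Label nT k D)} :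
    σ.Valid C (l :: e) ↔ σ.Enabled C l ∧ σ.Valid (σ.next l) e := Iff.rfl

theorem after_append {D : Type*} (C : Q × (Fin k → D)) (e e' : List (Label nT k D)) :
    σ.after C (e ++ e') = σ.after (σ.after C e) e' := by
  induction e generalizing C with
  | nil => rfl
  | cons l _ ih => exact ih _

theorem valid_append {C : Q × (Fin k → D)} {e e' : List (Label nT k D)} :
    σ.Valid C (e ++ e') ↔ σ.Valid C e ∧ σ.Valid (σ.after C e) e' := by
  induction e generalizing C with
  | nil => exact (and_iff_right trivial).symm
  | cons l e ih => exact (and_congr_right fun _ => ih).trans and_assoc.symm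

theorem Valid.of_prefix {C : Q × (Fin k → D)} {e e' : List (Label nT k D)} (h : σ.Valid C e')
    (he : e <+: e') : σ.Valid C e := by
  obtain ⟨b, rfl⟩ := he
  exact (valid_append.1 h).1

@[simp] theorem outputs_cons {A : Type*} (l : Label nT k A) (e : List (Label nT k A)) :
    σ.outputs (l :: e) = (σ.out l.1).map l.2.2 ++ σ.outputs e := by simp [outputs]

@[simp] theorem outputs_append {A : Type*} (e e' : List (Label nT k A)) :
    σ.outputs (e ++ e') = σ.outputs e ++ σ.outputs e' := by simp [outputs]

@[simp] theorem visits_append (τ τ' : List (Fin nT)) :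
    σ.visits (τ ++ τ') = σ.visits τ + σ.visits τ' := by simp [visits]

@[simp] theorem transitions_append {A : Type*} (e e' : List (Label nT k A)) :
    transitions (e ++ e') = transitions e ++ transitions e' := by simp [transitions]

@[simp] theorem length_transitions {A : Type*} (e : List (Label nT k A)) :
    (transitions e).length = e.length := List.length_map _

@[simp] theorem length_inputs {A : Type*} (e : List (Label nT k A)) :
    (inputs e).length = e.length := List.length_map _

theorem inputs_append {A : Type*} (e e' : List (Label nT k A)) :
    inputs (e ++ e') = inputs e ++ inputs e' := List.map_append

theorem outputs_map {A B : Type*} (μ : A → B) (e : List (Label nT k A)) :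
    σ.outputs (e.map (Label.map μ)) = (σ.outputs e).map μ := by
  induction e with
  | nil => rfl
  | cons l e ih => simp [ih, Label.map]

@[simp] theorem transitions_map {A B : Type*} (μ : A → B) (e : List (Label nT k A)) :
    transitions (e.map (Label.map μ)) = transitions e := by
  simp [transitions, Label.map, Function.comp_def]

theorem inputs_map {A B : Type*} (μ : A → B) (e : List (Label nT k A)) :
    inputs (e.map (Label.map μ)) = (inputs e).map μ := by
  simp [inputs, Label.map, Function.comp_def]

section Automorphisms

variable (μ : D ≃[L] D)

theorem Enabled.map {C : Q × (Fin k → D)} {l : Label nT k D} (h : σ.Enabled C l) :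
    σ.Enabled (C.1, μ ∘ C.2) (l.map μ) := by
  refine ⟨h.1, ?_⟩
  have hvalues : Sum.elim (μ ∘ C.2) (fun o : Option (Fin k) => o.elim (μ l.2.1) (μ ∘ l.2.2)) =
      μ ∘ Sum.elim C.2 fun o => o.elim l.2.1 l.2.2 := by
    funext x
    rcases x with x | _ | x <;> rfl
  rw [Label.map, Step, hvalues]
  exact (Language.StrongHomClass.realize_formula μ _).2 h.2

theorem Valid.map {C : Q × (Fin k → D)} {e : List (Label nT k D)} (h : σ.Valid C e) :
    σ.Valid (C.1, μ ∘ C.2) (e.map (Label.map μ)) := by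
  induction e generalizing C with
  | nil => trivial
  | cons l e ih => exact ⟨h.1.map μ, ih h.2⟩

theorem after_map (C : Q × (Fin k → D)) (e : List (Label nT k D)) :
    σ.after (C.1, μ ∘ C.2) (e.map (Label.map μ)) = ((σ.after C e).1, μ ∘ (σ.after C e).2) := by
  induction e generalizing C with
  | nil => rfl
  | cons l _ ih => exact ih (σ.next l)

end Automorphisms

/-! ### Short runs -/

section ShortRuns

variable (σ)

/-- A run with at least `m` visits to final states starts in the configuration. -/
def Live (m : ℕ) (C : Q × (Fin k → D)) : Prop :=
  ∃ e : List (Label nT k D), σ.Valid C e ∧ m ≤ σ.visits (transitions e)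

variable {σ}

theorem Live.mono {m m' : ℕ} (h : m ≤ m') {C : Q × (Fin k → D)} (hC : σ.Live m' C) : σ.Live m C :=
  hC.imp fun _ he => ⟨he.1, h.trans he.2⟩

theorem Live.map (μ : D ≃[L] D) {m : ℕ} {C : Q × (Fin k → D)} (hC : σ.Live m C) :
    σ.Live m (C.1, μ ∘ C.2) := by
  obtain ⟨e, he, hm⟩ := hC
  exact ⟨_, he.map μ, by rwa [transitions_map]⟩

theorem Live.of_map (μ : D ≃[L] D) {m : ℕ} {C : Q × (Fin k → D)}
    (hC : σ.Live m (C.1, μ ∘ C.2)) : σ.Live m C := by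
  convert hC.map μ.symm
  funext r
  exact (μ.toEquiv.symm_apply_apply _).symm

theorem Live.of_after {m : ℕ} {C : Q × (Fin k → D)} {e : List (Label nT k D)} (he : σ.Valid C e)
    (h : σ.Live m (σ.after C e)) : σ.Live m C := by
  obtain ⟨b, hb, hm⟩ := h
  refine ⟨e ++ b, valid_append.2 ⟨he, hb⟩, ?_⟩
  rw [transitions_append, visits_append]
  exact hm.trans (Nat.le_add_left _ _)

variable (σ) in
/-- Every configuration that admits a run with `K` visits to final states admits runs with
arbitrarily many visits. -/
def IsLiveBound (D : Type*) [L.Structure D] (K : ℕ) : Prop :=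
  ∀ C : Q × (Fin k → D), σ.Live K C → ∀ m, σ.Live m C

theorem exists_first_output {A : Type*} : ∀ e : List (Label nT k A), σ.outputs e ≠ [] →
    ∃ s l b, e = s ++ l :: b ∧ σ.outputs s = [] ∧ σ.out l.1 ≠ []
  | [], h => (h rfl).elim
  | l :: e, h => by
    by_cases hl : σ.out l.1 = []
    · obtain ⟨s, l', b, rfl, hs, hl'⟩ := exists_first_output e (by simpa [hl] using h)
      exact ⟨l :: s, l', b, rfl, by simp [hl, hs], hl'⟩
    · exact ⟨[], l, e, rfl, rfl, hl⟩

theorem exists_first_visit {A : Type*} {m : ℕ} : ∀ e : List (Label nT k A),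
    m + 1 ≤ σ.visits (transitions e) →
      ∃ s l b, e = s ++ l :: b ∧ σ.acc l.1 ∧ m ≤ σ.visits (transitions b)
  | [], h => by simp [transitions, visits] at h
  | l :: e, h => by
    by_cases hl : σ.acc l.1
    · exact ⟨[], l, e, rfl, hl, by simpa [transitions, visits, hl] using h⟩
    · obtain ⟨s, l', b, rfl, hl', hb⟩ :=
        exists_first_visit e (by simpa [transitions, visits, hl] using h)
      exact ⟨l :: s, l', b, rfl, hl', hb⟩

variable [Finite Q] (σ)

theorem exists_isLiveBound (hD : Oligomorphic L D) : ∃ K, σ.IsLiveBound D K := by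
  obtain ⟨K, hK⟩ := exists_bound_of_invariant_of_finite hD
    (S := fun m q r => ¬ σ.Live m (q, r)) fun μ m q r hr hl => hr (Live.of_map μ hl)
  refine ⟨K, fun C hC m => ?_⟩
  by_contra hm
  obtain ⟨m', hm', hn⟩ := hK C.1 C.2 ⟨m, hm⟩
  exact hn (hC.mono hm')

theorem exists_short_live (hD : Oligomorphic L D) (m : ℕ) :
    ∃ B, ∀ C : Q × (Fin k → D), σ.Live m C →
      ∃ e : List (Label nT k D), σ.Valid C e ∧ m ≤ σ.visits (transitions e) ∧ e.length ≤ B := by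
  obtain ⟨B, hB⟩ := exists_bound_of_invariant_of_finite hD
    (S := fun l q r => ∃ e : List (Label nT k D),
      σ.Valid (q, r) e ∧ m ≤ σ.visits (transitions e) ∧ e.length = l) <| by
    rintro μ l q r ⟨e, he, hm, hl⟩
    exact ⟨_, he.map μ, by rwa [transitions_map], by rwa [List.length_map]⟩
  refine ⟨B, fun C ⟨e, he, hm⟩ => ?_⟩
  obtain ⟨l, hl, e', he', hm', rfl⟩ := hB C.1 C.2 ⟨_, e, he, hm, rfl⟩
  exact ⟨e', he', hm', hl⟩

theorem exists_short_silent (hD : Oligomorphic L D) :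
    ∃ B, ∀ (C : Q × (Fin k → D)) (e : List (Label nT k D)), σ.Valid C e → σ.outputs e = [] →
      ∃ e' : List (Label nT k D), σ.Valid C e' ∧ σ.outputs e' = [] ∧ σ.after C e' = σ.after C e ∧
        e'.length ≤ B := by
  obtain ⟨B, hB⟩ := exists_bound_of_invariant_of_finite hD
    (S := fun l (q : Q × Q) (r : Fin k ⊕ Fin k → D) => ∃ e : List (Label nT k D),
      σ.Valid (q.1, r ∘ Sum.inl) e ∧ σ.outputs e = [] ∧
        σ.after (q.1, r ∘ Sum.inl) e = (q.2, r ∘ Sum.inr) ∧ e.length = l) <| by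
    rintro μ l q r ⟨e, he, ho, ha, hl⟩
    refine ⟨_, he.map μ, by rw [outputs_map, ho, List.map_nil], ?_, by rwa [List.length_map]⟩
    rw [Function.comp_assoc, after_map μ (q.1, r ∘ Sum.inl), ha]
    rfl
  refine ⟨B, fun C e he ho => ?_⟩
  obtain ⟨l, hl, e', he', ho', ha', rfl⟩ := hB (C.1, (σ.after C e).1)
    (Sum.elim C.2 (σ.after C e).2) ⟨_, e, he, ho, rfl, rfl⟩
  exact ⟨e', he', ho', ha', hl⟩

theorem exists_short_output (hD : Oligomorphic L D) :
    ∃ B, ∀ (c : ℕ) (C : Q × (Fin k → D)) (e : List (Label nT k D)), σ.Valid C e →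
      c ≤ (σ.outputs e).length → ∃ a a' b, e = a' ++ b ∧ σ.Valid C a ∧
        σ.after C a = σ.after C a' ∧ a.length ≤ c * B ∧
        (σ.outputs a).take c = (σ.outputs e).take c := by
  obtain ⟨B, hB⟩ := exists_short_silent σ hD
  refine ⟨B + 1, fun c => ?_⟩
  induction c using Nat.strong_induction_on with
  | _ c ih =>
    intro C e he hc
    rcases Nat.eq_zero_or_pos c with rfl | hpos
    · exact ⟨[], [], e, rfl, trivial, rfl, Nat.zero_le _, rfl⟩
    obtain ⟨s, l, b, rfl, hs, hl⟩ :=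
      exists_first_output e (List.length_pos_iff.1 (hpos.trans_le hc))
    obtain ⟨hvs, hvl, hvb⟩ := valid_append.1 he
    obtain ⟨s', hvs', hs', has', hls'⟩ := hB C s hvs hs
    have hpos_out := List.length_pos_iff.2 hl
    rw [outputs_append, outputs_cons, hs, List.nil_append, List.length_append,
      List.length_map] at hc
    obtain ⟨a, a', b', rfl, hva, haa', hla, hta⟩ :=
      ih (c - (σ.out l.1).length) (by omega) (σ.next l) b hvb (by omega)
    refine ⟨s' ++ l :: a, s ++ l :: a', b', by simp, ?_, ?_, ?_, ?_⟩
    · rw [valid_append, has']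
      exact ⟨hvs', hvl, hva⟩
    · rw [after_append, after_append]
      exact haa'
    · have hmul := Nat.mul_le_mul_right (B + 1) (show c - (σ.out l.1).length ≤ c - 1 by omega)
      rw [Nat.sub_one_mul] at hmul
      have := Nat.le_mul_of_pos_left (B + 1) hpos
      rw [List.length_append, List.length_cons]
      omega
    · rw [outputs_append s', outputs_append s, outputs_cons, outputs_cons, hs', hs]
      simp only [List.nil_append, List.take_append, List.length_map, hta]

end ShortRuns

/-! ### Infinite runs -/

section Segments

variable {A B : Type*}

/-- The prefix of length `n` of an infinite word. -/
def pre (e : ℕ → A) (n : ℕ) : List A := (List.range n).map e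

@[simp] theorem length_pre (e : ℕ → A) (n : ℕ) : (pre e n).length = n := by simp [pre]

theorem pre_succ (e : ℕ → A) (n : ℕ) : pre e (n + 1) = pre e n ++ [e n] := by
  simp [pre, List.range_succ]

theorem pre_add (e : ℕ → A) (m n : ℕ) :
    pre e (m + n) = pre e m ++ pre (fun s => e (m + s)) n := by
  simp [pre, List.range_add]

theorem pre_take (e : ℕ → A) {m n : ℕ} (h : m ≤ n) : (pre e n).take m = pre e m := by
  obtain ⟨d, rfl⟩ := Nat.exists_eq_add_of_le h
  rw [pre_add, List.take_left' (length_pre e m)]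

theorem pre_prefix (e : ℕ → A) {m n : ℕ} (h : m ≤ n) : pre e m <+: pre e n := by
  obtain ⟨d, rfl⟩ := Nat.exists_eq_add_of_le h
  exact ⟨_, (pre_add e m d).symm⟩

theorem pre_inj {e e' : ℕ → A} {n : ℕ} : pre e n = pre e' n ↔ ∀ s < n, e s = e' s := by
  simp [pre]

theorem pre_map (g : A → B) (e : ℕ → A) (n : ℕ) :
    (pre e n).map g = pre (fun s => g (e s)) n := by simp [pre, Function.comp_def]

theorem exists_pre_eq (e : List A) (e' : ℕ → A) :
    ∃ g : ℕ → A, pre g e.length = e ∧ ∀ s, g (e.length + s) = e' s := by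
  refine ⟨fun s => if h : s < e.length then e[s] else e' (s - e.length), ?_, by simp⟩
  refine List.ext_getElem (length_pre _ _) fun s _ hs => ?_
  simp [pre, hs]

end Segments

variable {L : Language} {Q D : Type*} [L.Structure D] {nT k : ℕ} (σ : RegisterSystem L Q nT k)

/-- The configuration before the step number `n` of a sequence of labels. -/
def config (C : Q × (Fin k → D)) (e : ℕ → Label nT k D) : ℕ → Q × (Fin k → D)
  | 0 => C
  | n + 1 => σ.next (e n)

/-- An infinite sequence of labels is an accepting run from the configuration. -/
def Accepts (C : Q × (Fin k → D)) (e : ℕ → Label nT k D) : Prop :=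
  (∀ n, σ.Valid C (pre e n)) ∧ ∀ n, ∃ m ≥ n, σ.acc (e m).1

variable {σ}

theorem after_pre {D : Type*} (C : Q × (Fin k → D)) (e : ℕ → Label nT k D) (n : ℕ) :
    σ.after C (pre e n) = σ.config C e n := by
  cases n with
  | zero => rfl
  | succ n => rw [pre_succ, after_append]; rfl

theorem valid_pre {C : Q × (Fin k → D)} {e : ℕ → Label nT k D} {n : ℕ} :
    σ.Valid C (pre e n) ↔ ∀ s < n, σ.Enabled (σ.config C e s) (e s) := by
  induction n with
  | zero => simp [pre]
  | succ n ih =>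
    rw [pre_succ, valid_append, ih, after_pre, Nat.forall_lt_succ_right, valid_cons,
      and_iff_left (valid_nil _)]

theorem Accepts.exists_append {C : Q × (Fin k → D)} {e : List (Label nT k D)}
    {e' : ℕ → Label nT k D} (he : σ.Valid C e) (he' : σ.Accepts (σ.after C e) e') :
    ∃ g : ℕ → Label nT k D, σ.Accepts C g ∧ pre g e.length = e := by
  obtain ⟨g, hg, hg'⟩ := exists_pre_eq e e'
  refine ⟨g, ⟨fun n => ?_, fun n => ?_⟩, hg⟩
  · have hv : σ.Valid C (pre g (e.length + n)) := by
      rw [pre_add, hg, valid_append]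
      simp only [hg']
      exact ⟨he, he'.1 n⟩
    exact hv.of_prefix (pre_prefix g (Nat.le_add_left _ _))
  · obtain ⟨m, hm, ha⟩ := he'.2 n
    exact ⟨e.length + m, by omega, by rwa [hg']⟩

theorem Accepts.exists_visits {C : Q × (Fin k → D)} {e : ℕ → Label nT k D} (he : σ.Accepts C e)
    (n m : ℕ) : ∃ N, m ≤ σ.visits (transitions (pre (fun s => e (n + s)) N)) := by
  induction m with
  | zero => exact ⟨0, Nat.zero_le _⟩
  | succ m ih =>
    obtain ⟨N, hN⟩ := ih
    obtain ⟨M, hM, ha⟩ := he.2 (n + N)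
    obtain ⟨d, rfl⟩ := Nat.exists_eq_add_of_le hM
    have hvisit : σ.visits (transitions [e (n + (N + d))]) = 1 := by
      rw [← Nat.add_assoc]
      simp [transitions, visits, ha]
    refine ⟨N + d + 1, ?_⟩
    rw [pre_succ, pre_add, transitions_append, transitions_append, visits_append, visits_append,
      hvisit]
    omega

theorem exists_accepts_of_rank {I : Q × (Fin k → D) → Prop} {rank : Q × (Fin k → D) → ℕ}
    (hstep : ∀ C, I C → ∃ l, σ.Enabled C l ∧ I (σ.next l) ∧
      (σ.acc l.1 ∨ rank (σ.next l) < rank C)) {C : Q × (Fin k → D)} (hC : I C) :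
    ∃ e : ℕ → Label nT k D, σ.Accepts C e := by
  choose g henabled hnext hdesc using fun C : {C // I C} => hstep C.1 C.2
  let c : ℕ → {C // I C} := fun n => Nat.rec ⟨C, hC⟩ (fun _ c => ⟨σ.next (g c), hnext c⟩) n
  have hconfig : ∀ n, σ.config C (fun n => g (c n)) n = (c n).1 := fun n => by cases n <;> rfl
  refine ⟨fun n => g (c n), fun n => valid_pre.2 fun s _ => hconfig s ▸ henabled (c s),
    fun n => ?_⟩
  induction hb : rank (c n).1 using Nat.strong_induction_on generalizing n with
  | _ b ih =>
    rcases hdesc (c n) with h | h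
    · exact ⟨n, le_rfl, h⟩
    · obtain ⟨m, hm, ha⟩ := ih _ (hb ▸ h) (n + 1) rfl
      exact ⟨m, (Nat.le_succ n).trans hm, ha⟩

variable (σ) in
/-- A run of length `h + 1` leads from the configuration, by a visit to a final state, to a
configuration from which at least `K` further visits are possible. -/
def VisitsAfter (K h : ℕ) (C : Q × (Fin k → D)) : Prop :=
  ∃ e l, e.length = h ∧ σ.Valid C (e ++ [l]) ∧ σ.acc l.1 ∧ σ.Live K (σ.after C (e ++ [l]))

theorem IsLiveBound.exists_visitsAfter {K : ℕ} (hK : σ.IsLiveBound D K) {C : Q × (Fin k → D)}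
    (hC : σ.Live K C) : ∃ h, σ.VisitsAfter K h C := by
  obtain ⟨e, he, hm⟩ := hK C hC (K + 1)
  obtain ⟨s, l, b, rfl, hl, hb⟩ := exists_first_visit e hm
  rw [← List.singleton_append, ← List.append_assoc, valid_append] at he
  exact ⟨_, s, l, rfl, he.1, hl, b, he.2, hb⟩

theorem Live.exists_accepts {K : ℕ} (hK : σ.IsLiveBound D K) {C : Q × (Fin k → D)}
    (hC : σ.Live K C) : ∃ e : ℕ → Label nT k D, σ.Accepts C e := by
  refine exists_accepts_of_rank (I := σ.Live K) (rank := fun C => sInf {h | σ.VisitsAfter K h C})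
    (fun C hC => ?_) hC
  obtain ⟨e, l, hlen, hv, hacc, hlive⟩ := Nat.sInf_mem (hK.exists_visitsAfter hC)
  cases e with
  | nil => exact ⟨l, hv.1, hlive, Or.inl hacc⟩
  | cons l' e =>
    have hnext : σ.VisitsAfter K e.length (σ.next l') := ⟨e, l, rfl, hv.2, hacc, hlive⟩
    refine ⟨l', hv.1, Live.of_after hv.2 hlive, Or.inr ?_⟩
    exact hlen ▸ Nat.lt_succ_of_le (Nat.sInf_le hnext)

variable {L : Language} {Q D : Type*} [L.Structure D] {nT k : ℕ} (σ : RegisterSystem L Q nT k)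

/-- The infinite word `y` is the output of the sequence of labels. -/
def Writes (e : ℕ → Label nT k D) (y : ℕ → D) : Prop :=
  (∀ n i a, (σ.outputs (pre e n))[i]? = some a → y i = a) ∧
    ∀ i, ∃ n, i < (σ.outputs (pre e n)).length

/-- The input word of a sequence of labels. -/
def inputWord (e : ℕ → Label nT k D) : ℕ → D := fun n => (e n).2.1

/-- The initial configuration. -/
def start (D : Type*) [L.Structure D] : Q × (Fin k → D) := (σ.q₀, fun r => (σ.init r : D))

/-- The register system defines the partial function `f`: the graph of `f` consists of the pairs of
input and output words of accepting runs, and all these outputs are infinite. -/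
structure DefinesFun (f : (ℕ → D) →. (ℕ → D)) : Prop where
  exists_mem : ∀ {e : ℕ → Label nT k D}, σ.Accepts (σ.start D) e →
    ∃ y ∈ f (inputWord e), σ.Writes e y
  exists_run : ∀ {x y : ℕ → D}, y ∈ f x →
    ∃ e : ℕ → Label nT k D, σ.Accepts (σ.start D) e ∧ inputWord e = x ∧ σ.Writes e y

/-! ### Mismatches -/

/-- The run `e` has length at least `j` and writes the letter `a` at position `i`; its prolongation
`e'` visits final states `K` times. If `K` is a live bound, then `e` is a prefix of an accepting
run. -/
structure OutputWitness (K j i : ℕ) (e e' : List (Label nT k D)) (a : D) : Prop where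
  valid : σ.Valid (σ.start D) (e ++ e')
  le_length : j ≤ e.length
  visits : K ≤ σ.visits (transitions e')
  outputs : (σ.outputs e)[i]? = some a

/-- Two runs whose inputs agree on the first `j` letters write different letters at position `i`;
the transitions of the first run begin with `τ`. -/
def Mismatch (D : Type*) [L.Structure D] (K j : ℕ) (τ : List (Fin nT)) (i : ℕ) : Prop :=
  ∃ (e₁ e₁' e₂ e₂' : List (Label nT k D)) (a b : D), σ.OutputWitness K j i e₁ e₁' a ∧
    σ.OutputWitness K j i e₂ e₂' b ∧ τ <+: transitions e₁ ∧
    (inputs e₁).take j = (inputs e₂).take j ∧ a ≠ b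

variable {σ} {f : (ℕ → D) →. (ℕ → D)} {K j i : ℕ}

theorem inputs_pre_take {D : Type*} {e : ℕ → Label nT k D} {n : ℕ} (h : j ≤ n) :
    (inputs (pre e n)).take j = pre (inputWord e) j := by
  rw [inputs, pre_map, pre_take _ h]
  rfl

theorem transitions_pre {D : Type*} (e : ℕ → Label nT k D) (n : ℕ) :
    transitions (pre e n) = pre (fun s => (e s).1) n :=
  pre_map _ _ _

theorem start_map (μ : D ≃[L] D) : ((σ.start D).1, μ ∘ (σ.start D).2) = σ.start D :=
  Prod.ext rfl (funext fun r => Language.HomClass.map_constants μ (σ.init r))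

theorem Valid.map_start (μ : D ≃[L] D) {e : List (Label nT k D)} (h : σ.Valid (σ.start D) e) :
    σ.Valid (σ.start D) (e.map (Label.map μ)) :=
  start_map (σ := σ) μ ▸ h.map μ

theorem getElem?_outputs_of_prefix {A : Type*} {e e' : List (Label nT k A)} (h : e <+: e') {a : A}
    (ha : (σ.outputs e)[i]? = some a) : (σ.outputs e')[i]? = some a := by
  obtain ⟨b, rfl⟩ := h
  rw [outputs_append, List.getElem?_append_left (List.getElem?_eq_some_iff.1 ha).1, ha]

theorem Writes.exists_getElem? {D : Type*} {e : ℕ → Label nT k D} {y : ℕ → D}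
    (hy : σ.Writes e y) (i : ℕ) :
    ∃ p, ∀ n ≥ p, (σ.outputs (pre e n))[i]? = some (y i) := by
  obtain ⟨p, hp⟩ := hy.2 i
  have ha := List.getElem?_eq_getElem hp
  exact ⟨p, fun n hn => getElem?_outputs_of_prefix (pre_prefix e hn) (hy.1 p i _ ha ▸ ha)⟩

namespace OutputWitness

theorem mono {j' : ℕ} (hj : j' ≤ j) {e e' : List (Label nT k D)} {a : D}
    (h : σ.OutputWitness K j i e e' a) : σ.OutputWitness K j' i e e' a :=
  ⟨h.valid, hj.trans h.le_length, h.visits, h.outputs⟩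

theorem map (μ : D ≃[L] D) {e e' : List (Label nT k D)} {a : D}
    (h : σ.OutputWitness K j i e e' a) :
    σ.OutputWitness K j i (e.map (Label.map μ)) (e'.map (Label.map μ)) (μ a) where
  valid := List.map_append ▸ h.valid.map_start μ
  le_length := (List.length_map _).symm ▸ h.le_length
  visits := (transitions_map (A := D) μ e').symm ▸ h.visits
  outputs := by rw [outputs_map, List.getElem?_map, h.outputs, Option.map_some]

theorem exists_mem (hK : σ.IsLiveBound D K) (hf : σ.DefinesFun f) {e e' : List (Label nT k D)}
    {a : D} (h : σ.OutputWitness K j i e e' a) :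
    ∃ g, pre g e.length = e ∧ ∃ y ∈ f (inputWord g), y i = a := by
  obtain ⟨hv, hv'⟩ := valid_append.1 h.valid
  obtain ⟨g', hg'⟩ := Live.exists_accepts hK ⟨e', hv', h.visits⟩
  obtain ⟨g, hg, hge⟩ := Accepts.exists_append hv hg'
  obtain ⟨y, hy, hw⟩ := hf.exists_mem hg
  exact ⟨g, hge, y, hy, hw.1 e.length i a (hge.symm ▸ h.outputs)⟩

end OutputWitness

theorem Accepts.exists_outputWitness {e : ℕ → Label nT k D} (he : σ.Accepts (σ.start D) e)
    {y : ℕ → D} (hy : σ.Writes e y) (K j i : ℕ) :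
    ∃ n ≥ j, ∃ e', σ.OutputWitness K j i (pre e n) e' (y i) := by
  obtain ⟨p, hp⟩ := hy.exists_getElem? i
  obtain ⟨N, hN⟩ := he.exists_visits (max p j) K
  refine ⟨max p j, le_max_right _ _, pre (fun s => e (max p j + s)) N, ⟨?_, ?_, hN, ?_⟩⟩
  · rw [← pre_add]
    exact he.1 _
  · exact (length_pre e _).symm ▸ le_max_right _ _
  · exact hp _ (le_max_left _ _)

theorem Mismatch.mono {j' : ℕ} {τ : List (Fin nT)} (hj : j' ≤ j) (h : σ.Mismatch D K j τ i) :
    σ.Mismatch D K j' τ i := by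
  obtain ⟨e₁, e₁', e₂, e₂', a, b, h₁, h₂, hτ, hin, hab⟩ := h
  refine ⟨e₁, e₁', e₂, e₂', a, b, h₁.mono hj, h₂.mono hj, hτ, ?_, hab⟩
  have := congrArg (List.take j') hin
  rwa [List.take_take, List.take_take, min_eq_left hj] at this

theorem isMContinuous_iff (hK : σ.IsLiveBound D K) (hf : σ.DefinesFun f) {m : ℕ → ℕ} :
    IsMContinuous f m ↔ ∀ i, ∀ i' < i, ¬ σ.Mismatch D K (m i) [] i' := by
  constructor
  · rintro h i i' hi ⟨e₁, e₁', e₂, e₂', a, b, h₁, h₂, -, hin, hab⟩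
    obtain ⟨g₁, hg₁, y₁, hy₁, rfl⟩ := h₁.exists_mem hK hf
    obtain ⟨g₂, hg₂, y₂, hy₂, rfl⟩ := h₂.exists_mem hK hf
    rw [← hg₁, ← hg₂, inputs_pre_take h₁.le_length, inputs_pre_take h₂.le_length, pre_inj] at hin
    exact hab (h i _ y₁ hy₁ _ y₂ hy₂ hin i' hi)
  · intro h i x₁ y₁ hy₁ x₂ y₂ hy₂ hx i' hi
    by_contra hne
    obtain ⟨e₁, he₁, rfl, hw₁⟩ := hf.exists_run hy₁
    obtain ⟨e₂, he₂, rfl, hw₂⟩ := hf.exists_run hy₂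
    obtain ⟨n₁, hn₁, e₁', h₁⟩ := he₁.exists_outputWitness hw₁ K (m i) i'
    obtain ⟨n₂, hn₂, e₂', h₂⟩ := he₂.exists_outputWitness hw₂ K (m i) i'
    refine h i i' hi ⟨_, e₁', _, e₂', _, _, h₁, h₂, List.nil_prefix, ?_, hne⟩
    rw [inputs_pre_take hn₁, inputs_pre_take hn₂, pre_inj]
    exact hx

variable (σ) in
/-- The first `n` labels of `e` form a run that does not write `b` at position `i`, although some
run with the same first `n` input letters does. -/
structure PrefixMismatch (K i n : ℕ) (e : ℕ → Label nT k D) : Prop where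
  valid : σ.Valid (σ.start D) (pre e n)
  exists_witness : ∃ g g' b, σ.OutputWitness K n i g g' b ∧
    pre (inputWord e) n = (inputs g).take n ∧ (σ.outputs (pre e n))[i]? ≠ some b

namespace PrefixMismatch

variable {n : ℕ} {e : ℕ → Label nT k D}

theorem map (μ : D ≃[L] D) (h : σ.PrefixMismatch K i n e) :
    σ.PrefixMismatch K i n fun s => (e s).map μ where
  valid := pre_map (Label.map μ) e n ▸ h.valid.map_start μ
  exists_witness := by
    obtain ⟨g, g', b, hg, hin, hb⟩ := h.exists_witness
    refine ⟨_, _, μ b, hg.map μ, ?_, ?_⟩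
    · rw [inputs_map, ← List.map_take, ← hin, pre_map]
      rfl
    · rw [← pre_map, outputs_map, List.getElem?_map, ← Option.map_some]
      exact fun h => hb (Option.map_injective μ.toEquiv.injective h)

theorem anti {n' : ℕ} (hn : n' ≤ n) (h : σ.PrefixMismatch K i n e) :
    σ.PrefixMismatch K i n' e where
  valid := h.valid.of_prefix (pre_prefix e hn)
  exists_witness := by
    obtain ⟨g, g', b, hg, hin, hb⟩ := h.exists_witness
    refine ⟨g, g', b, hg.mono hn, ?_,
      fun hb' => hb (getElem?_outputs_of_prefix (pre_prefix e hn) hb')⟩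
    rw [← pre_take _ hn, hin, List.take_take, min_eq_left hn]

theorem congr {e' : ℕ → Label nT k D} (he : ∀ s < n, e s = e' s)
    (h : σ.PrefixMismatch K i n e) : σ.PrefixMismatch K i n e' := by
  have hin : pre (inputWord e) n = pre (inputWord e') n :=
    pre_inj.2 fun s hs => congrArg (fun l => l.2.1) (he s hs)
  obtain ⟨hv, hw⟩ := h
  rw [pre_inj.2 he] at hv
  rw [pre_inj.2 he, hin] at hw
  exact ⟨hv, hw⟩

end PrefixMismatch

theorem Mismatch.exists_prefixMismatch {n : ℕ} {τ : ℕ → Fin nT}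
    (h : σ.Mismatch D K n (pre τ n) i) :
    ∃ e : ℕ → Label nT k D, (∀ s < n, (e s).1 = τ s) ∧ σ.PrefixMismatch K i n e := by
  obtain ⟨e₁, e₁', e₂, e₂', a, b, h₁, h₂, hτ, hin, hab⟩ := h
  obtain ⟨e, he, -⟩ := exists_pre_eq e₁ fun _ => (τ 0, a, fun _ => a)
  have hlen := h₁.le_length
  have hpre : pre e n <+: e₁ := he ▸ pre_prefix e hlen
  refine ⟨e, fun s hs => ?_, (valid_append.1 h₁.valid).1.of_prefix hpre,
    e₂, e₂', b, h₂, ?_, fun hb => ?_⟩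
  · rw [← he, transitions_pre, List.prefix_iff_eq_take, length_pre, pre_take _ hlen, pre_inj] at hτ
    exact (hτ s hs).symm
  · rw [← hin, ← he, inputs_pre_take hlen]
  · exact hab (Option.some_injective _
      (h₁.outputs.symm.trans (getElem?_outputs_of_prefix hpre hb)))

theorem exists_forall_prefixMismatch (hD : Oligomorphic L D) {τ : ℕ → Fin nT}
    (h : ∀ n, σ.Mismatch D K n (pre τ n) i) :
    ∃ e : ℕ → Label nT k D, (∀ s, (e s).1 = τ s) ∧ ∀ n, σ.PrefixMismatch K i n e := by
  let labels : (ℕ → Option (Fin k) → D) → ℕ → Label nT k D :=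
    fun v s => (τ s, v s none, fun r => v s (some r))
  obtain ⟨v, hv⟩ := exists_limit_of_invariant hD
    (P := fun n v => σ.PrefixMismatch K i n (labels v)) (fun μ n v h => h.map μ)
    (fun n n' hn v h => h.anti hn)
    (fun n v w hvw h => h.congr fun s hs => by simp only [labels, hvw s hs]) fun n => by
      obtain ⟨e, heτ, he⟩ := (h n).exists_prefixMismatch
      exact ⟨fun s o => o.elim (e s).2.1 (e s).2.2, he.congr fun s hs => Prod.ext (heτ s hs) rfl⟩
  exact ⟨labels v, fun _ => rfl, hv⟩

-- If there were a mismatch for every `j`, the limit of the mismatching runs would be accepting, as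
-- it has the transitions of `e`, and `f` would be discontinuous at its input.
theorem exists_not_mismatch (hD : Oligomorphic L D) (hK : σ.IsLiveBound D K)
    (hf : σ.DefinesFun f) (hc : IsContinuous f) {e : ℕ → Label nT k D}
    (he : σ.Accepts (σ.start D) e) (i : ℕ) :
    ∃ j, ¬ σ.Mismatch D K j (transitions (pre e j)) i := by
  by_contra! hmis
  simp only [transitions_pre] at hmis
  obtain ⟨g, hgτ, hg⟩ := exists_forall_prefixMismatch hD hmis
  obtain ⟨y, hy, hw⟩ := hf.exists_mem (e := g)
    ⟨fun n => (hg n).valid, fun n => (he.2 n).imp fun m hm => ⟨hm.1, (hgτ m).symm ▸ hm.2⟩⟩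
  obtain ⟨p, hp⟩ := hw.exists_getElem? i
  obtain ⟨j, hj⟩ := hc _ y hy (i + 1)
  obtain ⟨e₂, e₂', b, h₂, hin, hb⟩ := (hg (max p j)).exists_witness
  obtain ⟨g₂, hg₂, y₂, hy₂, rfl⟩ := h₂.exists_mem hK hf
  rw [← hg₂, inputs_pre_take h₂.le_length, pre_inj] at hin
  have hyi : y i = y₂ i :=
    hj _ y₂ hy₂ (fun s hs => hin s (hs.trans_le (le_max_right _ _))) i (Nat.lt_succ_self i)
  exact hb (hyi ▸ hp _ (le_max_left _ _))

/-! ### Mismatches of short runs -/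

theorem getElem?_outputs_append {A : Type*} {p e e' : List (Label nT k A)}
    (h : (σ.outputs e).take (i + 1 - (σ.outputs p).length) =
      (σ.outputs e').take (i + 1 - (σ.outputs p).length)) :
    (σ.outputs (p ++ e))[i]? = (σ.outputs (p ++ e'))[i]? := by
  rw [outputs_append, outputs_append]
  rcases lt_or_ge i (σ.outputs p).length with hip | hip
  · rw [List.getElem?_append_left hip, List.getElem?_append_left hip]
  · rw [List.getElem?_append_right hip, List.getElem?_append_right hip]
    have hlt : i - (σ.outputs p).length < i + 1 - (σ.outputs p).length := by omega
    rw [← List.getElem?_take_of_lt hlt, h, List.getElem?_take_of_lt hlt]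

variable [Finite Q] (σ)

theorem exists_short_outputWitness (hD : Oligomorphic L D) (K : ℕ) :
    ∃ B, ∀ (j i : ℕ) (e e' : List (Label nT k D)) (a : D), σ.OutputWitness K j i e e' a →
      ∃ g g', σ.OutputWitness K j i g g' a ∧ g.take j = e.take j ∧ g.length ≤ j + (i + 1) * B ∧
        g'.length ≤ j + (i + 1) * B := by
  obtain ⟨B₀, hB₀⟩ := exists_short_output σ hD
  obtain ⟨B₁, hB₁⟩ := exists_short_live σ hD K
  refine ⟨B₀ + B₁, fun j i e e' a h => ?_⟩
  obtain ⟨p, r, rfl, hpl⟩ : ∃ p r, e = p ++ r ∧ p.length = j :=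
    ⟨e.take j, e.drop j, (List.take_append_drop j e).symm, List.length_take_of_le h.le_length⟩
  obtain ⟨hv, hv'⟩ := valid_append.1 h.valid
  obtain ⟨hvp, hvr⟩ := valid_append.1 hv
  have hi : i < (σ.outputs (p ++ r)).length := (List.getElem?_eq_some_iff.1 h.outputs).1
  rw [outputs_append, List.length_append] at hi
  obtain ⟨g, g', b, rfl, hvg, hgg', hgl, hgt⟩ :=
    hB₀ (i + 1 - (σ.outputs p).length) _ r hvr (by omega)
  have hvpg : σ.Valid (σ.start D) (p ++ g) := valid_append.2 ⟨hvp, hvg⟩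
  have hlive : σ.Live K (σ.after (σ.start D) (p ++ g)) := by
    rw [after_append, after_append, ← hgg'] at hv'
    rw [after_append]
    exact Live.of_after (hgg' ▸ (valid_append.1 hvr).2) ⟨e', hv', h.visits⟩
  obtain ⟨w, hvw, hvisits, hwl⟩ := hB₁ _ hlive
  have hle₀ : (i + 1 - (σ.outputs p).length) * B₀ ≤ (i + 1) * B₀ :=
    Nat.mul_le_mul_right _ (Nat.sub_le _ _)
  have hle₁ : B₁ ≤ (i + 1) * B₁ := Nat.le_mul_of_pos_left _ i.succ_pos
  rw [Nat.mul_add]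
  refine ⟨p ++ g, w, ⟨valid_append.2 ⟨hvpg, hvw⟩, ?_, hvisits, ?_⟩, ?_, ?_, by omega⟩
  · rw [List.length_append]
    omega
  · rw [getElem?_outputs_append hgt, h.outputs]
  · rw [List.take_left' hpl, List.take_left' hpl]
  · rw [List.length_append]
    omega

theorem exists_short_mismatch (hD : Oligomorphic L D) (K : ℕ) :
    ∃ B, ∀ (j : ℕ) (τ : List (Fin nT)) (i : ℕ), τ.length ≤ j → σ.Mismatch D K j τ i →
      ∃ (e₁ e₁' e₂ e₂' : List (Label nT k D)) (a b : D), σ.OutputWitness K j i e₁ e₁' a ∧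
        σ.OutputWitness K j i e₂ e₂' b ∧ τ <+: transitions e₁ ∧
        (inputs e₁).take j = (inputs e₂).take j ∧ a ≠ b ∧
        ∀ e ∈ [e₁, e₁', e₂, e₂'], e.length ≤ j + (i + 1) * B := by
  obtain ⟨B, hB⟩ := exists_short_outputWitness σ hD K
  refine ⟨B, fun j τ i hτl => ?_⟩
  rintro ⟨e₁, e₁', e₂, e₂', a, b, h₁, h₂, hτ, hin, hab⟩
  obtain ⟨g₁, g₁', hg₁, htake₁, hl₁, hl₁'⟩ := hB j i e₁ e₁' a h₁
  obtain ⟨g₂, g₂', hg₂, htake₂, hl₂, hl₂'⟩ := hB j i e₂ e₂' b h₂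
  refine ⟨g₁, g₁', g₂, g₂', a, b, hg₁, hg₂, ?_, ?_, hab, by simp [hl₁, hl₁', hl₂, hl₂']⟩
  · have hτ' : τ <+: (transitions e₁).take j := by
      rw [List.prefix_iff_eq_take] at hτ ⊢
      rw [List.take_take, min_eq_left hτl, ← hτ]
    rw [transitions, ← List.map_take, ← htake₁, List.map_take] at hτ'
    exact hτ'.trans (List.take_prefix _ _)
  · rw [inputs, inputs, ← List.map_take, ← List.map_take] at hin ⊢
    rw [htake₁, htake₂, hin]

end RegisterSystem

/-! ### From register transducers to register systems -/

section Rename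

variable {L : Language} {X Y D : Type*} [L.Structure D]

/-- Renaming of the free variables of a formula. Unlike `Formula.relabel`, it does not touch the
indices of bound variables, so that the code of the result is computed by relabelling terms. -/
def rename (g : X → Y) (φ : L.Formula X) : L.Formula Y :=
  Language.BoundedFormula.mapTermRel (g := id) (fun _ t => t.relabel (Sum.map g id)) (fun _ => id)
    (fun _ => id) φ

theorem realize_rename (g : X → Y) (φ : L.Formula X) (v : Y → D) :
    (rename g φ).Realize v ↔ φ.Realize (v ∘ g) := by
  refine Language.BoundedFormula.realize_mapTermRel_id (fun n t xs => ?_) fun _ _ _ => rfl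
  rw [Language.Term.realize_relabel]
  congr 1
  funext x
  rcases x with x | x <;> rfl

theorem isQF_rename (g : X → Y) {φ : L.Formula X} (h : φ.IsQF) : (rename g φ).IsQF := by
  induction h with
  | falsum => exact .falsum
  | of_isAtomic h =>
    cases h with
    | equal t₁ t₂ => exact .of_isAtomic (.equal _ _)
    | rel P ts => exact .of_isAtomic (.rel _ _)
  | imp _ _ h₁ h₂ => exact .imp h₁ h₂

theorem isQF_foldr_inf {l : List (L.Formula X)} (h : ∀ φ ∈ l, φ.IsQF) :
    (l.foldr (· ⊓ ·) ⊤).IsQF := by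
  induction l with
  | nil => exact .top
  | cons φ l ih => exact (h φ (by simp)).inf (ih fun ψ hψ => h ψ (by simp [hψ]))

end Rename

section Produces

variable {D : Type*} (v : ℕ → List D)

theorem flatten_prefix {m n : ℕ} (h : m ≤ n) :
    ((List.range m).map v).flatten <+: ((List.range n).map v).flatten := by
  obtain ⟨d, rfl⟩ := Nat.exists_eq_add_of_le h
  rw [List.range_add, List.map_append, List.flatten_append]
  exact List.prefix_append _ _

theorem exists_produces : ∃ w, Produces v w := by
  by_cases h : ∃ N, ∀ n ≥ N, ((List.range n).map v).flatten = ((List.range N).map v).flatten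
  · obtain ⟨N, hN⟩ := h
    exact ⟨.inl _, N, hN⟩
  push Not at h
  have hlen : ∀ l, ∃ n, l ≤ ((List.range n).map v).flatten.length := by
    intro l
    induction l with
    | zero => exact ⟨0, Nat.zero_le _⟩
    | succ l ih =>
      obtain ⟨N, hN⟩ := ih
      obtain ⟨n, hn, hne⟩ := h N
      have hp := flatten_prefix v hn
      exact ⟨n, Nat.succ_le_of_lt (hN.trans_lt
        (lt_of_le_of_ne hp.length_le fun he => hne (hp.eq_of_length he).symm))⟩
  choose n hn using fun i => hlen (i + 1)
  refine ⟨.inr fun i => ((List.range (n i)).map v).flatten[i]'(hn i), fun m =>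
    ⟨((List.range m).map v).flatten.length, ?_⟩, hlen⟩
  refine List.ext_getElem (by simp) fun i him _ => ?_
  simp only [List.getElem_map, List.getElem_range]
  rcases le_total m (n i) with h | h
  · exact (flatten_prefix v h).getElem him
  · exact ((flatten_prefix v h).getElem (hn i)).symm

end Produces

namespace NRT

variable {L : Language} {Q R D : Type*} [L.Structure D] {nT k : ℕ}

/-- The formula that describes the effect of a transition on a register. -/
def updateRule (u : RegOp) (r : Fin k) : L.Formula (Fin k ⊕ Option (Fin k)) :=
  match u with
  | .keep => Language.Term.equal (.var (.inr (some r))) (.var (.inl r))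
  | .set => Language.Term.equal (.var (.inr (some r))) (.var (.inr none))
  | .guess => ⊤

theorem isQF_updateRule (u : RegOp) (r : Fin k) : (updateRule (L := L) u r).IsQF := by
  cases u
  · exact .of_isAtomic (.equal _ _)
  · exact .of_isAtomic (.equal _ _)
  · exact .top

theorem realize_updateRule (u : RegOp) (s : Fin k) {r r' : Fin k → D} {d : D} :
    (updateRule (L := L) u s).Realize (Sum.elim r fun o => o.elim d r') ↔
      (u = .keep → r' s = r s) ∧ (u = .set → r' s = d) := by
  cases u <;> simp [updateRule, Language.Formula.realize_equal]

open Classical in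
/-- The register system obtained by numbering the transitions and the registers of a transducer. -/
noncomputable def toRegisterSystem (T : NRT L Q R) (eT : T.Δ ≃ Fin nT) (eR : R ≃ Fin k) :
    RegisterSystem L Q nT k where
  src t := (eT.symm t).1.source
  tgt t := (eT.symm t).1.target
  q₀ := T.q₀
  acc t := decide ((eT.symm t).1.target ∈ T.F)
  rule t := rename (fun a => a.elim (.inr none) fun r => .inl (eR r)) (eT.symm t).1.test ⊓
    ((List.finRange k).map fun r => updateRule ((eT.symm t).1.update (eR.symm r)) r).foldr (· ⊓ ·) ⊤
  rule_isQF t := (isQF_rename _ (eT.symm t).1.test_isQF).inf <| isQF_foldr_inf fun φ hφ => by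
    obtain ⟨r, -, rfl⟩ := List.mem_map.1 hφ
    exact isQF_updateRule _ _
  out t := (eT.symm t).1.output.map eR
  init r := T.c₀ (eR.symm r)

variable (T : NRT L Q R) (eT : T.Δ ≃ Fin nT) (eR : R ≃ Fin k)

theorem step_toRegisterSystem (t : Fin nT) (r : Fin k → D) (d : D) (r' : Fin k → D) :
    (T.toRegisterSystem eT eR).Step t r d r' ↔
      (eT.symm t).1.test.Realize (fun a : Option R => a.elim d (r ∘ eR)) ∧
      (∀ s, (eT.symm t).1.update s = RegOp.keep → r' (eR s) = r (eR s)) ∧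
      (∀ s, (eT.symm t).1.update s = RegOp.set → r' (eR s) = d) := by
  have hvalues : (Sum.elim r (fun o => o.elim d r') ∘ fun a : Option R =>
      a.elim (Sum.inr none) fun r => Sum.inl (eR r)) = fun a => a.elim d (r ∘ eR) := by
    funext a
    cases a <;> rfl
  rw [RegisterSystem.Step, toRegisterSystem, Language.Formula.realize_inf, realize_rename, hvalues,
    Language.Formula.Realize.eq_1 (List.foldr _ _ _), Language.BoundedFormula.realize_foldr_inf,
    ← forall_and, ← eR.symm.forall_congr_right]
  simp only [List.mem_map, List.mem_finRange, true_and, forall_exists_index,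
    forall_apply_eq_imp_iff, eR.apply_symm_apply]
  exact and_congr_right fun _ => forall_congr' fun s => realize_updateRule _ _

theorem flatten_eq_outputs {D : Type*} (e : ℕ → Label nT k D) (n : ℕ) :
    ((List.range n).map fun n => ((T.toRegisterSystem eT eR).out (e n).1).map (e n).2.2).flatten =
      (T.toRegisterSystem eT eR).outputs (RegisterSystem.pre e n) := by
  simp [RegisterSystem.outputs, RegisterSystem.pre, List.flatMap, Function.comp_def]

variable {T eT eR}

theorem writes_of_produces {D : Type*} {e : ℕ → Label nT k D} {y : ℕ → D}
    (h : Produces (fun n => ((T.toRegisterSystem eT eR).out (e n).1).map (e n).2.2) (.inr y)) :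
    (T.toRegisterSystem eT eR).Writes e y := by
  obtain ⟨hprefix, hlength⟩ := h
  simp only [flatten_eq_outputs] at hprefix hlength
  refine ⟨fun n i a hi => ?_, fun i => hlength (i + 1)⟩
  obtain ⟨l, hl⟩ := hprefix n
  rw [hl] at hi
  obtain ⟨hil, ha⟩ := List.getElem?_eq_some_iff.1 hi
  simpa only [List.getElem_map, List.getElem_range] using ha

theorem rel_of_accepts {e : ℕ → Label nT k D}
    (he : (T.toRegisterSystem eT eR).Accepts ((T.toRegisterSystem eT eR).start D) e)
    {w : List D ⊕ (ℕ → D)}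
    (hw : Produces (fun n => ((T.toRegisterSystem eT eR).out (e n).1).map (e n).2.2) w) :
    T.Rel (RegisterSystem.inputWord e) w := by
  let C := (T.toRegisterSystem eT eR).config ((T.toRegisterSystem eT eR).start D) e
  refine ⟨fun n => ((C n).1, (C n).2 ∘ eR), _, ?_, fun n => ?_, ?_, hw⟩
  · refine Prod.ext rfl (funext fun r => ?_)
    change ((T.c₀ (eR.symm (eR r)) : L.Constants) : D) = _
    rw [eR.symm_apply_apply]
  · obtain ⟨hsrc, hstep⟩ := RegisterSystem.valid_pre.1 (he.1 (n + 1)) n (Nat.lt_succ_self n)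
    obtain ⟨htest, hkeep, hset⟩ := (step_toRegisterSystem ..).1 hstep
    refine ⟨_, (eT.symm (e n).1).2, hsrc, rfl, htest, hkeep, hset, ?_⟩
    simp [C, RegisterSystem.config, RegisterSystem.next, toRegisterSystem, Function.comp_def]
  · refine Filter.frequently_atTop.2 fun n => ?_
    obtain ⟨m, hm, ha⟩ := he.2 n
    simp only [toRegisterSystem, decide_eq_true_eq] at ha
    exact ⟨m + 1, by omega, ha⟩

theorem exists_accepts_of_rel {x y : ℕ → D} (h : T.Rel x (.inr y)) :
    ∃ e : ℕ → Label nT k D,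
      (T.toRegisterSystem eT eR).Accepts ((T.toRegisterSystem eT eR).start D) e ∧
      RegisterSystem.inputWord e = x ∧ (T.toRegisterSystem eT eR).Writes e y := by
  obtain ⟨C, v, hC, hstep, hfreq, hprod⟩ := h
  choose t ht hsrc htgt htest hkeep hset hout using hstep
  let e : ℕ → Label nT k D := fun n => (eT ⟨t n, ht n⟩, x n, (C (n + 1)).2 ∘ eR.symm)
  have hconfig : ∀ n, (T.toRegisterSystem eT eR).config ((T.toRegisterSystem eT eR).start D) e n =
      ((C n).1, (C n).2 ∘ eR.symm) := by
    rintro (_ | n)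
    · rw [hC]; rfl
    · simp [RegisterSystem.config, RegisterSystem.next, toRegisterSystem, e, htgt]
  refine ⟨e, ⟨fun n => RegisterSystem.valid_pre.2 fun s _ => ?_, fun n => ?_⟩, rfl,
    writes_of_produces ?_⟩
  · rw [hconfig]
    refine ⟨by simp [toRegisterSystem, e, hsrc], (step_toRegisterSystem ..).2 ?_⟩
    simp only [e, Equiv.symm_apply_apply, Function.comp_assoc, Equiv.symm_comp_self,
      Function.comp_id, Function.comp_apply]
    exact ⟨htest s, hkeep s, hset s⟩
  · obtain ⟨_ | m, hm, hF⟩ := Filter.frequently_atTop.1 hfreq (n + 1)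
    · omega
    · exact ⟨m, by omega, by simpa [toRegisterSystem, e, htgt] using hF⟩
  · convert hprod using 1
    funext n
    simp [hout, toRegisterSystem, e, Function.comp_def]

theorem definesFun_toRegisterSystem {f : (ℕ → D) →. (ℕ → D)} (hf : T.Defines f) :
    (T.toRegisterSystem eT eR).DefinesFun f where
  exists_mem {e} he := by
    obtain ⟨w, hw⟩ := exists_produces fun n =>
      ((T.toRegisterSystem eT eR).out (e n).1).map (e n).2.2
    obtain ⟨y, hy, rfl⟩ := (hf _ _).1 (rel_of_accepts he hw)
    exact ⟨y, hy, writes_of_produces hw⟩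
  exists_run hy := exists_accepts_of_rel ((hf _ _).2 ⟨_, hy, rfl⟩)

end NRT

/-! ### Computable predicates -/

section ComputablePredicates

variable {α β : Type*} [Primcodable α] [Primcodable β]

theorem computablePred_comp {p : β → Prop} (hp : ComputablePred p) {f : α → β}
    (hf : Computable f) : ComputablePred fun a => p (f a) := by
  obtain ⟨g, hg, rfl⟩ := ComputablePred.computable_iff.1 hp
  exact ComputablePred.computable_iff.2 ⟨_, hg.comp hf, rfl⟩

theorem computablePred_and {p q : α → Prop} (hp : ComputablePred p) (hq : ComputablePred q) :
    ComputablePred fun a => p a ∧ q a := by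
  obtain ⟨f, hf, rfl⟩ := ComputablePred.computable_iff.1 hp
  obtain ⟨g, hg, rfl⟩ := ComputablePred.computable_iff.1 hq
  exact ComputablePred.computable_iff.2 ⟨_, Primrec.and.to_comp.comp hf hg, by simp⟩

theorem computablePred_imp {p q : α → Prop} (hp : ComputablePred p) (hq : ComputablePred q) :
    ComputablePred fun a => p a → q a :=
  (computablePred_and hp hq.not).not.of_eq fun a => by tauto

theorem computablePred_const (p : Prop) : ComputablePred fun _ : α => p := by
  classical
  exact ComputablePred.computable_iff.2 ⟨fun _ => decide p, Computable.const _, by simp⟩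

theorem computablePred_eq {f g : α → β} (hf : Computable f) (hg : Computable g) :
    ComputablePred fun a => f a = g a := by
  have h : PrimrecPred fun p : β × β => p.1 = p.2 := Primrec.eq
  exact computablePred_comp h.computablePred (hf.pair hg)

theorem computablePred_le {f g : α → ℕ} (hf : Computable f) (hg : Computable g) :
    ComputablePred fun a => f a ≤ g a := by
  have h : PrimrecPred fun p : ℕ × ℕ => p.1 ≤ p.2 := Primrec.nat_le
  exact computablePred_comp h.computablePred (hf.pair hg)

theorem computablePred_exists_lt {p : α → ℕ → Prop}
    (hp : ComputablePred fun a : α × ℕ => p a.1 a.2) {N : α → ℕ} (hN : Computable N) :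
    ComputablePred fun a => ∃ n < N a, p a n := by
  obtain ⟨g, hg, hpg⟩ := ComputablePred.computable_iff.1 hp
  have hiff (a : α) (n : ℕ) : p a n ↔ g (a, n) := iff_of_eq (congrFun hpg (a, n))
  refine ComputablePred.computable_iff.2
    ⟨fun a => Nat.rec false (fun n b => b || g (a, n)) (N a), ?_, ?_⟩
  · refine Computable.nat_rec hN (Computable.const false) (h := fun a s => s.2 || g (a, s.1)) ?_
    exact Primrec.or.to_comp.comp (Computable.snd.comp Computable.snd)
      (hg.comp (Computable.fst.pair (Computable.fst.comp Computable.snd)))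
  · funext a
    simp only [hiff, eq_iff_iff]
    induction N a with
    | zero => simp
    | succ n ih => rw [Nat.exists_lt_succ_right, ih, Bool.or_eq_true]

theorem computablePred_forall_lt {p : α → ℕ → Prop}
    (hp : ComputablePred fun a : α × ℕ => p a.1 a.2) {N : α → ℕ} (hN : Computable N) :
    ComputablePred fun a => ∀ n < N a, p a n :=
  (computablePred_exists_lt (p := fun a n => ¬ p a n) hp.not hN).not.of_eq fun a => by simp

theorem computablePred_exists_mem_option {p : α → β → Prop}
    (hp : ComputablePred fun a : α × β => p a.1 a.2) {o : α → Option β} (ho : Computable o) :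
    ComputablePred fun a => ∃ b, o a = some b ∧ p a b := by
  obtain ⟨g, hg, hpg⟩ := ComputablePred.computable_iff.1 hp
  have hiff (a : α) (b : β) : p a b ↔ g (a, b) := iff_of_eq (congrFun hpg (a, b))
  refine ComputablePred.computable_iff.2
    ⟨fun a => Option.casesOn (o a) false fun b => g (a, b), ?_, ?_⟩
  · exact Computable.option_casesOn ho (Computable.const false) (g := fun a b => g (a, b)) hg
  · funext a
    simp only [hiff, eq_iff_iff]
    cases o a <;> simp

theorem computablePred_exists_mem_list {p : α → β → Prop}
    (hp : ComputablePred fun a : α × β => p a.1 a.2) {l : α → List β} (hl : Computable l) :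
    ComputablePred fun a => ∃ b ∈ l a, p a b := by
  have hget : ComputablePred fun a : α × ℕ => ∃ b, (l a.1)[a.2]? = some b ∧ p a.1 b :=
    computablePred_exists_mem_option (p := fun (a : α × ℕ) b => p a.1 b)
      (computablePred_comp hp ((Computable.fst.comp Computable.fst).pair Computable.snd))
      (Computable.list_getElem?.comp (hl.comp Computable.fst) Computable.snd)
  refine (computablePred_exists_lt (p := fun a n => ∃ b, (l a)[n]? = some b ∧ p a b) hget
    (Computable.list_length.comp hl)).of_eq fun a => ?_
  constructor
  · rintro ⟨n, -, b, hb, h⟩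
    exact ⟨b, List.mem_of_getElem? hb, h⟩
  · rintro ⟨b, hb, h⟩
    obtain ⟨n, hn, rfl⟩ := List.mem_iff_getElem.1 hb
    exact ⟨n, hn, _, List.getElem?_eq_getElem hn, h⟩

theorem computable_fin_curry₁ {n : ℕ} {f : Fin n → α → β} (hf : ∀ i, Computable (f i)) :
    Computable fun p : α × Fin n => f p.2 p.1 := by
  refine Computable.option_some_iff.1 ((Computable.list_getElem?.comp
    ((Computable.list_ofFn hf).comp Computable.fst)
    (Primrec.fin_val.to_comp.comp Computable.snd)).of_eq fun p => ?_)
  simp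

theorem computablePred_fin_curry₁ {n : ℕ} {p : Fin n → α → Prop}
    (hp : ∀ i, ComputablePred (p i)) : ComputablePred fun a : α × Fin n => p a.2 a.1 := by
  choose g hg hp using fun i => ComputablePred.computable_iff.1 (hp i)
  exact ComputablePred.computable_iff.2 ⟨_, computable_fin_curry₁ hg, by
    funext a; exact congrFun (hp a.2) a.1⟩

theorem computable_fin_pi {n : ℕ} {f : Fin n → α → β} (hf : ∀ i, Computable (f i)) :
    Computable fun a => fun i => f i a :=
  (Primrec.vector_get'.to_comp.comp (Computable.vector_ofFn hf)).of_eq fun a => by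
    funext i; simp

end ComputablePredicates

/-! ### Codes of formulas -/

section Codes

variable {L : Language} [Encodable (Σ n, L.Functions n)]

theorem termCode_injective {n : ℕ} : Function.Injective (termCode (L := L) (n := n)) := by
  intro t
  induction t with
  | var x =>
    intro t' h
    rcases x with x | x <;> rcases t' with (y | y) | _ <;>
      simp only [termCode, Nat.pair_eq_pair, Nat.reduceEqDiff, false_and, true_and] at h
    · rw [h]
    · rw [Fin.ext h]
  | func f ts ih =>
    intro t' h
    rcases t' with (y | y) | ⟨g, ts'⟩ <;>
      simp only [termCode, Nat.pair_eq_pair, Nat.reduceEqDiff, false_and, true_and,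
        Encodable.encode_inj, Sigma.mk.injEq] at h
    obtain ⟨⟨rfl, hfg⟩, hts⟩ := h
    obtain rfl := eq_of_heq hfg
    congr 1
    funext i
    exact ih i (congrFun (List.ofFn_injective hts) i)

theorem primrec_termCode_relabel (hL : IsRelConst L) {X α : Type*} [Primcodable α]
    {g : α → X → ℕ} (hg : ∀ x, Primrec fun a => g a x) (t : L.Term (X ⊕ Fin 0)) :
    Primrec fun a => termCode (t.relabel (Sum.map (g a) id)) := by
  cases t with
  | var x =>
    rcases x with x | x
    · exact Primrec₂.natPair.comp (Primrec.const 0) (hg x)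
    · exact x.elim0
  | @func l f ts =>
    cases l with
    | zero =>
      refine (Primrec.const (termCode (Language.Term.func f (Fin.elim0 ·) :
        L.Term (ℕ ⊕ Fin 0)))).of_eq fun a => ?_
      simp [termCode]
    | succ l => exact (hL l).elim f

variable [Encodable (Σ n, L.Relations n)]

theorem formulaCode_injective {n : ℕ} : Function.Injective (formulaCode (L := L) (n := n)) := by
  intro φ
  induction φ with
  | falsum => intro ψ h; cases ψ <;> simp [formulaCode, Nat.pair_eq_pair] at h ⊢
  | equal t₁ t₂ =>
    intro ψ h
    cases ψ <;>
      simp only [formulaCode, Nat.pair_eq_pair, Nat.reduceEqDiff, false_and, true_and] at h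
    rw [termCode_injective h.1, termCode_injective h.2]
  | rel P ts =>
    intro ψ h
    cases ψ <;>
      simp only [formulaCode, Nat.pair_eq_pair, Nat.reduceEqDiff, false_and, true_and,
        Encodable.encode_inj, Sigma.mk.injEq] at h
    obtain ⟨⟨rfl, hP⟩, hts⟩ := h
    obtain rfl := eq_of_heq hP
    congr 1
    funext i
    exact termCode_injective (congrFun (List.ofFn_injective hts) i)
  | imp φ₁ φ₂ ih₁ ih₂ =>
    intro ψ h
    cases ψ <;>
      simp only [formulaCode, Nat.pair_eq_pair, Nat.reduceEqDiff, false_and, true_and] at h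
    rw [ih₁ h.1, ih₂ h.2]
  | all φ ih =>
    intro ψ h
    cases ψ <;>
      simp only [formulaCode, Nat.pair_eq_pair, Nat.reduceEqDiff, false_and, true_and] at h
    rw [ih h]

/-- The code of the conjunction of the formulas with the given codes. The conjunction of `φ` and `ψ`
is `(φ → (ψ → ⊥)) → ⊥`. -/
def conjCode (l : List ℕ) : ℕ :=
  l.foldr (fun a b => Nat.pair 3 (Nat.pair (Nat.pair 3 (Nat.pair a (Nat.pair 3
    (Nat.pair b (Nat.pair 0 0))))) (Nat.pair 0 0))) (formulaCode (⊤ : L.Formula ℕ))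

theorem formulaCode_foldr_inf (l : List (L.Formula ℕ)) :
    formulaCode (l.foldr (· ⊓ ·) ⊤) = conjCode (L := L) (l.map formulaCode) := by
  induction l with
  | nil => rfl
  | cons φ l ih =>
    simp only [List.foldr_cons, List.map_cons, conjCode] at ih ⊢
    rw [← ih]
    rfl

theorem primrec_conjCode : Primrec (conjCode (L := L)) := by
  refine Primrec.list_foldr (f := fun l : List ℕ => l) Primrec.id (Primrec.const _)
    (h := fun _ p => Nat.pair 3 (Nat.pair (Nat.pair 3 (Nat.pair p.1 (Nat.pair 3
      (Nat.pair p.2 (Nat.pair 0 0))))) (Nat.pair 0 0))) ?_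
  have hleft : Primrec fun p : List ℕ × ℕ × ℕ => p.2.1 := Primrec.fst.comp Primrec.snd
  have hright : Primrec fun p : List ℕ × ℕ × ℕ => p.2.2 := Primrec.snd.comp Primrec.snd
  have hnot {f : List ℕ × ℕ × ℕ → ℕ} (hf : Primrec f) :
      Primrec fun p => Nat.pair 3 (Nat.pair (f p) (Nat.pair 0 0)) :=
    Primrec₂.natPair.comp (Primrec.const 3) (Primrec₂.natPair.comp hf (Primrec.const _))
  exact hnot (Primrec₂.natPair.comp (Primrec.const 3) (Primrec₂.natPair.comp hleft (hnot hright)))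

theorem primrec_formulaCode_rename (hL : IsRelConst L) {X α : Type*} [Primcodable α]
    {g : α → X → ℕ} (hg : ∀ x, Primrec fun a => g a x) {φ : L.Formula X} (hφ : φ.IsQF) :
    Primrec fun a => formulaCode (rename (g a) φ) := by
  induction hφ with
  | falsum => exact Primrec.const _
  | of_isAtomic h =>
    cases h with
    | equal t₁ t₂ =>
      exact Primrec₂.natPair.comp (Primrec.const 1) (Primrec₂.natPair.comp
        (primrec_termCode_relabel hL hg t₁) (primrec_termCode_relabel hL hg t₂))
    | rel P ts =>
      exact Primrec₂.natPair.comp (Primrec.const 2) (Primrec₂.natPair.comp (Primrec.const _)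
        (Primrec.encode.comp (Primrec.list_ofFn fun i => primrec_termCode_relabel hL hg (ts i))))
  | imp _ _ h₁ h₂ =>
    exact Primrec₂.natPair.comp (Primrec.const 3) (Primrec₂.natPair.comp h₁ h₂)

theorem DecidableSat.computablePred {D : Type*} [L.Structure D] (h : DecidableSat L D) {α : Type*}
    [Primcodable α] {φ : α → L.Formula ℕ} (hφ : Computable fun a => formulaCode (φ a)) :
    ComputablePred fun a => ∃ v : ℕ → D, (φ a).Realize v :=
  (computablePred_comp h hφ).of_eq fun a => by simp [formulaCode_injective.eq_iff]

end Codes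

/-! ### Names of data values -/

section Names

variable {L : Language} {D : Type*} [L.Structure D] (ρ : Representation L D)

/-- A naming of data values by words: the representation of `d` names `d`, and every other word also
names some data value, whose representation can be computed. -/
structure Naming where
  val : List (Fin ρ.size) → D
  val_enc : ∀ d, val (ρ.enc d) = d
  computable : Computable fun w => ρ.enc (val w)

theorem nonempty_naming [Nonempty D] : Nonempty (Naming ρ) := by
  classical
  obtain ⟨d₀⟩ := ‹Nonempty D›
  let val : List (Fin ρ.size) → D := fun w => if h : ∃ d, ρ.enc d = w then h.choose else d₀
  have hval (w) : ρ.enc (val w) = if ∃ d, ρ.enc d = w then w else ρ.enc d₀ := by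
    by_cases h : ∃ d, ρ.enc d = w
    · simp only [val, dif_pos h, if_pos h]
      exact h.choose_spec
    · simp only [val, dif_neg h, if_neg h]
  refine ⟨⟨val, fun d => ρ.enc_injective ?_, ?_⟩⟩
  · rw [hval, if_pos ⟨d, rfl⟩]
  · refine (Computable.cond ρ.decidable_range.decide Computable.id
      (Computable.const (ρ.enc d₀))).of_eq fun w => ?_
    rw [hval, Bool.cond_decide]
    rfl

variable {ρ} (ν : Naming ρ)

theorem Naming.exists_termName (hL : IsRelConst L) {X α : Type*} [Primcodable α]
    {g : α → X → List (Fin ρ.size)} (hg : ∀ x, Computable fun a => g a x)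
    (t : L.Term (X ⊕ Fin 0)) :
    ∃ h : α → List (Fin ρ.size), Computable h ∧
      ∀ a, t.realize (Sum.elim (ν.val ∘ g a) default) = ν.val (h a) := by
  cases t with
  | var x =>
    rcases x with x | x
    · exact ⟨_, hg x, fun a => rfl⟩
    · exact x.elim0
  | @func l f ts =>
    cases l with
    | zero =>
      refine ⟨_, Computable.const (ρ.enc (Language.Structure.funMap f default)), fun a => ?_⟩
      rw [ν.val_enc, Language.Term.realize_func]
      exact congrArg _ (Subsingleton.elim _ _)
    | succ l => exact (hL l).elim f

theorem Naming.computablePred_realize (hL : IsRelConst L) {X α : Type*} [Primcodable α]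
    {g : α → X → List (Fin ρ.size)} (hg : ∀ x, Computable fun a => g a x) {φ : L.Formula X}
    (hφ : φ.IsQF) : ComputablePred fun a => φ.Realize (ν.val ∘ g a) := by
  induction hφ with
  | falsum => exact (computablePred_const False).of_eq fun _ => Iff.rfl
  | of_isAtomic h =>
    cases h with
    | equal t₁ t₂ =>
      obtain ⟨h₁, hc₁, he₁⟩ := ν.exists_termName hL hg t₁
      obtain ⟨h₂, hc₂, he₂⟩ := ν.exists_termName hL hg t₂
      refine (computablePred_eq (ν.computable.comp hc₁) (ν.computable.comp hc₂)).of_eq fun a => ?_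
      rw [ρ.enc_injective.eq_iff, ← he₁, ← he₂]
      rfl
    | @rel l P ts =>
      choose h hc he using fun i => ν.exists_termName hL hg (ts i)
      refine (computablePred_comp (ρ.decidable_rel _ P)
        (computable_fin_pi fun i => ν.computable.comp (hc i))).of_eq fun _ => ?_
      refine Iff.trans ?_ (Language.BoundedFormula.realize_rel).symm
      simp only [he, ρ.enc_injective.eq_iff]
      exact ⟨fun ⟨v, hv, hva⟩ => funext hva ▸ hv, fun hP => ⟨_, hP, fun _ => rfl⟩⟩
  | imp _ _ h₁ h₂ => exact computablePred_imp h₁ h₂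

end Names

/-! ### Runs as lists of steps -/

section Primrec

variable {α β γ : Type*} [Primcodable α] [Primcodable β] [Primcodable γ]

/-- A list of lists over `l` that contains all lists of length at most `B` if `l` contains all
letters. -/
def allLists {β : Type*} (l : List β) (B : ℕ) : List (List β) :=
  Nat.rec [ [] ] (fun _ ls => [] :: ls.flatMap fun e => l.map fun b => b :: e) B

theorem mem_allLists {β : Type*} {l : List β} (hl : ∀ b, b ∈ l) {B : ℕ} {e : List β}
    (he : e.length ≤ B) : e ∈ allLists l B := by
  induction B generalizing e with
  | zero => simp_all [allLists]
  | succ B ih =>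
    cases e with
    | nil => exact List.mem_cons_self
    | cons b e =>
      refine List.mem_cons_of_mem _ (List.mem_flatMap.2 ⟨e, ih (by simpa using he), ?_⟩)
      exact List.mem_map.2 ⟨b, hl b, rfl⟩

theorem primrec_allLists (l : List β) : Primrec (allLists l) := by
  refine Primrec.nat_rec₁ _ ?_
  refine Primrec.list_cons.comp (Primrec.const []) ?_
  refine Primrec.list_flatMap (f := fun p : ℕ × List (List β) => p.2) Primrec.snd ?_
  exact Primrec.list_map (Primrec.const l)
    (Primrec.list_cons.comp Primrec.snd (Primrec.snd.comp Primrec.fst)).to₂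

theorem exists_primrec_equiv_fin (β : Type*) [Primcodable β] [Finite β] :
    ∃ (n : ℕ) (e : β ≃ Fin n), Primrec e := by
  obtain ⟨n, ⟨e⟩⟩ := Finite.exists_equiv_fin β
  exact ⟨n, e, Primrec.dom_finite e⟩

theorem primrec_finite_curry₁ [Finite β] {f : β → α → γ} (hf : ∀ b, Primrec (f b)) :
    Primrec fun p : α × β => f p.2 p.1 := by
  obtain ⟨n, e, he⟩ := exists_primrec_equiv_fin β
  have h : Primrec₂ fun (i : Fin n) (a : α) => f (e.symm i) a :=
    Primrec.fin_curry₁.2 fun i => hf _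
  exact (h.comp (he.comp Primrec.snd) Primrec.fst).of_eq fun p => by simp

theorem computablePred_finite_curry₁ [Finite β] {p : β → α → Prop}
    (hp : ∀ b, ComputablePred (p b)) : ComputablePred fun a : α × β => p a.2 a.1 := by
  obtain ⟨n, e, he⟩ := exists_primrec_equiv_fin β
  exact (computablePred_comp (computablePred_fin_curry₁ fun i => hp (e.symm i))
    (Computable.fst.pair (he.to_comp.comp Computable.snd))).of_eq fun a => by simp

theorem primrec_list_mapIdx {f : α → List β} {g : α → ℕ → β → γ} (hf : Primrec f)
    (hg : Primrec fun p : α × ℕ × β => g p.1 p.2.1 p.2.2) :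
    Primrec fun a => (f a).mapIdx (g a) := by
  refine (Primrec.list_foldl (σ := List γ) hf (Primrec.const [])
    (h := fun a p => p.1 ++ [g a p.1.length p.2]) ?_).of_eq fun a => ?_
  · exact Primrec.list_concat.comp (Primrec.fst.comp Primrec.snd)
      (hg.comp (Primrec.fst.pair ((Primrec.list_length.comp (Primrec.fst.comp Primrec.snd)).pair
        (Primrec.snd.comp Primrec.snd))))
  · induction f a using List.reverseRecOn with
    | nil => rfl
    | append_singleton l b ih =>
      rw [List.foldl_append, ih, List.mapIdx_append]
      simp

theorem primrec_list_countP {p : β → Bool} (hp : Primrec p) :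
    Primrec fun l : List β => l.countP p := by
  have h : PrimrecPred fun b => p b = true := ⟨inferInstance, hp.of_eq fun b => by simp⟩
  refine (Primrec.list_length.comp (Primrec.listFilter h)).of_eq fun l => ?_
  rw [List.countP_eq_length_filter]
  simp

end Primrec

namespace RegisterSystem

section Primrec

variable {L : Language} {Q A : Type*} [Primcodable A] {nT k : ℕ} (σ : RegisterSystem L Q nT k)

theorem primrec_outputs : Primrec fun e : List (Label nT k A) => σ.outputs e := by
  refine Primrec.list_flatMap (f := fun e : List (Label nT k A) => e) Primrec.id ?_
  refine Primrec.list_map (f := fun p : List (Label nT k A) × Label nT k A => σ.out p.2.1)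
    ((Primrec.dom_finite σ.out).comp (Primrec.fst.comp Primrec.snd)) ?_
  exact Primrec.fin_app.comp (Primrec.snd.comp (Primrec.snd.comp (Primrec.snd.comp Primrec.fst)))
    Primrec.snd

theorem primrec_visits : Primrec σ.visits := primrec_list_countP (Primrec.dom_finite σ.acc)

theorem primrec_transitions : Primrec fun e : List (Label nT k A) => transitions e :=
  Primrec.list_map Primrec.id (Primrec.fst.comp Primrec.snd).to₂

theorem primrec_inputs : Primrec fun e : List (Label nT k A) => inputs e :=
  Primrec.list_map Primrec.id (Primrec.fst.comp (Primrec.snd.comp Primrec.snd)).to₂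

end Primrec

/-- A step of a run: the previous transition, if any, the previous contents of the registers, and a
label. -/
abbrev Link (nT k : ℕ) (A : Type*) : Type _ := (Option (Fin nT) × (Fin k → A)) × Label nT k A

variable {nT k : ℕ}

/-- The steps of a run. -/
def links {A : Type*} :
    Option (Fin nT) × (Fin k → A) → List (Label nT k A) → List (Link nT k A)
  | _, [] => []
  | p, l :: e => (p, l) :: links (some l.1, l.2.2) e

/-- The values that a step assigns to the variables of its rule. -/
def Link.values {A : Type*} (x : Link nT k A) : Fin k ⊕ Option (Fin k) → A :=
  Sum.elim x.1.2 fun o => o.elim x.2.2.1 x.2.2.2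

section Guard

variable {L : Language} {Q D : Type*} [L.Structure D] (σ : RegisterSystem L Q nT k)

open Classical in
/-- The condition for a step with the transition `t` after the transition `p`. -/
noncomputable def guard (p : Option (Fin nT)) (t : Fin nT) : L.Formula (Fin k ⊕ Option (Fin k)) :=
  if σ.src t = p.elim σ.q₀ σ.tgt then σ.rule t else ⊥

theorem isQF_guard (p : Option (Fin nT)) (t : Fin nT) : (σ.guard p t).IsQF := by
  unfold guard
  split
  · exact σ.rule_isQF t
  · exact .falsum

theorem enabled_iff_realize_guard {A : Type*} (v : A → D) (x : Link nT k A) :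
    σ.Enabled (x.1.1.elim σ.q₀ σ.tgt, v ∘ x.1.2) (x.2.map v) ↔
      (σ.guard x.1.1 x.2.1).Realize (v ∘ x.values) := by
  have hvalues : v ∘ x.values =
      Sum.elim (v ∘ x.1.2) fun o => o.elim (x.2.map v).2.1 (x.2.map v).2.2 := by
    funext y
    rcases y with y | _ | y <;> rfl
  rw [hvalues, guard, Enabled, Step, Label.map]
  by_cases hs : σ.src x.2.1 = x.1.1.elim σ.q₀ σ.tgt <;> simp [hs]

theorem valid_iff_realize_guard {A : Type*} (v : A → D) (p : Option (Fin nT) × (Fin k → A))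
    (e : List (Label nT k A)) :
    σ.Valid (p.1.elim σ.q₀ σ.tgt, v ∘ p.2) (e.map (Label.map v)) ↔
      ∀ x ∈ links p e, (σ.guard x.1.1 x.2.1).Realize (v ∘ x.values) := by
  induction e generalizing p with
  | nil => simp [links]
  | cons l e ih =>
    rw [links, List.forall_mem_cons, ← ih (some l.1, l.2.2), ← σ.enabled_iff_realize_guard v (p, l)]
    rfl

end Guard

section Primrec

variable {A : Type*} [Primcodable A]

theorem links_eq_foldl {A : Type*} (p : Option (Fin nT) × (Fin k → A)) (e : List (Label nT k A)) :
    links p e = (e.foldl (fun s l => ((some l.1, l.2.2), s.2 ++ [(s.1, l)])) (p, [])).2 := by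
  suffices ∀ (p) (acc : List (Link nT k A)), (e.foldl
      (fun s l => ((some l.1, l.2.2), s.2 ++ [(s.1, l)])) (p, acc)).2 = acc ++ links p e by
    simpa using (this p []).symm
  clear p
  induction e with
  | nil => intro p acc; simp [links]
  | cons l e ih => intro p acc; simp [links, ih]

theorem primrec_links :
    Primrec fun p : (Option (Fin nT) × (Fin k → A)) × List (Label nT k A) => links p.1 p.2 := by
  have hfoldl := Primrec.list_foldl (σ := (Option (Fin nT) × (Fin k → A)) × List (Link nT k A))
    (f := fun p : (Option (Fin nT) × (Fin k → A)) × List (Label nT k A) => p.2)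
    (g := fun p => (p.1, []))
    (h := fun _ s => ((some s.2.1, s.2.2.2), s.1.2 ++ [(s.1.1, s.2)]))
    Primrec.snd (Primrec.fst.pair (Primrec.const [])) (by
      have hs := Primrec.snd (α := (Option (Fin nT) × (Fin k → A)) × List (Label nT k A))
        (β := ((Option (Fin nT) × (Fin k → A)) × List (Link nT k A)) × Label nT k A)
      have hl := Primrec.snd.comp hs
      have hacc := Primrec.fst.comp hs
      exact ((Primrec.option_some.comp (Primrec.fst.comp hl)).pair
        (Primrec.snd.comp (Primrec.snd.comp hl))).pair
        (Primrec.list_concat.comp (Primrec.snd.comp hacc) ((Primrec.fst.comp hacc).pair hl)))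
  exact (Primrec.snd.comp hfoldl).of_eq fun p => (links_eq_foldl p.1 p.2).symm

theorem primrec_values (x : Fin k ⊕ Option (Fin k)) :
    Primrec fun a : Link nT k A => a.values x := by
  have hl := Primrec.snd (α := Option (Fin nT) × (Fin k → A)) (β := Label nT k A)
  rcases x with r | _ | r
  · exact Primrec.fin_app.comp (Primrec.snd.comp Primrec.fst) (Primrec.const r)
  · exact Primrec.fst.comp (Primrec.snd.comp hl)
  · exact Primrec.fin_app.comp (Primrec.snd.comp (Primrec.snd.comp hl)) (Primrec.const r)

end Primrec

/-! ### Runs with variables in place of data values -/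

section Symbolic

variable {nT k : ℕ}

/-- The variable for the input data value number `s` of the run `b`; the first `j` input data values
are common to all runs. -/
def inVar (b j s : ℕ) : ℕ := Nat.pair (if s < j then 0 else b) (Nat.pair s 0)

/-- The variable for the register `r` before the step number `s` of the run `b`. -/
def regVar (b s : ℕ) (r : Fin k) : ℕ := Nat.pair b (Nat.pair s (r + 1))

/-- The run `b` with the transitions `ts`, with variables instead of data values. -/
def symbolicRun (b j : ℕ) (ts : List (Fin nT)) : List (Label nT k ℕ) :=
  ts.mapIdx fun s t => (t, inVar b j s, regVar b (s + 1))

@[simp]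
theorem length_symbolicRun (b j : ℕ) (ts : List (Fin nT)) :
    (symbolicRun (k := k) b j ts).length = ts.length := by
  simp [symbolicRun]

@[simp]
theorem transitions_symbolicRun (b j : ℕ) (ts : List (Fin nT)) :
    transitions (symbolicRun (k := k) b j ts) = ts :=
  List.ext_getElem (by simp) fun s _ _ => by simp [transitions, symbolicRun]

theorem exists_symbolicRun_append (b j : ℕ) (t t' : List (Fin nT)) :
    ∃ e : List (Label nT k ℕ),
      symbolicRun b j (t ++ t') = symbolicRun b j t ++ e ∧ transitions e = t' :=
  ⟨_, List.mapIdx_append, List.ext_getElem (by simp) fun s _ _ => by simp [transitions]⟩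

theorem take_inputs_symbolicRun (b : ℕ) {j : ℕ} {ts : List (Fin nT)} (h : j ≤ ts.length) :
    (inputs (symbolicRun (k := k) b j ts)).take j =
      (List.range j).map fun s => Nat.pair 0 (Nat.pair s 0) := by
  refine List.ext_getElem (by simp [h]) fun s hs _ => ?_
  have hsj : s < j := (lt_min_iff.1 (List.length_take ▸ hs)).1
  simp [inputs, symbolicRun, inVar, hsj]

theorem map_symbolicRun {D : Type*} {v : ℕ → D} {b j : ℕ} {e : List (Label nT k D)}
    (hin : ∀ (s) (hs : s < e.length), v (inVar b j s) = e[s].2.1)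
    (hreg : ∀ (s) (hs : s < e.length), v ∘ regVar b (s + 1) = e[s].2.2) :
    (symbolicRun b j (transitions e)).map (Label.map v) = e := by
  refine List.ext_getElem (by simp) fun s _ hs => ?_
  simp [symbolicRun, Label.map, transitions, hin s hs, hreg s hs]

/-- The data value at the variable with the parameters `s` and `r` in a run. -/
def runValue {D : Type*} (d₀ : D) (r₀ : Fin k → D) (e : List (Label nT k D)) (s : ℕ) : ℕ → D
  | 0 => e[s]?.elim d₀ fun l => l.2.1
  | r + 1 => if h : r < k then ((r₀ :: e.map fun l => l.2.2)[s]?).elim d₀ (· ⟨r, h⟩) else d₀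

theorem exists_valuation {D : Type*} (d₀ : D) (r₀ : Fin k → D) {e₁ e₂ : List (Label nT k D)} {j : ℕ}
    (h : ∀ s < j, (inputs e₁)[s]? = (inputs e₂)[s]?) :
    ∃ v : ℕ → D, v ∘ regVar 1 0 = r₀ ∧ v ∘ regVar 2 0 = r₀ ∧
      (symbolicRun 1 j (transitions e₁)).map (Label.map v) = e₁ ∧
      (symbolicRun 2 j (transitions e₂)).map (Label.map v) = e₂ := by
  let run (b : ℕ) : List (Label nT k D) := if b = 2 then e₂ else e₁
  let v (n : ℕ) : D := runValue d₀ r₀ (run n.unpair.1) n.unpair.2.unpair.1 n.unpair.2.unpair.2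
  have hv (b s r) : v (Nat.pair b (Nat.pair s r)) = runValue d₀ r₀ (run b) s r := by simp [v]
  have hinit (b) : v ∘ regVar b 0 = r₀ := by
    funext r
    simp [hv, regVar, runValue]
  have hreg (b s) (hs : s < (run b).length) : v ∘ regVar b (s + 1) = (run b)[s].2.2 := by
    funext r
    simp [hv, regVar, runValue, hs]
  have hcommon (s) (hs : s < j) : ((run 0)[s]?.map fun l => l.2.1) = e₂[s]?.map fun l => l.2.1 := by
    have hs := h s hs
    rwa [inputs, inputs, List.getElem?_map, List.getElem?_map] at hs
  have hin (b s) (hb : b = 1 ∨ b = 2) (hs : s < (run b).length) :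
      v (inVar b j s) = (run b)[s].2.1 := by
    have hrun : ((run (if s < j then 0 else b))[s]?.map fun l => l.2.1) = some (run b)[s].2.1 := by
      split_ifs with hsj
      · rcases hb with rfl | rfl
        · exact congrArg _ (List.getElem?_eq_getElem hs)
        · exact (hcommon s hsj).trans (congrArg _ (List.getElem?_eq_getElem hs))
      · exact congrArg _ (List.getElem?_eq_getElem hs)
    obtain ⟨l, hl, hls⟩ := Option.map_eq_some_iff.1 hrun
    rw [inVar, hv, runValue, hl]
    exact hls
  exact ⟨v, hinit 1, hinit 2, map_symbolicRun (fun s => hin 1 s (.inl rfl)) (hreg 1),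
    map_symbolicRun (fun s => hin 2 s (.inr rfl)) (hreg 2)⟩

theorem primrec_inVar (b : ℕ) : Primrec₂ (inVar b) :=
  Primrec₂.natPair.comp
    (Primrec.ite (Primrec.nat_lt.comp Primrec.snd Primrec.fst) (Primrec.const 0) (Primrec.const b))
    (Primrec₂.natPair.comp Primrec.snd (Primrec.const 0))

theorem primrec_regVar (b : ℕ) : Primrec fun s => (regVar b s : Fin k → ℕ) :=
  Primrec.fin_curry.2 (Primrec₂.natPair.comp (Primrec.const b) (Primrec₂.natPair.comp Primrec.fst
    (Primrec.succ.comp (Primrec.fin_val.comp Primrec.snd)))).to₂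

theorem primrec_symbolicRun (b : ℕ) :
    Primrec fun p : ℕ × List (Fin nT) => symbolicRun (k := k) b p.1 p.2 :=
  primrec_list_mapIdx Primrec.snd
    ((Primrec.snd.comp Primrec.snd).pair (((primrec_inVar b).comp (Primrec.fst.comp Primrec.fst)
      (Primrec.fst.comp Primrec.snd)).pair
      ((primrec_regVar b).comp (Primrec.succ.comp (Primrec.fst.comp Primrec.snd)))))

end Symbolic

section Formula

variable {L : Language} {Q : Type*} {nT k : ℕ} (σ : RegisterSystem L Q nT k)

/-- The registers contain their initial values. -/
def initFormula : L.Formula (Fin k) :=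
  ((List.finRange k).map fun r =>
    Language.Term.equal (.var r) (Language.Constants.term (σ.init r))).foldr (· ⊓ ·) ⊤

/-- The conditions for the run `b` with the transitions `ts`. -/
noncomputable def runConditions (b j : ℕ) (ts : List (Fin nT)) : List (L.Formula ℕ) :=
  rename (regVar b 0) σ.initFormula ::
    (links (none, regVar b 0) (symbolicRun (k := k) b j ts)).map fun x =>
      rename x.values (σ.guard x.1.1 x.2.1)

/-- Two runs agree on their first `j` input data values and differ at the variables `p` and `q`. -/
noncomputable def mismatchFormula (j : ℕ) (ts₁ ts₂ : List (Fin nT)) (p q : ℕ) : L.Formula ℕ :=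
  (rename ![p, q] (Language.Term.equal (.var 0) (.var 1) : L.Formula (Fin 2)).not ::
    (σ.runConditions 1 j ts₁ ++ σ.runConditions 2 j ts₂)).foldr (· ⊓ ·) ⊤

section Realize

variable {D : Type*} [L.Structure D]

theorem realize_initFormula (r : Fin k → D) :
    σ.initFormula.Realize r ↔ (σ.q₀, r) = σ.start D := by
  unfold initFormula Language.Formula.Realize start
  rw [Language.BoundedFormula.realize_foldr_inf]
  simp only [List.mem_map, List.mem_finRange, true_and, forall_exists_index,
    forall_apply_eq_imp_iff, Prod.mk.injEq, funext_iff]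
  refine forall_congr' fun i => (Language.Formula.realize_equal (x := r)).trans ?_
  rw [Language.Term.realize_constants]
  exact Iff.rfl

theorem realize_runConditions (b j : ℕ) (ts : List (Fin nT)) (v : ℕ → D) :
    (∀ φ ∈ σ.runConditions b j ts, φ.Realize v) ↔
      (σ.q₀, v ∘ regVar b 0) = σ.start D ∧
        σ.Valid (σ.start D) ((symbolicRun b j ts).map (Label.map v)) := by
  have hvalid := σ.valid_iff_realize_guard v (none, regVar b 0) (symbolicRun b j ts)
  rw [runConditions, List.forall_mem_cons, realize_rename, realize_initFormula]
  refine and_congr_right fun hstart => ?_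
  rw [← hstart]
  refine Iff.trans ?_ hvalid.symm
  simp only [List.forall_mem_map, realize_rename]

theorem realize_mismatchFormula (j : ℕ) (ts₁ ts₂ : List (Fin nT)) (p q : ℕ) (v : ℕ → D) :
    (σ.mismatchFormula j ts₁ ts₂ p q).Realize v ↔ v p ≠ v q ∧
      ((∀ φ ∈ σ.runConditions 1 j ts₁, φ.Realize v) ∧
        ∀ φ ∈ σ.runConditions 2 j ts₂, φ.Realize v) := by
  unfold mismatchFormula Language.Formula.Realize
  rw [Language.BoundedFormula.realize_foldr_inf, List.forall_mem_cons, List.forall_mem_append]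
  refine and_congr ((realize_rename _ _ _).trans ?_) Iff.rfl
  rw [Language.Formula.realize_not, Language.Formula.realize_equal]
  rfl

end Realize

section Code

variable [Encodable (Σ n, L.Functions n)] [Encodable (Σ n, L.Relations n)]

theorem primrec_formulaCode_guard (hL : IsRelConst L) : Primrec fun x : Link nT k ℕ =>
    formulaCode (rename x.values (σ.guard x.1.1 x.2.1)) :=
  (primrec_finite_curry₁ (f := fun (c : Option (Fin nT) × Fin nT) (x : Link nT k ℕ) =>
    formulaCode (rename x.values (σ.guard c.1 c.2)))
    fun c => primrec_formulaCode_rename hL primrec_values (σ.isQF_guard c.1 c.2)).comp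
    (Primrec.id.pair ((Primrec.fst.comp Primrec.fst).pair (Primrec.fst.comp Primrec.snd)))

theorem primrec_runConditions (hL : IsRelConst L) (b : ℕ) :
    Primrec fun p : ℕ × List (Fin nT) => (σ.runConditions b p.1 p.2).map formulaCode := by
  refine (Primrec.list_cons.comp (Primrec.const (formulaCode (rename (regVar b 0) σ.initFormula)))
    (Primrec.list_map (primrec_links.comp ((Primrec.const (none, regVar b 0)).pair
      (primrec_symbolicRun b))) ((σ.primrec_formulaCode_guard hL).comp Primrec.snd).to₂)).of_eq
    fun p => ?_
  simp [runConditions]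

theorem primrec_mismatchFormula (hL : IsRelConst L) :
    Primrec fun x : (ℕ × List (Fin nT) × List (Fin nT)) × ℕ × ℕ =>
      formulaCode (σ.mismatchFormula x.1.1 x.1.2.1 x.1.2.2 x.2.1 x.2.2) := by
  have hj := Primrec.fst.comp (Primrec.fst (α := ℕ × List (Fin nT) × List (Fin nT)) (β := ℕ × ℕ))
  have hts := Primrec.snd.comp (Primrec.fst (α := ℕ × List (Fin nT) × List (Fin nT)) (β := ℕ × ℕ))
  have hpq := Primrec.snd (α := ℕ × List (Fin nT) × List (Fin nT)) (β := ℕ × ℕ)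
  have hne : Primrec fun x : (ℕ × List (Fin nT) × List (Fin nT)) × ℕ × ℕ =>
      formulaCode (rename ![x.2.1, x.2.2]
        (Language.Term.equal (.var 0) (.var 1) : L.Formula (Fin 2)).not) := by
    refine primrec_formulaCode_rename hL (fun i => ?_) (.not (.of_isAtomic (.equal _ _)))
    refine Fin.cases ?_ (fun i => ?_) i
    · exact Primrec.fst.comp hpq
    · exact (Primrec.snd.comp hpq).of_eq fun x => by simp
  refine ((primrec_conjCode (L := L)).comp (Primrec.list_cons.comp hne (Primrec.list_append.comp
    ((σ.primrec_runConditions hL 1).comp (hj.pair (Primrec.fst.comp hts)))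
    ((σ.primrec_runConditions hL 2).comp (hj.pair (Primrec.snd.comp hts)))))).of_eq fun x => ?_
  rw [mismatchFormula, formulaCode_foldr_inf, List.map_cons, List.map_append]

end Code

end Formula

end RegisterSystem

/-! ### Mismatches are decidable -/

namespace RegisterSystem

variable {L : Language} {Q : Type*} {nT k : ℕ} (σ : RegisterSystem L Q nT k)

/-- The transitions of a run and of its prolongation have the lengths and the final states required
from an output witness. -/
def IsWitnessShape (K j : ℕ) (u : List (Fin nT) × List (Fin nT)) : Prop :=
  j ≤ u.1.length ∧ K ≤ σ.visits u.2

/-- Some runs with the transitions `u.1 ++ u.2` and `w.1 ++ w.2` have the same first `j` input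
letters and write different letters at position `i` during `u.1` and `w.1`. -/
def HasDistinctOutputs (D : Type*) [L.Structure D] (j i : ℕ)
    (u w : List (Fin nT) × List (Fin nT)) : Prop :=
  ∃ p, (σ.outputs (symbolicRun 1 j u.1))[i]? = some p ∧
    ∃ q, (σ.outputs (symbolicRun 2 j w.1))[i]? = some q ∧
      ∃ v : ℕ → D, (σ.mismatchFormula j (u.1 ++ u.2) (w.1 ++ w.2) p q).Realize v

/-- A mismatch between runs with the transitions `u.1 ++ u.2` and `w.1 ++ w.2`. -/
def SymbolicMismatch (D : Type*) [L.Structure D] (K j : ℕ) (τ : List (Fin nT)) (i : ℕ)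
    (u w : List (Fin nT) × List (Fin nT)) : Prop :=
  (τ.length ≤ j ∧ u.1.take τ.length = τ) ∧
    (σ.IsWitnessShape K j u ∧ σ.IsWitnessShape K j w) ∧ σ.HasDistinctOutputs D j i u w

variable {σ} {K j i : ℕ}

section Soundness

variable {D : Type*} [L.Structure D]

theorem OutputWitness.of_symbolicRun {u : List (Fin nT) × List (Fin nT)} {b p : ℕ} {v : ℕ → D}
    (hu : σ.IsWitnessShape K j u)
    (hv : σ.Valid (σ.start D) ((symbolicRun b j (u.1 ++ u.2)).map (Label.map v)))
    (hp : (σ.outputs (symbolicRun b j u.1))[i]? = some p) :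
    ∃ e', σ.OutputWitness K j i ((symbolicRun b j u.1).map (Label.map v)) e' (v p) := by
  obtain ⟨e', he', ht⟩ := exists_symbolicRun_append (k := k) b j u.1 u.2
  rw [he', List.map_append] at hv
  refine ⟨_, hv, by simpa using hu.1, by simpa [ht] using hu.2, ?_⟩
  rw [outputs_map, List.getElem?_map, hp, Option.map_some]

theorem SymbolicMismatch.mismatch {τ : List (Fin nT)} {u w : List (Fin nT) × List (Fin nT)}
    (h : σ.SymbolicMismatch D K j τ i u w) : σ.Mismatch D K j τ i := by
  obtain ⟨⟨-, hτ⟩, ⟨hu, hw⟩, p, hp, q, hq, v, hv⟩ := h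
  rw [realize_mismatchFormula, realize_runConditions, realize_runConditions] at hv
  obtain ⟨hne, ⟨-, hv₁⟩, -, hv₂⟩ := hv
  obtain ⟨e₁', he₁⟩ := OutputWitness.of_symbolicRun hu hv₁ hp
  obtain ⟨e₂', he₂⟩ := OutputWitness.of_symbolicRun hw hv₂ hq
  refine ⟨_, _, _, _, _, _, he₁, he₂, ?_, ?_, hne⟩
  · rw [transitions_map, transitions_symbolicRun, List.prefix_iff_eq_take, hτ]
  · rw [inputs_map, inputs_map, ← List.map_take, ← List.map_take, take_inputs_symbolicRun _ hu.1,
      take_inputs_symbolicRun _ hw.1]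

end Soundness

section Completeness

variable {D : Type*}

theorem getElem?_inputs_append {e₁ e₁' e₂ e₂' : List (Label nT k D)} (h₁ : j ≤ e₁.length)
    (h₂ : j ≤ e₂.length) (h : (inputs e₁).take j = (inputs e₂).take j) {s : ℕ} (hs : s < j) :
    (inputs (e₁ ++ e₁'))[s]? = (inputs (e₂ ++ e₂'))[s]? := by
  rw [inputs_append, inputs_append, List.getElem?_append_left (by simpa using hs.trans_le h₁),
    List.getElem?_append_left (by simpa using hs.trans_le h₂), ← List.getElem?_take_of_lt hs, h,
    List.getElem?_take_of_lt hs]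

theorem map_symbolicRun_of_append {b : ℕ} {e e' : List (Label nT k D)} {v : ℕ → D}
    (h : (symbolicRun b j (transitions (e ++ e'))).map (Label.map v) = e ++ e') :
    (symbolicRun b j (transitions e)).map (Label.map v) = e := by
  obtain ⟨r, hr, -⟩ := exists_symbolicRun_append (k := k) b j (transitions e) (transitions e')
  rw [transitions_append, hr, List.map_append] at h
  exact (List.append_inj h (by simp)).1

variable [L.Structure D]

theorem OutputWitness.isWitnessShape {e e' : List (Label nT k D)} {a : D}
    (h : σ.OutputWitness K j i e e' a) :
    σ.IsWitnessShape K j (transitions e, transitions e') :=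
  ⟨by simpa using h.le_length, h.visits⟩

theorem OutputWitness.exists_variable {b : ℕ} {e e' : List (Label nT k D)} {a : D} {v : ℕ → D}
    (h : σ.OutputWitness K j i e e' a)
    (hv : (symbolicRun b j (transitions (e ++ e'))).map (Label.map v) = e ++ e') :
    ∃ p, (σ.outputs (symbolicRun b j (transitions e)))[i]? = some p ∧ v p = a := by
  have ha := h.outputs
  rwa [← map_symbolicRun_of_append hv, outputs_map, List.getElem?_map,
    Option.map_eq_some_iff] at ha

theorem exists_symbolicMismatch {τ : List (Fin nT)} {e₁ e₁' e₂ e₂' : List (Label nT k D)} {x y : D}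
    (hτj : τ.length ≤ j) (h₁ : σ.OutputWitness K j i e₁ e₁' x)
    (h₂ : σ.OutputWitness K j i e₂ e₂' y) (hτ : τ <+: transitions e₁)
    (hin : (inputs e₁).take j = (inputs e₂).take j) (hne : x ≠ y) :
    σ.SymbolicMismatch D K j τ i (transitions e₁, transitions e₁')
      (transitions e₂, transitions e₂') := by
  obtain ⟨v, hv₁, hv₂, hrun₁, hrun₂⟩ := exists_valuation x (σ.start D).2 fun s =>
    getElem?_inputs_append (e₁' := e₁') (e₂' := e₂') h₁.le_length h₂.le_length hin
  obtain ⟨p, hp, rfl⟩ := h₁.exists_variable hrun₁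
  obtain ⟨q, hq, rfl⟩ := h₂.exists_variable hrun₂
  refine ⟨⟨hτj, (List.prefix_iff_eq_take.1 hτ).symm⟩, ⟨h₁.isWitnessShape, h₂.isWitnessShape⟩,
    p, hp, q, hq, v, ?_⟩
  rw [realize_mismatchFormula, realize_runConditions, realize_runConditions, hv₁, hv₂,
    ← transitions_append, ← transitions_append, hrun₁, hrun₂]
  exact ⟨hne, ⟨rfl, h₁.valid⟩, rfl, h₂.valid⟩

end Completeness

section Computability

/-- Pairs of lists of length at most `B`. -/
def listPairs {β : Type*} (l : List β) (B : ℕ) : List (List β × List β) :=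
  (allLists l B).flatMap fun e => (allLists l B).map fun e' => (e, e')

theorem mem_listPairs {β : Type*} {l : List β} (hl : ∀ b, b ∈ l) {B : ℕ} {e e' : List β}
    (he : e.length ≤ B) (he' : e'.length ≤ B) : (e, e') ∈ listPairs l B :=
  List.mem_flatMap.2 ⟨e, mem_allLists hl he, List.mem_map.2 ⟨e', mem_allLists hl he', rfl⟩⟩

theorem primrec_listPairs {β : Type*} [Primcodable β] (l : List β) : Primrec (listPairs l) :=
  Primrec.list_flatMap (primrec_allLists l)
    (Primrec.list_map ((primrec_allLists l).comp Primrec.fst)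
      (Primrec.pair (Primrec.snd.comp Primrec.fst) Primrec.snd).to₂).to₂

variable {α : Type*} [Primcodable α] {dj di : α → ℕ} {u w : α → List (Fin nT) × List (Fin nT)}

variable (σ)

theorem primrec_getElem?_outputs_symbolicRun (b : ℕ) (hj : Primrec dj) (hi : Primrec di)
    (hu : Primrec u) :
    Primrec fun a => (σ.outputs (symbolicRun (k := k) b (dj a) (u a).1))[di a]? :=
  Primrec.list_getElem?.comp (σ.primrec_outputs.comp
    ((primrec_symbolicRun b).comp (hj.pair (Primrec.fst.comp hu)))) hi

theorem computablePred_isWitnessShape (K : ℕ) (hj : Primrec dj) (hu : Primrec u) :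
    ComputablePred fun a => σ.IsWitnessShape K (dj a) (u a) :=
  computablePred_and
    (computablePred_le hj.to_comp (Primrec.list_length.comp (Primrec.fst.comp hu)).to_comp)
    (computablePred_le (Computable.const K) (σ.primrec_visits.comp (Primrec.snd.comp hu)).to_comp)

variable {D : Type*} [L.Structure D]
variable [Encodable (Σ n, L.Functions n)] [Encodable (Σ n, L.Relations n)]

theorem computablePred_hasDistinctOutputs (hL : IsRelConst L) (hsat : DecidableSat L D)
    (hj : Primrec dj) (hi : Primrec di) (hu : Primrec u) (hw : Primrec w) :
    ComputablePred fun a => σ.HasDistinctOutputs D (dj a) (di a) (u a) (w a) := by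
  have hts : Primrec fun a => (dj a, (u a).1 ++ (u a).2, (w a).1 ++ (w a).2) :=
    hj.pair ((Primrec.list_append.comp (Primrec.fst.comp hu) (Primrec.snd.comp hu)).pair
      (Primrec.list_append.comp (Primrec.fst.comp hw) (Primrec.snd.comp hw)))
  have hpq : Primrec fun x : (α × ℕ) × ℕ => (x.1.2, x.2) :=
    (Primrec.snd.comp Primrec.fst).pair Primrec.snd
  have hargs := (hts.comp (Primrec.fst.comp (Primrec.fst (α := α × ℕ) (β := ℕ)))).pair hpq
  have hcode := ((σ.primrec_mismatchFormula hL).comp hargs).to_comp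
  refine computablePred_exists_mem_option (p := fun a p =>
    ∃ q, (σ.outputs (symbolicRun 2 (dj a) (w a).1))[di a]? = some q ∧ ∃ v : ℕ → D,
      (σ.mismatchFormula (dj a) ((u a).1 ++ (u a).2) ((w a).1 ++ (w a).2) p q).Realize v) ?_
    (σ.primrec_getElem?_outputs_symbolicRun 1 hj hi hu).to_comp
  refine computablePred_exists_mem_option (p := fun (x : α × ℕ) q => ∃ v : ℕ → D,
    (σ.mismatchFormula (dj x.1) ((u x.1).1 ++ (u x.1).2) ((w x.1).1 ++ (w x.1).2) x.2 q).Realize v)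
    ?_ ((σ.primrec_getElem?_outputs_symbolicRun 2 hj hi hw).to_comp.comp Computable.fst)
  exact hsat.computablePred hcode

theorem computablePred_symbolicMismatch (hL : IsRelConst L) (hsat : DecidableSat L D) (K : ℕ)
    {t : α → List (Fin nT)} (hj : Primrec dj) (ht : Primrec t) (hi : Primrec di) (hu : Primrec u)
    (hw : Primrec w) :
    ComputablePred fun a => σ.SymbolicMismatch D K (dj a) (t a) (di a) (u a) (w a) := by
  have hlen : Primrec fun a => (t a).length := Primrec.list_length.comp ht
  have hprefix : ComputablePred fun a => (u a).1.take (t a).length = t a :=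
    computablePred_eq (Primrec.list_take.comp hlen (Primrec.fst.comp hu)).to_comp ht.to_comp
  exact computablePred_and
    (computablePred_and (computablePred_le hlen.to_comp hj.to_comp) hprefix)
    (computablePred_and (computablePred_and (σ.computablePred_isWitnessShape K hj hu)
      (σ.computablePred_isWitnessShape K hj hw))
      (σ.computablePred_hasDistinctOutputs hL hsat hj hi hu hw))

theorem computablePred_mismatch [Finite Q] (hL : IsRelConst L) (hD : Oligomorphic L D)
    (hsat : DecidableSat L D) (K : ℕ) :
    ComputablePred fun a : ℕ × List (Fin nT) × ℕ =>
      a.2.1.length ≤ a.1 ∧ σ.Mismatch D K a.1 a.2.1 a.2.2 := by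
  obtain ⟨B, hB⟩ := exists_short_mismatch σ hD K
  let pairs (a : ℕ × List (Fin nT) × ℕ) := listPairs (List.finRange nT) (a.1 + (a.2.2 + 1) * B)
  have hpairs : Primrec pairs :=
    (primrec_listPairs _).comp (Primrec.nat_add.comp Primrec.fst (Primrec.nat_mul.comp
      (Primrec.succ.comp (Primrec.snd.comp Primrec.snd)) (Primrec.const B)))
  have ha := Primrec.fst.comp (Primrec.fst (α := (ℕ × List (Fin nT) × ℕ) ×
    (List (Fin nT) × List (Fin nT))) (β := List (Fin nT) × List (Fin nT)))
  refine (computablePred_exists_mem_list (p := fun a u =>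
    ∃ w ∈ pairs a, σ.SymbolicMismatch D K a.1 a.2.1 a.2.2 u w) ?_ hpairs.to_comp).of_eq fun a => ?_
  · exact computablePred_exists_mem_list (p := fun (x : (ℕ × List (Fin nT) × ℕ) ×
      (List (Fin nT) × List (Fin nT))) w => σ.SymbolicMismatch D K x.1.1 x.1.2.1 x.1.2.2 x.2 w)
      (σ.computablePred_symbolicMismatch hL hsat K (Primrec.fst.comp ha)
        (Primrec.fst.comp (Primrec.snd.comp ha)) (Primrec.snd.comp (Primrec.snd.comp ha))
        (Primrec.snd.comp Primrec.fst) Primrec.snd) (hpairs.to_comp.comp Computable.fst)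
  · constructor
    · rintro ⟨u, -, w, -, h⟩
      exact ⟨h.1.1, h.mismatch⟩
    · rintro ⟨hτj, h⟩
      obtain ⟨e₁, e₁', e₂, e₂', x, y, h₁, h₂, hτ, hin, hne, hlen⟩ := hB _ _ _ hτj h
      simp only [List.mem_cons, List.not_mem_nil, or_false, forall_eq_or_imp, forall_eq] at hlen
      exact ⟨_, mem_listPairs List.mem_finRange (by simpa using hlen.1) (by simpa using hlen.2.1),
        _, mem_listPairs List.mem_finRange (by simpa using hlen.2.2.1) (by simpa using hlen.2.2.2),
        exists_symbolicMismatch hτj h₁ h₂ hτ hin hne⟩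

end Computability

end RegisterSystem

/-! ### Searching for the next output letter -/

theorem computable_decode_bind {α β γ : Type*} [Primcodable α] [Primcodable β] [Primcodable γ]
    {c : α → ℕ} (hc : Computable c) {g : α → β → Option γ}
    (hg : Computable fun p : α × β => g p.1 p.2) :
    Computable fun a => (Encodable.decode (c a)).bind (g a) :=
  Computable.option_bind (Computable.decode.comp hc) hg

namespace RegisterSystem

variable {L : Language} {Q D : Type*} [L.Structure D] {nT k : ℕ} (σ : RegisterSystem L Q nT k)
  {ρ : Representation L D} (ν : Naming ρ)

/-- A run, a prolongation of the run, and a length of the input, with letters from `A`. -/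
abbrev Candidate (nT k : ℕ) (A : Type*) : Type _ := List (Label nT k A) × List (Label nT k A) × ℕ

/-- The names of the initial contents of the registers. -/
def startNames (ρ : Representation L D) : Fin k → List (Fin ρ.size) := fun r => ρ.enc (σ.init r : D)

/-- The run certifies that its output at position `i` is the output of `f` at position `i` for all
inputs that start with the letters named by `u`. The strategy `κ` says which of the transitions of
the run are taken into account when mismatches with other runs are excluded. -/
structure Certifies (K : ℕ) (κ : List (Fin nT) → List (Fin nT)) (u : List (List (Fin ρ.size)))
    (i : ℕ) (x : Candidate nT k (List (Fin ρ.size))) : Prop where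
  le_letters : x.2.2 ≤ u.length
  le_length : x.2.2 ≤ x.1.length
  take_inputs : (inputs x.1).take x.2.2 = u.take x.2.2
  visits : K ≤ σ.visits (transitions x.2.1)
  realize_guards : ∀ l ∈ links (none, σ.startNames ρ) (x.1 ++ x.2.1),
    (σ.guard l.1.1 l.2.1).Realize (ν.val ∘ l.values)
  not_mismatch : ¬ ((κ ((transitions x.1).take x.2.2)).length ≤ x.2.2 ∧
    σ.Mismatch D K x.2.2 (κ ((transitions x.1).take x.2.2)) i)

open Classical in
/-- The letter at position `i` of the output that a run certifies. -/
noncomputable def certified (K : ℕ) (κ : List (Fin nT) → List (Fin nT))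
    (a : List (List (Fin ρ.size)) × ℕ × ℕ) (x : Candidate nT k (List (Fin ρ.size))) :
    Option (List (Fin ρ.size)) :=
  bif decide (σ.Certifies ν K κ a.1 a.2.1 x) then
    (σ.outputs x.1)[a.2.1]?.map fun p => ρ.enc (ν.val p)
  else none

/-- The attempt number `c` to find the letter at position `i` of the output, given names of the
letters read, tests the candidate with the code `c.unpair.1`. Thus every candidate is tested
infinitely often. -/
noncomputable def search (K : ℕ) (κ : List (Fin nT) → List (Fin nT))
    (a : List (List (Fin ρ.size)) × ℕ × ℕ) : Option (List (Fin ρ.size)) :=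
  (Primcodable.toEncodable.decode (α := Candidate nT k (List (Fin ρ.size))) a.2.2.unpair.1).bind
    (σ.certified ν K κ a)

section Correctness

variable {σ ν} {K : ℕ} {κ : List (Fin nT) → List (Fin nT)} {f : (ℕ → D) →. (ℕ → D)}

theorem search_eq_some {a : List (List (Fin ρ.size)) × ℕ × ℕ} {w : List (Fin ρ.size)}
    (h : σ.search ν K κ a = some w) :
    ∃ x : Candidate nT k (List (Fin ρ.size)), σ.Certifies ν K κ a.1 a.2.1 x ∧
      ∃ p, (σ.outputs x.1)[a.2.1]? = some p ∧ ρ.enc (ν.val p) = w := by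
  classical
  obtain ⟨x, -, hx⟩ := Option.bind_eq_some_iff.1 h
  unfold certified at hx
  by_cases hc : σ.Certifies ν K κ a.1 a.2.1 x
  · rw [decide_eq_true hc, cond_true, Option.map_eq_some_iff] at hx
    exact ⟨x, hc, hx⟩
  · simp [decide_eq_false hc] at hx

theorem val_comp_startNames : (σ.q₀, ν.val ∘ σ.startNames ρ) = σ.start D :=
  Prod.ext rfl (funext fun _ => ν.val_enc _)

theorem valid_map_val_iff (e : List (Label nT k (List (Fin ρ.size)))) :
    σ.Valid (σ.start D) (e.map (Label.map ν.val)) ↔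
      ∀ l ∈ links (none, σ.startNames ρ) e, (σ.guard l.1.1 l.2.1).Realize (ν.val ∘ l.values) := by
  rw [← σ.valid_iff_realize_guard ν.val (none, σ.startNames ρ) e]
  simp only [Option.elim_none, val_comp_startNames]

theorem map_val_map_enc (e : List (Label nT k D)) :
    (e.map (Label.map ρ.enc)).map (Label.map ν.val) = e := by
  rw [List.map_map]
  refine List.map_id'' (fun l => ?_) e
  exact Prod.ext rfl (Prod.ext (ν.val_enc _) (funext fun _ => ν.val_enc _))

theorem map_val_letterNames (x : ℕ → D) (n : ℕ) : (letterNames ρ.enc x n).map ν.val = pre x n := by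
  simp only [letterNames, pre, List.map_map]
  exact List.map_congr_left fun s _ => ν.val_enc _

theorem Certifies.outputWitness {u : List (List (Fin ρ.size))} {i : ℕ}
    {x : Candidate nT k (List (Fin ρ.size))} (h : σ.Certifies ν K κ u i x) {p : List (Fin ρ.size)}
    (hp : (σ.outputs x.1)[i]? = some p) :
    σ.OutputWitness K x.2.2 i (x.1.map (Label.map ν.val)) (x.2.1.map (Label.map ν.val))
      (ν.val p) where
  valid := by
    rw [← List.map_append, valid_map_val_iff]
    exact h.realize_guards
  le_length := by simpa using h.le_length
  visits := by simpa using h.visits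
  outputs := by rw [outputs_map, List.getElem?_map, hp, Option.map_some]

theorem search_sound (hκ : ∀ l, κ l <+: l) (hf : σ.DefinesFun f) {x y : ℕ → D} (hy : y ∈ f x)
    {j i c : ℕ} {w : List (Fin ρ.size)}
    (h : σ.search ν K κ (letterNames ρ.enc x j, i, c) = some w) : w = ρ.enc (y i) := by
  obtain ⟨⟨e, e', n⟩, hcert, p, hp, rfl⟩ := search_eq_some h
  have hnj : n ≤ j := length_letterNames ρ.enc x j ▸ hcert.le_letters
  have hκn := hκ ((transitions e).take n)
  have hmis : ¬ σ.Mismatch D K n (κ ((transitions e).take n)) i := fun hm =>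
    hcert.not_mismatch ⟨hκn.length_le.trans (List.length_take_le _ _), hm⟩
  by_contra hne
  obtain ⟨g, hg, rfl, hw⟩ := hf.exists_run hy
  obtain ⟨N, hN, g', hg'⟩ := hg.exists_outputWitness hw K n i
  refine hmis ⟨_, _, pre g N, g', _, y i, hcert.outputWitness hp, hg', ?_, ?_,
    fun h => hne (h ▸ rfl)⟩
  · rw [transitions_map]
    exact hκn.trans (List.take_prefix _ _)
  · rw [inputs_map, ← List.map_take, hcert.take_inputs, List.map_take, map_val_letterNames,
      pre_take _ hnj, inputs_pre_take hN]

theorem OutputWitness.certifies {e : ℕ → Label nT k D} {n : ℕ} {e' : List (Label nT k D)} {a : D}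
    {i j j' : ℕ} (hw : σ.OutputWitness K j i (pre e n) e' a) (hj : j ≤ j')
    (h : ¬ σ.Mismatch D K j (κ (transitions (pre e j))) i) :
    σ.Certifies ν K κ (letterNames ρ.enc (inputWord e) j') i
      ((pre e n).map (Label.map ρ.enc), e'.map (Label.map ρ.enc), j) where
  le_letters := (length_letterNames _ _ _).symm ▸ hj
  le_length := (List.length_map _).symm ▸ hw.le_length
  take_inputs := by
    have hn : j ≤ n := length_pre e n ▸ hw.le_length
    rw [inputs_map, ← List.map_take, inputs_pre_take hn, pre_map]
    exact (pre_take _ hj).symm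
  visits := by simpa using hw.visits
  realize_guards := by
    rw [← valid_map_val_iff, List.map_append, map_val_map_enc, map_val_map_enc]
    exact hw.valid
  not_mismatch := fun hm => h <| by
    have hn : j ≤ n := length_pre e n ▸ hw.le_length
    have hmis := hm.2
    rwa [transitions_map, transitions_pre, pre_take _ hn, ← transitions_pre] at hmis

theorem search_complete {e : ℕ → Label nT k D} (he : σ.Accepts (σ.start D) e) {y : ℕ → D}
    (hy : σ.Writes e y) {i j : ℕ} (h : ¬ σ.Mismatch D K j (κ (transitions (pre e j))) i) :
    ∃ c, ∀ N, ∀ j' ≥ j,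
      σ.search ν K κ (letterNames ρ.enc (inputWord e) j', i, Nat.pair c N) ≠ none := by
  obtain ⟨n, -, e', hw⟩ := he.exists_outputWitness hy K j i
  let x : Candidate nT k (List (Fin ρ.size)) :=
    ((pre e n).map (Label.map ρ.enc), e'.map (Label.map ρ.enc), j)
  refine ⟨Primcodable.toEncodable.encode x, fun N j' hj' => ?_⟩
  have hcert : σ.Certifies ν K κ (letterNames ρ.enc (inputWord e) j') i x := hw.certifies hj' h
  have hout : (σ.outputs x.1)[i]? = some (ρ.enc (y i)) := by
    rw [outputs_map, List.getElem?_map, hw.outputs, Option.map_some]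
  simp [search, certified, hcert, hout]

end Correctness

section Computability

theorem computablePred_realize_guards (hL : IsRelConst L) :
    ComputablePred fun e : List (Label nT k (List (Fin ρ.size))) =>
      ∀ l ∈ links (none, σ.startNames ρ) e,
        (σ.guard l.1.1 l.2.1).Realize (ν.val ∘ l.values) := by
  have hguard : ComputablePred fun l : Link nT k (List (Fin ρ.size)) =>
      (σ.guard l.1.1 l.2.1).Realize (ν.val ∘ l.values) :=
    computablePred_comp (computablePred_finite_curry₁
      (p := fun (c : Option (Fin nT) × Fin nT) (l : Link nT k (List (Fin ρ.size))) =>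
        (σ.guard c.1 c.2).Realize (ν.val ∘ l.values))
      fun c => ν.computablePred_realize hL (fun x => (primrec_values x).to_comp)
        (σ.isQF_guard c.1 c.2))
      (Primrec.id.pair ((Primrec.fst.comp Primrec.fst).pair (Primrec.fst.comp Primrec.snd))).to_comp
  refine (computablePred_exists_mem_list
    (p := fun (_ : List (Label nT k (List (Fin ρ.size)))) l =>
      ¬ (σ.guard l.1.1 l.2.1).Realize (ν.val ∘ l.values))
    (computablePred_comp hguard.not Computable.snd) (l := fun e => links (none, σ.startNames ρ) e)
    (primrec_links.comp ((Primrec.const _).pair Primrec.id)).to_comp).not.of_eq fun e => ?_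
  push Not
  rfl

variable [Encodable (Σ n, L.Functions n)] [Encodable (Σ n, L.Relations n)]
variable [Finite Q] (hL : IsRelConst L) (hD : Oligomorphic L D) (hsat : DecidableSat L D) (K : ℕ)
  {κ : List (Fin nT) → List (Fin nT)} (hκ : Primrec κ)

include hL hD hsat hκ

theorem computablePred_certifies :
    ComputablePred fun a : (List (List (Fin ρ.size)) × ℕ) × Candidate nT k (List (Fin ρ.size)) =>
      σ.Certifies ν K κ a.1.1 a.1.2 a.2 := by
  have hu := Primrec.fst.comp (Primrec.fst (α := List (List (Fin ρ.size)) × ℕ)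
    (β := Candidate nT k (List (Fin ρ.size))))
  have hi := Primrec.snd.comp (Primrec.fst (α := List (List (Fin ρ.size)) × ℕ)
    (β := Candidate nT k (List (Fin ρ.size))))
  have he := Primrec.fst.comp (Primrec.snd (α := List (List (Fin ρ.size)) × ℕ)
    (β := Candidate nT k (List (Fin ρ.size))))
  have hsnd := Primrec.snd.comp (Primrec.snd (α := List (List (Fin ρ.size)) × ℕ)
    (β := Candidate nT k (List (Fin ρ.size))))
  have he' := Primrec.fst.comp hsnd
  have hj := Primrec.snd.comp hsnd
  have hτ := hκ.comp (Primrec.list_take.comp hj (primrec_transitions.comp he))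
  refine (computablePred_and
    (computablePred_le hj.to_comp (Primrec.list_length.comp hu).to_comp) <| computablePred_and
    (computablePred_le hj.to_comp (Primrec.list_length.comp he).to_comp) <| computablePred_and
    (computablePred_eq (Primrec.list_take.comp hj (primrec_inputs.comp he)).to_comp
      (Primrec.list_take.comp hj hu).to_comp) <| computablePred_and
    (computablePred_le (Computable.const K)
      (σ.primrec_visits.comp (primrec_transitions.comp he')).to_comp) <| computablePred_and
    (computablePred_comp (σ.computablePred_realize_guards ν hL)
      (Primrec.list_append.comp he he').to_comp)
    (computablePred_comp (σ.computablePred_mismatch hL hD hsat K)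
      (hj.pair (hτ.pair hi)).to_comp).not).of_eq fun a => ?_
  exact ⟨fun ⟨h₁, h₂, h₃, h₄, h₅, h₆⟩ => ⟨h₁, h₂, h₃, h₄, h₅, h₆⟩,
    fun ⟨h₁, h₂, h₃, h₄, h₅, h₆⟩ => ⟨h₁, h₂, h₃, h₄, h₅, h₆⟩⟩

theorem computable_certified :
    Computable fun b : (List (List (Fin ρ.size)) × ℕ × ℕ) × Candidate nT k (List (Fin ρ.size)) =>
      σ.certified ν K κ b.1 b.2 := by
  classical
  have hfst := Primrec.fst (α := List (List (Fin ρ.size)) × ℕ × ℕ)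
    (β := Candidate nT k (List (Fin ρ.size)))
  have hi := Primrec.fst.comp (Primrec.snd.comp hfst)
  have hx := Primrec.snd (α := List (List (Fin ρ.size)) × ℕ × ℕ)
    (β := Candidate nT k (List (Fin ρ.size)))
  have hcertifies := computablePred_comp (σ.computablePred_certifies ν hL hD hsat K hκ)
    (((Primrec.fst.comp hfst).pair hi).pair hx).to_comp
  have houtput := (Primrec.list_getElem?.comp (σ.primrec_outputs.comp (Primrec.fst.comp hx)) hi)
  exact Computable.cond hcertifies.decide
    (Computable.option_map houtput.to_comp (ν.computable.comp Computable.snd).to₂)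
    (Computable.const none)

theorem computable_search : Computable (σ.search (k := k) ν K κ) := by
  have hc : Computable fun a : List (List (Fin ρ.size)) × ℕ × ℕ => a.2.2.unpair.1 :=
    Computable.fst.comp (Computable.unpair.comp (Computable.snd.comp Computable.snd))
  exact computable_decode_bind hc (σ.computable_certified ν hL hD hsat K hκ)

end Computability

end RegisterSystem

/-! ### Correct algorithms on letters -/

section LetterRun

variable {n : ℕ} {D : Type*} {chk : List (List (Fin n)) × ℕ × ℕ → Option (List (Fin n))}
  {rd : ℕ × ℕ → Bool} {enc : D → List (Fin n)} {x y : ℕ → D}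

/-- The argument of the search for a letter in a configuration of an algorithm on letters. -/
abbrev LetterCfg.query (c : LetterCfg n) (enc : D → List (Fin n)) (x : ℕ → D) :
    List (List (Fin n)) × ℕ × ℕ :=
  (letterNames enc x c.read, c.written, c.counter)

theorem letterRun_succ (k : ℕ) :
    letterRun chk rd enc x (k + 1) = letterStep chk rd enc x (letterRun chk rd enc x k) :=
  Function.iterate_succ_apply' _ _ _

theorem letterStep_of_eq_some {c : LetterCfg n} {w : List (Fin n)}
    (h : chk (c.query enc x) = some w) :
    letterStep chk rd enc x c =
      ⟨c.read, c.written + 1, 0, c.out ++ (w.map some ++ [none])⟩ := by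
  simp [letterStep, h]

theorem letterStep_of_eq_none {c : LetterCfg n} (h : chk (c.query enc x) = none) :
    letterStep chk rd enc x c =
      ⟨bif rd (c.read, c.written) then c.read + 1 else c.read, c.written, c.counter + 1,
        c.out⟩ := by
  simp [letterStep, h]

/-- The letters found by `chk` on the input `x` are those of the output `y`. -/
def IsSound (chk : List (List (Fin n)) × ℕ × ℕ → Option (List (Fin n))) (enc : D → List (Fin n))
    (x y : ℕ → D) : Prop :=
  ∀ j i c w, chk (letterNames enc x j, i, c) = some w → w = enc (y i)

/-- Once `j` letters of `x` have been read, one of the attempts to find the output letter at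
position `i` succeeds. The number of the attempt is a pair whose second component is arbitrary: the
attempt succeeds infinitely often, so that it does not matter when the `j`th letter is read. -/
def Finds (chk : List (List (Fin n)) × ℕ × ℕ → Option (List (Fin n))) (enc : D → List (Fin n))
    (x : ℕ → D) (i j : ℕ) : Prop :=
  ∃ c, ∀ N, ∀ j' ≥ j, chk (letterNames enc x j', i, Nat.pair c N) ≠ none

theorem IsSound.out_eq (h : IsSound chk enc x y) (k : ℕ) :
    (letterRun chk rd enc x k).out = encPrefix enc y (letterRun chk rd enc x k).written := by
  induction k with
  | zero => rfl
  | succ k ih =>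
    rw [letterRun_succ]
    cases hc : chk ((letterRun chk rd enc x k).query enc x) with
    | none => rw [letterStep_of_eq_none hc, ih]
    | some w => rw [letterStep_of_eq_some hc, encPrefix_succ, ← ih, h _ _ _ _ hc]

theorem monotone_read_letterRun : Monotone fun k => (letterRun chk rd enc x k).read := by
  refine monotone_nat_of_le_succ fun k => ?_
  rw [letterRun_succ]
  cases hc : chk ((letterRun chk rd enc x k).query enc x) with
  | none =>
    rw [letterStep_of_eq_none hc]
    cases rd ((letterRun chk rd enc x k).read, (letterRun chk rd enc x k).written) <;> simp
  | some w => rw [letterStep_of_eq_some hc]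

section Stuck

variable {k : ℕ}
  (hstuck : ∀ m, chk ((letterRun chk rd enc x (k + m)).query enc x) = none)

include hstuck

theorem letterRun_of_stuck (m : ℕ) :
    (letterRun chk rd enc x (k + m)).written = (letterRun chk rd enc x k).written ∧
      (letterRun chk rd enc x (k + m)).counter = (letterRun chk rd enc x k).counter + m := by
  induction m with
  | zero => exact ⟨rfl, rfl⟩
  | succ m ih =>
    rw [← Nat.add_assoc, letterRun_succ, letterStep_of_eq_none (hstuck m)]
    exact ⟨ih.1, congrArg (· + 1) ih.2⟩

theorem le_read_of_stuck (hrd : ∀ m, rd ((letterRun chk rd enc x (k + m)).read,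
    (letterRun chk rd enc x k).written) = true) (m : ℕ) :
    m ≤ (letterRun chk rd enc x (k + m)).read := by
  induction m with
  | zero => exact Nat.zero_le _
  | succ m ih =>
    rw [← Nat.add_assoc, letterRun_succ, letterStep_of_eq_none (hstuck m),
      (letterRun_of_stuck hstuck m).1, hrd m]
    exact Nat.succ_le_succ ih

theorem not_finds_of_stuck (M : ℕ) :
    ¬ Finds chk enc x (letterRun chk rd enc x k).written (letterRun chk rd enc x (k + M)).read := by
  rintro ⟨c, hc⟩
  obtain ⟨m, hm⟩ := Nat.exists_eq_add_of_le
    (Nat.right_le_pair c ((letterRun chk rd enc x k).counter + M))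
  obtain ⟨hwritten, hcounter⟩ := letterRun_of_stuck hstuck (M + m)
  have hnone := hstuck (M + m)
  rw [LetterCfg.query, hwritten, hcounter, ← Nat.add_assoc (LetterCfg.counter _), ← hm] at hnone
  exact hc _ _ (monotone_read_letterRun (by omega)) hnone

theorem false_of_stuck (hfalse : ∀ i j, rd (j, i) = false → Finds chk enc x i j)
    (hfind : ∀ i, ∃ j, Finds chk enc x i j) : False := by
  have hrd (m : ℕ) : rd ((letterRun chk rd enc x (k + m)).read,
      (letterRun chk rd enc x k).written) = true := by
    by_contra h
    exact not_finds_of_stuck hstuck m (hfalse _ _ (Bool.eq_false_of_not_eq_true h))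
  obtain ⟨j, c, hc⟩ := hfind (letterRun chk rd enc x k).written
  exact not_finds_of_stuck hstuck j
    ⟨c, fun N j' hj' => hc N j' ((le_read_of_stuck hstuck hrd j).trans hj')⟩

end Stuck

theorem exists_written_eq (hfalse : ∀ i j, rd (j, i) = false → Finds chk enc x i j)
    (hfind : ∀ i, ∃ j, Finds chk enc x i j) (i : ℕ) :
    ∃ k, (letterRun chk rd enc x k).written = i := by
  induction i with
  | zero => exact ⟨0, rfl⟩
  | succ i ih =>
    obtain ⟨k, hk⟩ := ih
    by_contra! hne
    have hnone (k' : ℕ) (hk' : (letterRun chk rd enc x k').written = i) :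
        chk ((letterRun chk rd enc x k').query enc x) = none := by
      by_contra hc
      obtain ⟨w, hw⟩ := Option.ne_none_iff_exists'.1 hc
      refine hne (k' + 1) ?_
      rw [letterRun_succ, letterStep_of_eq_some hw, hk']
    have hwritten (m : ℕ) : (letterRun chk rd enc x (k + m)).written = i := by
      induction m with
      | zero => exact hk
      | succ m ih =>
        rw [← Nat.add_assoc, letterRun_succ, letterStep_of_eq_none (hnone _ ih)]
        exact ih
    exact false_of_stuck (fun m => hnone _ (hwritten m)) hfalse hfind

theorem read_le_of_written_lt {m : ℕ → ℕ} (hrd : ∀ i j, rd (j, i) = true → ∀ i' > i, j < m i')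
    (k : ℕ) {i : ℕ} (hi : (letterRun chk rd enc x k).written < i) :
    (letterRun chk rd enc x k).read ≤ m i := by
  induction k with
  | zero => exact Nat.zero_le _
  | succ k ih =>
    rw [letterRun_succ] at hi ⊢
    cases hc : chk ((letterRun chk rd enc x k).query enc x) with
    | none =>
      rw [letterStep_of_eq_none hc] at hi ⊢
      cases h : rd ((letterRun chk rd enc x k).read, (letterRun chk rd enc x k).written) with
      | false => simpa [h] using ih hi
      | true => simpa [h] using hrd _ _ h i hi
    | some w =>
      rw [letterStep_of_eq_some hc] at hi ⊢
      exact ih ((Nat.lt_succ_self _).trans hi)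

theorem exists_written_eq_and_read_le {m : ℕ → ℕ}
    (hrd : ∀ i j, rd (j, i) = true → ∀ i' > i, j < m i') {i k : ℕ}
    (hk : (letterRun chk rd enc x k).written = i + 1) :
    ∃ k, (letterRun chk rd enc x k).written = i + 1 ∧
      (letterRun chk rd enc x k).read ≤ m (i + 1) := by
  induction k with
  | zero => exact absurd hk (Nat.succ_ne_zero i).symm
  | succ k ih =>
    cases hc : chk ((letterRun chk rd enc x k).query enc x) with
    | none =>
      rw [letterRun_succ, letterStep_of_eq_none hc] at hk
      exact ih hk
    | some w =>
      refine ⟨k + 1, hk, ?_⟩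
      rw [letterRun_succ, letterStep_of_eq_some hc] at hk ⊢
      exact read_le_of_written_lt hrd k (hk ▸ Nat.lt_succ_self _)

theorem exists_machine_of_search {f : (ℕ → D) →. (ℕ → D)} (hchk : Computable chk)
    (hrd : Computable rd) (hsound : ∀ x, ∀ y ∈ f x, IsSound chk enc x y)
    (hfalse : ∀ x, ∀ y ∈ f x, ∀ i j, rd (j, i) = false → Finds chk enc x i j)
    (hfind : ∀ x, ∀ y ∈ f x, ∀ i, ∃ j, Finds chk enc x i j) :
    ∃ M : Machine n, M.Computes enc f ∧ ∀ m : ℕ → ℕ,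
      (∀ i j, rd (j, i) = true → ∀ i' > i, j < m i') →
      ∀ i x, (f x).Dom → M.OutputLengthGE enc x (m i) i := by
  obtain ⟨M, hM⟩ := exists_machine_simulates_letterRun hchk hrd
  refine ⟨M, fun x y hy => ⟨fun t => ?_, fun l => ?_⟩, fun m hm i x hx => ?_⟩
  · obtain ⟨k, hk⟩ := (hM enc x).2 t
    have hk : (M.run enc x t).out <+: (letterRun chk rd enc x k).out := hk
    exact ⟨_, (hsound x y hy).out_eq k ▸ hk⟩
  · obtain ⟨k, hk⟩ := exists_written_eq (hfalse x y hy) (hfind x y hy) l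
    obtain ⟨t, ht⟩ := (hM enc x).1 k
    have hout := (hsound x y hy).out_eq (rd := rd) k
    rw [hk] at hout
    exact ⟨t, (congrArg Prod.snd ht).trans hout ▸ List.prefix_rfl⟩
  · obtain ⟨y, hy⟩ := Part.dom_iff_mem.1 hx
    cases i with
    | zero => exact ⟨0, Nat.zero_le _, Nat.zero_le _⟩
    | succ i =>
      obtain ⟨_, hk⟩ := exists_written_eq (hfalse x y hy) (hfind x y hy) (i + 1)
      obtain ⟨k, hk, hread⟩ := exists_written_eq_and_read_le hm hk
      obtain ⟨t, ht⟩ := (hM enc x).1 k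
      refine ⟨t, (congrArg Prod.fst ht).le.trans (encPrefix_prefix enc x hread).length_le, ?_⟩
      have hout : (M.run enc x t).out = encPrefix enc y (i + 1) :=
        (congrArg Prod.snd ht).trans (hk ▸ (hsound x y hy).out_eq k)
      rw [hout, count_encPrefix]

end LetterRun

/-! ### Computability of continuous functions -/

namespace RegisterSystem

variable {L : Language} [Encodable (Σ n, L.Functions n)] [Encodable (Σ n, L.Relations n)]
  {Q D : Type*} [Finite Q] [L.Structure D] {nT k : ℕ} {σ : RegisterSystem L Q nT k}
  {f : (ℕ → D) →. (ℕ → D)}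

theorem DefinesFun.isComputable [Nonempty D] (hf : σ.DefinesFun f) (hL : IsRelConst L)
    (hD : Oligomorphic L D) (hsat : DecidableSat L D) (ρ : Representation L D)
    (hc : IsContinuous f) : IsComputable ρ f := by
  obtain ⟨ν⟩ := nonempty_naming ρ
  obtain ⟨K, hK⟩ := σ.exists_isLiveBound hD
  have hfind : ∀ x, ∀ y ∈ f x, ∀ i, ∃ j, Finds (σ.search ν K id) ρ.enc x i j := by
    intro x y hy i
    obtain ⟨e, he, rfl, hw⟩ := hf.exists_run hy
    obtain ⟨j, hj⟩ := exists_not_mismatch hD hK hf hc he i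
    exact ⟨j, search_complete he hw hj⟩
  obtain ⟨M, hM, -⟩ := exists_machine_of_search (rd := fun _ => true)
    (σ.computable_search ν hL hD hsat K Primrec.id) (Computable.const true)
    (fun x y hy j i c w h => search_sound (fun _ => List.prefix_rfl) hf hy h)
    (fun _ _ _ _ _ h => absurd h.symm Bool.false_ne_true) hfind
  exact ⟨M, hM⟩

theorem computablePred_mismatch_nil (hL : IsRelConst L) (hD : Oligomorphic L D)
    (hsat : DecidableSat L D) (K : ℕ) :
    ComputablePred fun a : ℕ × ℕ => σ.Mismatch D K a.1 [] a.2 :=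
  (computablePred_comp (σ.computablePred_mismatch hL hD hsat K) (Computable.fst.pair
    ((Computable.const []).pair Computable.snd))).of_eq fun a => by simp

-- The machine reads another letter exactly when the letters read so far do not yet determine the
-- next letter of the output. It therefore respects every modulus of continuity, even if the modulus
-- is not computable.
theorem DefinesFun.isMComputable [Nonempty D] (hf : σ.DefinesFun f) (hL : IsRelConst L)
    (hD : Oligomorphic L D) (hsat : DecidableSat L D) (ρ : Representation L D) {m : ℕ → ℕ}
    (hm : IsMContinuous f m) : IsMComputable ρ f m := by
  classical
  obtain ⟨ν⟩ := nonempty_naming ρ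
  obtain ⟨K, hK⟩ := σ.exists_isLiveBound hD
  rw [isMContinuous_iff hK hf] at hm
  have hfind : ∀ x, ∀ y ∈ f x, ∀ i j, ¬ σ.Mismatch D K j [] i →
      Finds (σ.search ν K fun _ => []) ρ.enc x i j := by
    intro x y hy i j h
    obtain ⟨e, he, rfl, hw⟩ := hf.exists_run hy
    exact search_complete he hw h
  obtain ⟨M, hM, hmod⟩ := exists_machine_of_search
    (σ.computable_search ν hL hD hsat K (κ := fun _ => []) (Primrec.const []))
    (computablePred_mismatch_nil (σ := σ) hL hD hsat K).decide
    (fun x y hy j i c w h => search_sound (fun _ => List.nil_prefix) hf hy h)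
    (fun x y hy i j h => hfind x y hy i j (of_decide_eq_false h))
    (fun x y hy i => ⟨m (i + 1), hfind x y hy i _ (hm (i + 1) i (Nat.lt_succ_self i))⟩)
  refine ⟨M, hM, hmod m fun i j hij i' hi' => ?_⟩
  by_contra hle
  exact hm i' i hi' ((of_decide_eq_true hij).mono (not_lt.1 hle))

theorem DefinesFun.isUniformlyComputable [Nonempty D] (hf : σ.DefinesFun f) (hL : IsRelConst L)
    (hD : Oligomorphic L D) (hsat : DecidableSat L D) (ρ : Representation L D)
    (hc : IsUniformlyContinuous f) : IsUniformlyComputable ρ f := by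
  classical
  obtain ⟨K, hK⟩ := σ.exists_isLiveBound hD
  obtain ⟨m, hm⟩ := hc
  rw [isMContinuous_iff hK hf] at hm
  have hdec : ComputablePred fun p : ℕ × ℕ => ∀ i' < p.1, ¬ σ.Mismatch D K p.2 [] i' :=
    computablePred_forall_lt (p := fun (p : ℕ × ℕ) i' => ¬ σ.Mismatch D K p.2 [] i')
      (computablePred_comp (computablePred_mismatch_nil hL hD hsat K)
        ((Computable.snd.comp Computable.fst).pair Computable.snd)).not Computable.fst
  have hex : ∀ i, ∃ j, ∀ i' < i, ¬ σ.Mismatch D K j [] i' := fun i => ⟨m i, hm i⟩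
  refine ⟨_, Computable.find (P := fun i j => ∀ i' < i, ¬ σ.Mismatch D K j [] i') hdec hex,
    hf.isMComputable hL hD hsat ρ ?_⟩
  rw [isMContinuous_iff hK hf]
  exact fun i => Nat.find_spec (hex i)

end RegisterSystem

end DataWord

theorem mainTheorem4_general {L : FirstOrder.Language}
    [Encodable (Σ n, L.Functions n)] [Encodable (Σ n, L.Relations n)]
    (hL : DataWord.IsRelConst L) {D : Type*} [Nonempty D] [L.Structure D]
    (hD : DataWord.Oligomorphic L D) (hsat : DataWord.DecidableSat L D)
    (ρ : DataWord.Representation L D)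
    {Q R : Type*} [Finite Q] [Finite R] (T : DataWord.NRT L Q R)
    (f : (ℕ → D) →. (ℕ → D)) (hf : T.Defines f) (m : ℕ → ℕ) :
    (DataWord.IsComputable ρ f ↔ DataWord.IsContinuous f) ∧
    (DataWord.IsUniformlyComputable ρ f ↔ DataWord.IsUniformlyContinuous f) ∧
    (DataWord.IsMComputable ρ f m ↔ DataWord.IsMContinuous f m) := by
  have := T.finite_Δ.to_subtype
  obtain ⟨nT, ⟨eT⟩⟩ := Finite.exists_equiv_fin T.Δ
  obtain ⟨k, ⟨eR⟩⟩ := Finite.exists_equiv_fin R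
  have hσ := DataWord.NRT.definesFun_toRegisterSystem (eT := eT) (eR := eR) hf
  exact ⟨⟨fun h => h.isContinuous, hσ.isComputable hL hD hsat ρ⟩,
    ⟨fun h => h.isUniformlyContinuous, hσ.isUniformlyComputable hL hD hsat ρ⟩,
    ⟨fun h => h.isMContinuous, hσ.isMComputable hL hD hsat ρ⟩⟩

theorem mainTheorem4 {L : FirstOrder.Language} [Finite L.Symbols]
    [Encodable (Σ n, L.Functions n)] [Encodable (Σ n, L.Relations n)]
    (hL : DataWord.IsRelConst L)
    {D : Type*} [Countable D] [Infinite D] [L.Structure D]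
    (hD : DataWord.Oligomorphic L D) (hdec : DataWord.DecidableStructure L D)
    (ρ : DataWord.Representation L D)
    {Q R : Type*} [Finite Q] [Finite R] (T : DataWord.NRT L Q R)
    (f : (ℕ → D) →. (ℕ → D)) (hf : T.Defines f) (m : ℕ → ℕ) :
    (DataWord.IsComputable ρ f ↔ DataWord.IsContinuous f) ∧
    (DataWord.IsUniformlyComputable ρ f ↔ DataWord.IsUniformlyContinuous f) ∧
    (DataWord.IsMComputable ρ f m ↔ DataWord.IsMContinuous f m) :=
  mainTheorem4_general hL hD hdec.2 ρ T f hf m
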